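/- Let $(\Sigma_1,g_1)$ and $(\Sigma_2,g_2)$ be smooth oriented Riemannian surfaces. **Configuration space.** $C(\Sigma_1,\Sigma_2)$ is the set of triples $(x,\hat x,A)$ with $x\in\Sigma_1$, $\hat x\in\Sigma_2$ and $A:T_x\Sigma_1\to T_{\hat x}\Sigma_2$ an orientation-preserving linear isometry. It is a smooth circle bundle over $\Sigma_1\times\Sigma_2$: over local oriented orthonormal frames $(e_1,e_2)$ of $\Sigma_1$ and $(e_3,e_4)$ of $\Sigma_2$ it has the trivialization $(x,\hat x,\phi)$, where $Ae_1=\cos\phi\,e_3+\sin\phi\,e_4$ and $Ae_2=-\sin\phi\,e_3+\cos\phi\,e_4$. A smooth curve $(x(t),\hat x(t),A(t))$ in $C(\Sigma_1,\Sigma_2)$ is a motion *without slipping* if $A(t)\dot x(t)=\dot{\hat x}(t)$ for all $t$, and *without twisting* if, for every vector field $v(t)$ parallel along $x(t)$, the vector field $A(t)v(t)$ is parallel along $\hat x(t)$ (for the Levi-Civita connections of $g_1$ and $g_2$). The *velocity distribution* $\mathcal D_v\subset TC(\Sigma_1,\Sigma_2)$ consists of the velocities at $t=0$ of all smooth motions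 without slipping and twisting that are defined for $t$ near $0$. **Twistor bundle.** Let $M$ be an oriented 4-manifold with a smooth metric $g$ of signature $(+,+,-,-)$. In an oriented orthonormal basis $(e_1,e_2,e_3,e_4)$ of a tangent space, with $g=\mathrm{diag}(1,1,-1,-1)$, the Hodge star on bivectors is $e_1\wedge e_2\leftrightarrow e_3\wedge e_4$, $e_1\wedge e_3\leftrightarrow e_2\wedge e_4$, $e_1\wedge e_4\leftrightarrow -e_2\wedge e_3$. A 2-plane $N\subset T_yM$ is *totally null* if $g$ vanishes on $N$, and *selfdual* if $*(u\wedge v)=u\wedge v$ for all $u,v\in N$. The *twistor bundle* $\mathbb T(M)$ is the set of pairs $(y,N)$ with $y\in M$ and $N\subset T_yM$ a selfdual totally null plane. It is a smooth circle bundle over $M$: over a local oriented orthonormal frame it has the trivialization $(y,\phi)$, where $N=\mathrm{Span}(e_1+\cos\phi\,e_3+\sin\phi\,e_4,\ e_2-\sin\phi\,e_3+\cos\phi\,e_4)$. The *horizontal lift* of $Y\in T_yM$ to $(y,N)$ is the velocity at $t=0$ of the curve of planes obtained by parallel transport of $N$, for the Levi-Civita connection of $g$, along a curve $y(t)$ with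 $y(0)=y$ and $\dot y(0)=Y$. The *twistor distribution* $\mathcal D\subset T\mathbb T(M)$ consists at $(y,N)$ of the horizontal lifts to $(y,N)$ of all $Y\in N$. **Theorem.** Let $M=\Sigma_1\times\Sigma_2$ with the product orientation and the metric $g=g_1\oplus(-g_2)$. For each $(x,\hat x,A)\in C(\Sigma_1,\Sigma_2)$, the graph of $A$, $\{(u,Au): u\in T_x\Sigma_1\}\subset T_{(x,\hat x)}M$, is a selfdual totally null plane, and the map $$\Phi:C(\Sigma_1,\Sigma_2)\to\mathbb T(\Sigma_1\times\Sigma_2),\qquad \Phi(x,\hat x,A)=\big((x,\hat x),\ \mathrm{graph}\,A\big),$$ is a diffeomorphism over $\Sigma_1\times\Sigma_2$. Moreover, $\mathcal D_v$ and $\mathcal D$ are fields of 2-planes (2-dimensional linear subspaces of the tangent spaces, one at each point), and $\Phi$ identifies them: $d\Phi(\mathcal D_v)=\mathcal D$. -/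

import Mathlib

open Set Function Manifold Bundle Module
open scoped Topology ContDiff

noncomputable section

/-- A point of a bundle: a point `base` of the base and a point `fiber` of the fibre over it. -/
@[ext] structure BundlePoint {B : Type*} (E : B → Type*) where
  base : B
  fiber : E base

/-- Data turning a family of sets `E y`, `y ∈ B`, into a smooth circle bundle over `B`: a covering
of `B` by open sets `dom i`, over each of them a parametrization of the fibres by the unit circle,
any two of which differ by a smooth map on the overlap. -/
structure CircleAtlas {EB : Type*} [NormedAddCommGroup EB] [NormedSpace ℝ EB]
    {HB : Type*} [TopologicalSpace HB] (IB : ModelWithCorners ℝ EB HB)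
    {B : Type*} [TopologicalSpace B] [ChartedSpace HB B] (E : B → Type*) where
  ι : Type*
  dom : ι → Set B
  isOpen_dom : ∀ i, IsOpen (dom i)
  exists_mem : ∀ y, ∃ i, y ∈ dom i
  angle : ∀ i y, y ∈ dom i → E y ≃ Circle
  smooth_change : ∀ i j, ∃ τ : B × Circle → Circle,
    ContMDiffOn (IB.prod (𝓡 1)) (𝓡 1) ∞ τ ((dom i ∩ dom j) ×ˢ univ) ∧
    ∀ y (hi : y ∈ dom i) (hj : y ∈ dom j) (a : E y), angle j y hj a = τ (y, angle i y hi a)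

namespace CircleAtlas

variable {EB : Type*} [NormedAddCommGroup EB] [NormedSpace ℝ EB]
    {HB : Type*} [TopologicalSpace HB] {IB : ModelWithCorners ℝ EB HB}
    {B : Type*} [TopologicalSpace B] [ChartedSpace HB B] {E : B → Type*}

open Classical in
/-- The local trivialization `(y, a) ↦ (y, angle of a)` over `dom i`. -/
def triv (c : CircleAtlas IB E) (i : c.ι) : PartialEquiv (BundlePoint E) (B × Circle) where
  toFun p := (p.base, if h : p.base ∈ c.dom i then c.angle i p.base h p.fiber else 1)
  invFun q := ⟨q.1, if h : q.1 ∈ c.dom i then (c.angle i q.1 h).symm q.2 else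
    (c.angle (c.exists_mem q.1).choose q.1 (c.exists_mem q.1).choose_spec).symm 1⟩
  source := {p | p.base ∈ c.dom i}
  target := c.dom i ×ˢ univ
  map_source' p hp := ⟨hp, mem_univ _⟩
  map_target' q hq := by
    have h : q.1 ∈ c.dom i := hq.1
    simp [h]
  left_inv' p hp := by
    have h : p.base ∈ c.dom i := hp
    simp [h]
  right_inv' q hq := by
    have h : q.1 ∈ c.dom i := hq.1
    simp [h]

theorem triv_trans_source (c : CircleAtlas IB E) (i j : c.ι) :
    ((c.triv i).symm.trans (c.triv j)).source = (c.dom i ∩ c.dom j) ×ˢ univ := by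
  ext q
  simp only [PartialEquiv.trans_source, PartialEquiv.symm_source, triv, mem_inter_iff, mem_prod,
    mem_univ, and_true, mem_preimage, mem_ofPred_eq]
  refine and_congr_right fun h => ?_
  simp [PartialEquiv.symm, h]

theorem triv_trans_contMDiffOn (c : CircleAtlas IB E) (i j : c.ι) :
    ContMDiffOn (IB.prod (𝓡 1)) (IB.prod (𝓡 1)) ∞ ((c.triv i).symm.trans (c.triv j))
      ((c.dom i ∩ c.dom j) ×ˢ univ) := by
  obtain ⟨τ, hτ, h⟩ := c.smooth_change i j
  refine (contMDiffOn_fst.prodMk hτ).congr ?_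
  rintro ⟨y, a⟩ ⟨⟨hi, hj⟩, -⟩
  have hi' : y ∈ c.dom i := hi
  have hj' : y ∈ c.dom j := hj
  simp [triv, PartialEquiv.symm, hi', hj', h y hi' hj']

/-- The smooth atlas of the total space, with charts valued in `B × Circle`. -/
def core (c : CircleAtlas IB E) : ChartedSpaceCore (B × Circle) (BundlePoint E) where
  atlas := range c.triv
  chartAt p := c.triv (c.exists_mem p.base).choose
  mem_chart_source p := (c.exists_mem p.base).choose_spec
  chart_mem_atlas p := mem_range_self _
  open_source := by
    rintro _ _ ⟨i, rfl⟩ ⟨j, rfl⟩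
    rw [triv_trans_source]
    exact ((c.isOpen_dom i).inter (c.isOpen_dom j)).prod isOpen_univ
  continuousOn_toFun := by
    rintro _ _ ⟨i, rfl⟩ ⟨j, rfl⟩
    rw [triv_trans_source]
    exact (c.triv_trans_contMDiffOn i j).continuousOn

/-- The topology of the total space. -/
@[reducible] def topology (c : CircleAtlas IB E) : TopologicalSpace (BundlePoint E) :=
  c.core.toTopologicalSpace

/-- The manifold structure of the total space, modelled on `HB × ℝ`. -/
@[reducible] def chartedSpace (c : CircleAtlas IB E) :
    @ChartedSpace (ModelProd HB (EuclideanSpace ℝ (Fin 1))) _ (BundlePoint E) c.topology :=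
  letI := c.topology
  letI : ChartedSpace (B × Circle) (BundlePoint E) := c.core.toChartedSpace
  ChartedSpace.comp _ (B × Circle) (BundlePoint E)

/-- Smooth maps of a manifold, as a pregroupoid. -/
def smoothPregroupoid {E' : Type*} [NormedAddCommGroup E'] [NormedSpace ℝ E']
    {H' : Type*} [TopologicalSpace H'] (I' : ModelWithCorners ℝ E' H')
    (M : Type*) [TopologicalSpace M] [ChartedSpace H' M] : Pregroupoid M where
  property f s := ContMDiffOn I' I' ∞ f s
  comp {f g u v} hf hg _ _ _ := hg.comp' hf
  id_mem := contMDiffOn_id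
  locality {f u} _ h x hx := by
    obtain ⟨v, hv, hxv, h⟩ := h x hx
    exact (contMDiffWithinAt_inter (hv.mem_nhds hxv)).1 (h x ⟨hx, hxv⟩)
  congr {f g u} _ h hf := hf.congr h

theorem isManifold (c : CircleAtlas IB E) [IsManifold IB ∞ B] :
    @IsManifold ℝ _ _ _ _ _ _ (IB.prod (𝓡 1)) ∞ (BundlePoint E) c.topology c.chartedSpace := by
  let _ := c.topology
  let _ : ChartedSpace (B × Circle) (BundlePoint E) := c.core.toChartedSpace
  let _ := c.chartedSpace
  have : IsManifold (𝓡 1) ∞ Circle := IsManifold.of_le (n := ω) le_top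
  have : HasGroupoid (BundlePoint E) (smoothPregroupoid (IB.prod (𝓡 1)) (B × Circle)).groupoid := by
    refine hasGroupoid_of_pregroupoid _ ?_
    intro e e' he he'
    obtain ⟨i, rfl⟩ : ∃ i, e = c.core.openPartialHomeomorph (c.triv i) (mem_range_self i) := by
      obtain ⟨_, ⟨i, rfl⟩, h⟩ := mem_iUnion₂.1 he
      exact ⟨i, h⟩
    obtain ⟨j, rfl⟩ : ∃ i, e' = c.core.openPartialHomeomorph (c.triv i) (mem_range_self i) := by
      obtain ⟨_, ⟨i, rfl⟩, h⟩ := mem_iUnion₂.1 he'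
      exact ⟨i, h⟩
    have h := c.triv_trans_contMDiffOn i j
    rw [← triv_trans_source] at h
    exact h
  refine { StructureGroupoid.HasGroupoid.comp
    (smoothPregroupoid (IB.prod (𝓡 1)) (B × Circle)).groupoid ?_ with }
  intro e he
  rw [mem_groupoid_of_pregroupoid] at he
  rw [isLocalStructomorphOn_contDiffGroupoid_iff]
  exact he

end CircleAtlas


/-- A basis is orthonormal for a form `g` of signature `η` if its Gram matrix is `diag η`. -/
def IsOrthoBasis {n : ℕ} {V : Type*} [AddCommGroup V] [Module ℝ V] (g : LinearMap.BilinForm ℝ V)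
    (η : Fin n → ℝ) (b : Basis (Fin n) ℝ V) : Prop :=
  ∀ i j, g (b i) (b j) = Matrix.diagonal η i j

/-- The signature `(+,+,-,-)`. -/
def splitSig : Fin 4 → ℝ := ![1, 1, -1, -1]

section LinearAlgebra

variable {V : Type*} [AddCommGroup V] [Module ℝ V]

/-- The simple bivector `u ∧ v`. -/
def wedge (u v : V) : ⋀[ℝ]^2 V := exteriorPower.ιMulti ℝ 2 ![u, v]

/-- The linear functional on bivectors with `u ∧ v ↦ uᵢ vⱼ - uⱼ vᵢ`, i.e. the coefficient at
`bᵢ ∧ bⱼ` (for `i < j`) in the basis of bivectors given by `b`. -/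
def bivectorCoord (b : Basis (Fin 4) ℝ V) (i j : Fin 4) : ⋀[ℝ]^2 V →ₗ[ℝ] ℝ :=
  exteriorPower.alternatingMapLinearEquiv
    (Matrix.detRowAlternating.compLinearMap (LinearMap.pi fun k => b.coord (![i, j] k)))

/-- The Hodge star on bivectors of a space with a metric of signature `(+,+,-,-)`, in an oriented
orthonormal basis `b = (e₁, e₂, e₃, e₄)`: `e₁∧e₂ ↔ e₃∧e₄`, `e₁∧e₃ ↔ e₂∧e₄`, `e₁∧e₄ ↔ -e₂∧e₃`. -/
def hodgeStar (b : Basis (Fin 4) ℝ V) : ⋀[ℝ]^2 V →ₗ[ℝ] ⋀[ℝ]^2 V :=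
  (bivectorCoord b 0 1).smulRight (wedge (b 2) (b 3)) +
  (bivectorCoord b 2 3).smulRight (wedge (b 0) (b 1)) +
  (bivectorCoord b 0 2).smulRight (wedge (b 1) (b 3)) +
  (bivectorCoord b 1 3).smulRight (wedge (b 0) (b 2)) -
  (bivectorCoord b 0 3).smulRight (wedge (b 1) (b 2)) -
  (bivectorCoord b 1 2).smulRight (wedge (b 0) (b 3))

/-- A totally null plane of the form `g`. -/
structure IsNullPlane (g : LinearMap.BilinForm ℝ V) (N : Submodule ℝ V) : Prop where
  finrank_eq : finrank ℝ N = 2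
  null : ∀ u ∈ N, ∀ v ∈ N, g u v = 0

/-- A selfdual totally null plane: its bivectors are fixed by the Hodge star (of the
form `g` and the orientation `o`). -/
structure IsSelfdualNullPlane (g : LinearMap.BilinForm ℝ V) (o : Orientation ℝ V (Fin 4))
    (N : Submodule ℝ V) : Prop extends IsNullPlane g N where
  selfdual : ∀ b : Basis (Fin 4) ℝ V, IsOrthoBasis g splitSig b → b.orientation = o →
    ∀ u ∈ N, ∀ v ∈ N, hodgeStar b (wedge u v) = wedge u v

theorem bivectorCoord_wedge (b : Basis (Fin 4) ℝ V) (i j : Fin 4) (u v : V) :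
    bivectorCoord b i j (wedge u v) = b.repr u i * b.repr v j - b.repr u j * b.repr v i := by
  have h : bivectorCoord b i j (wedge u v) =
      Matrix.det (Matrix.of fun k l : Fin 2 => b.coord (![i, j] l) (![u, v] k)) := by
    simp only [bivectorCoord, wedge, exteriorPower.alternatingMapLinearEquiv_apply_ιMulti]
    rfl
  rw [h, Matrix.det_fin_two]
  simp

theorem bivectorCoord_injective (b : Basis (Fin 4) ℝ V) {α β : ⋀[ℝ]^2 V}
    (h : ∀ i j, i < j → bivectorCoord b i j α = bivectorCoord b i j β) : α = β := by
  have key : (bivectorCoord b 0 1).smulRight (wedge (b 0) (b 1)) +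
      (bivectorCoord b 0 2).smulRight (wedge (b 0) (b 2)) +
      (bivectorCoord b 0 3).smulRight (wedge (b 0) (b 3)) +
      (bivectorCoord b 1 2).smulRight (wedge (b 1) (b 2)) +
      (bivectorCoord b 1 3).smulRight (wedge (b 1) (b 3)) +
      (bivectorCoord b 2 3).smulRight (wedge (b 2) (b 3)) = LinearMap.id := by
    apply exteriorPower.linearMap_ext
    refine Basis.ext_alternating b fun v hv => ?_
    have hd : ∀ x y : V, wedge y x = - wedge x y := by
      intro x y
      have := (exteriorPower.ιMulti ℝ 2 (M := V)).map_swap ![x, y] (i := 0) (j := 1) (by decide)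
      rw [wedge, wedge, ← this]
      congr 1
      ext i
      fin_cases i <;> rfl
    have e : (fun i => b (v i)) = ![b (v 0), b (v 1)] := by
      ext i; fin_cases i <;> rfl
    have h01 : v 0 ≠ v 1 := fun h => by simpa using hv h
    rw [e]
    generalize v 0 = p at *
    generalize v 1 = q at *
    change _ = wedge (b p) (b q)
    simp only [LinearMap.compAlternatingMap_apply, LinearMap.add_apply, LinearMap.smulRight_apply]
    change bivectorCoord b 0 1 (wedge _ _) • _ + bivectorCoord b 0 2 (wedge _ _) • _ +
      bivectorCoord b 0 3 (wedge _ _) • _ + bivectorCoord b 1 2 (wedge _ _) • _ +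
      bivectorCoord b 1 3 (wedge _ _) • _ + bivectorCoord b 2 3 (wedge _ _) • _ = _
    simp only [bivectorCoord_wedge, Basis.repr_self]
    fin_cases p <;> fin_cases q <;> first | (exact absurd rfl h01) | (simp; try exact (hd _ _).symm)
  rw [← LinearMap.id_apply (R := ℝ) α, ← LinearMap.id_apply (R := ℝ) β, ← key]
  simp only [LinearMap.add_apply, LinearMap.smulRight_apply]
  rw [h 0 1 (by decide), h 0 2 (by decide), h 0 3 (by decide), h 1 2 (by decide),
    h 1 3 (by decide), h 2 3 (by decide)]

theorem hodgeStar_wedge_eq_iff (b : Basis (Fin 4) ℝ V) (u v : V) :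
    hodgeStar b (wedge u v) = wedge u v ↔
      bivectorCoord b 0 1 (wedge u v) = bivectorCoord b 2 3 (wedge u v) ∧
      bivectorCoord b 0 2 (wedge u v) = bivectorCoord b 1 3 (wedge u v) ∧
      bivectorCoord b 0 3 (wedge u v) = - bivectorCoord b 1 2 (wedge u v) := by
  have hs : ∀ i j, bivectorCoord b i j (hodgeStar b (wedge u v)) =
      bivectorCoord b 0 1 (wedge u v) * bivectorCoord b i j (wedge (b 2) (b 3)) +
      bivectorCoord b 2 3 (wedge u v) * bivectorCoord b i j (wedge (b 0) (b 1)) +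
      bivectorCoord b 0 2 (wedge u v) * bivectorCoord b i j (wedge (b 1) (b 3)) +
      bivectorCoord b 1 3 (wedge u v) * bivectorCoord b i j (wedge (b 0) (b 2)) -
      bivectorCoord b 0 3 (wedge u v) * bivectorCoord b i j (wedge (b 1) (b 2)) -
      bivectorCoord b 1 2 (wedge u v) * bivectorCoord b i j (wedge (b 0) (b 3)) := by
    intro i j
    simp only [hodgeStar, LinearMap.add_apply, LinearMap.sub_apply, LinearMap.smulRight_apply,
      map_add, map_sub, map_smul, smul_eq_mul]
  simp only [bivectorCoord_wedge b _ _ (b _) (b _), Basis.repr_self] at hs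
  constructor
  · intro h
    have h1 := hs 0 1
    have h2 := hs 0 2
    have h3 := hs 0 3
    rw [h] at h1 h2 h3
    simp at h1 h2 h3
    exact ⟨h1, h2, by linarith⟩
  · rintro ⟨h1, h2, h3⟩
    apply bivectorCoord_injective b
    intro i j hij
    rw [hs]
    fin_cases i <;> fin_cases j <;> first | (exact absurd hij (by decide)) | (simp; linarith)


theorem exists_circle_coe_eq {z : ℂ} (h : ‖z‖ = 1) : ∃ c : Circle, (c : ℂ) = z :=
  ⟨⟨z, mem_sphere_zero_iff_norm.2 h⟩, rfl⟩

theorem IsOrthoBasis.apply_eq {g : LinearMap.BilinForm ℝ V} {b : Basis (Fin 4) ℝ V}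
    (hb : IsOrthoBasis g splitSig b) (u v : V) :
    g u v = b.repr u 0 * b.repr v 0 + b.repr u 1 * b.repr v 1 - b.repr u 2 * b.repr v 2 -
      b.repr u 3 * b.repr v 3 := by
  have h : ∀ i j, g (b i) (b j) = Matrix.diagonal splitSig i j := hb
  have hu := b.sum_repr u
  have hv := b.sum_repr v
  rw [Fin.sum_univ_four] at hu hv
  conv_lhs => rw [← hu, ← hv]
  simp only [map_add, map_smul, LinearMap.add_apply, LinearMap.smul_apply, h]
  simp [splitSig]
  ring

theorem IsOrthoBasis.det_eq {g : LinearMap.BilinForm ℝ V} {b b' : Basis (Fin 4) ℝ V}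
    (hb : IsOrthoBasis g splitSig b)
    (hb' : IsOrthoBasis g splitSig b') (ho : b.orientation = b'.orientation) :
    b.det = b'.det := by
  have h1 : LinearMap.BilinForm.toMatrix b g = Matrix.diagonal splitSig := by
    ext i j; rw [LinearMap.BilinForm.toMatrix_apply]; exact hb i j
  have h2 : LinearMap.BilinForm.toMatrix b' g = Matrix.diagonal splitSig := by
    ext i j; rw [LinearMap.BilinForm.toMatrix_apply]; exact hb' i j
  have h3 := LinearMap.BilinForm.toMatrix_mul_basis_toMatrix b b' g
  rw [h1, h2] at h3
  have h4 := congrArg Matrix.det h3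
  have hd : (Matrix.diagonal splitSig).det = 1 := by
    simp [splitSig, Fin.prod_univ_four]
  rw [Matrix.det_mul, Matrix.det_mul, Matrix.det_transpose, hd] at h4
  have hp := (b.orientation_eq_iff_det_pos b').1 ho
  rw [Basis.det_apply] at hp
  have h5 : (b.toMatrix b').det = 1 := by nlinarith
  have h6 := AlternatingMap.eq_smul_basis_det b' b.det
  rw [h6, Basis.det_apply, h5, one_smul]

theorem hodgeStar_wedge_eq_iff_det {g : LinearMap.BilinForm ℝ V} {b : Basis (Fin 4) ℝ V}
    (hb : IsOrthoBasis g splitSig b) (u v : V) :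
    hodgeStar b (wedge u v) = wedge u v ↔
      ∀ x y, b.det ![x, y, u, v] = g x u * g y v - g x v * g y u := by
  have hdet : ∀ x y, b.det ![x, y, u, v] = Matrix.det
      !![b.repr x 0, b.repr y 0, b.repr u 0, b.repr v 0;
         b.repr x 1, b.repr y 1, b.repr u 1, b.repr v 1;
         b.repr x 2, b.repr y 2, b.repr u 2, b.repr v 2;
         b.repr x 3, b.repr y 3, b.repr u 3, b.repr v 3] := by
    intro x y
    rw [Basis.det_apply]
    congr 1
    ext i j
    fin_cases i <;> fin_cases j <;> rfl
  rw [hodgeStar_wedge_eq_iff]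
  simp only [hb.apply_eq, hdet, bivectorCoord_wedge]
  constructor
  · rintro ⟨h1, h2, h3⟩ x y
    simp [Matrix.det_succ_row_zero, Fin.sum_univ_succ, Fin.succAbove]
    generalize b.repr x = x at *
    generalize b.repr y = y at *
    generalize b.repr u = u at *
    generalize b.repr v = v at *
    linear_combination (-(x 0 * y 1 - x 1 * y 0) + (x 2 * y 3 - x 3 * y 2)) * h1 +
      ((x 0 * y 2 - x 2 * y 0) - (x 1 * y 3 - x 3 * y 1)) * h2 +
      ((x 0 * y 3 - x 3 * y 0) + (x 1 * y 2 - x 2 * y 1)) * h3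
  · intro h
    have h1 := h (b 0) (b 1)
    have h2 := h (b 0) (b 2)
    have h3 := h (b 0) (b 3)
    simp [Matrix.det_succ_row_zero, Fin.sum_univ_succ, Fin.succAbove] at h1 h2 h3
    refine ⟨?_, ?_, ?_⟩ <;> linarith

/-- Selfduality may be tested in any one oriented orthonormal basis. -/
theorem isSelfdualNullPlane_iff {g : LinearMap.BilinForm ℝ V} {b : Basis (Fin 4) ℝ V}
    {o : Orientation ℝ V (Fin 4)}
    (hb : IsOrthoBasis g splitSig b) (ho : b.orientation = o)
    (N : Submodule ℝ V) :
    IsSelfdualNullPlane g o N ↔ IsNullPlane g N ∧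
      ∀ u ∈ N, ∀ v ∈ N, hodgeStar b (wedge u v) = wedge u v := by
  refine ⟨fun h => ⟨h.1, h.2 b hb ho⟩, fun h => ⟨h.1, fun b' hb' ho' u hu v hv => ?_⟩⟩
  rw [hodgeStar_wedge_eq_iff_det hb', ← hb.det_eq hb' (ho.trans ho'.symm),
    ← hodgeStar_wedge_eq_iff_det hb]
  exact h.2 u hu v hv

/-- The plane spanned by `e₁ + cos φ e₃ + sin φ e₄` and `e₂ - sin φ e₃ + cos φ e₄`, where
`c = exp (iφ)` and `b = (e₁, e₂, e₃, e₄)`. -/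
def circlePlane (b : Basis (Fin 4) ℝ V) (c : Circle) : Submodule ℝ V :=
  Submodule.span ℝ {b 0 + (c : ℂ).re • b 2 + (c : ℂ).im • b 3,
    b 1 - (c : ℂ).im • b 2 + (c : ℂ).re • b 3}

/-- The complex number `vᵢ + √-1 vⱼ`. -/
def complexCoord {n : ℕ} (b : Basis (Fin n) ℝ V) (i j : Fin n) (v : V) : ℂ :=
  ⟨b.repr v i, b.repr v j⟩

theorem mem_circlePlane (b : Basis (Fin 4) ℝ V) (c : Circle) (v : V) :
    v ∈ circlePlane b c ↔ complexCoord b 2 3 v = c * complexCoord b 0 1 v := by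
  rw [circlePlane, Submodule.mem_span_pair, Complex.ext_iff]
  simp only [complexCoord, Complex.mul_re, Complex.mul_im]
  constructor
  · rintro ⟨s, t, rfl⟩
    simp
    constructor <;> ring
  · rintro ⟨h1, h2⟩
    refine ⟨b.repr v 0, b.repr v 1, ?_⟩
    apply b.ext_elem
    intro i
    fin_cases i <;> simp [h1, h2] <;> ring

theorem finrank_circlePlane (b : Basis (Fin 4) ℝ V) (c : Circle) :
    finrank ℝ (circlePlane b c) = 2 := by
  have : LinearIndependent ℝ ![b 0 + (c : ℂ).re • b 2 + (c : ℂ).im • b 3,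
    b 1 - (c : ℂ).im • b 2 + (c : ℂ).re • b 3] := by
    rw [LinearIndependent.pair_iff]
    intro s t h
    have h0 := congrArg (fun w => b.repr w 0) h
    have h1 := congrArg (fun w => b.repr w 1) h
    simp at h0 h1
    exact ⟨h0, h1⟩
  have h := finrank_span_eq_card this
  rw [Matrix.range_cons, Matrix.range_cons, Matrix.range_empty, union_empty,
    singleton_union] at h
  exact h.trans (by simp)

theorem circlePlane_injective (b : Basis (Fin 4) ℝ V) : Injective (circlePlane b) := by
  intro c d h
  have : b 0 + (c : ℂ).re • b 2 + (c : ℂ).im • b 3 ∈ circlePlane b d :=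
    h ▸ Submodule.subset_span (by simp)
  rw [mem_circlePlane] at this
  simp [complexCoord] at this
  ext
  rw [Complex.ext_iff] at this ⊢
  simpa using this

theorem isSelfdualNullPlane_circlePlane {g : LinearMap.BilinForm ℝ V} {b : Basis (Fin 4) ℝ V}
    {o : Orientation ℝ V (Fin 4)}
    (hb : IsOrthoBasis g splitSig b) (ho : b.orientation = o) (c : Circle) :
    IsSelfdualNullPlane g o (circlePlane b c) := by
  have hc : (c : ℂ).re ^ 2 + (c : ℂ).im ^ 2 = 1 := by
    have := c.normSq_coe
    rw [Complex.normSq_apply] at this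
    linarith
  rw [isSelfdualNullPlane_iff hb ho]
  refine ⟨⟨finrank_circlePlane b c, ?_⟩, ?_⟩
  · intro u hu v hv
    rw [mem_circlePlane, Complex.ext_iff] at hu hv
    simp only [complexCoord, Complex.mul_re, Complex.mul_im] at hu hv
    simp only [hb.apply_eq, hu, hv]
    generalize b.repr u = u at *
    generalize b.repr v = v at *
    linear_combination (-(u 0 * v 0 + u 1 * v 1)) * hc
  · intro u hu v hv
    rw [mem_circlePlane, Complex.ext_iff] at hu hv
    simp only [complexCoord, Complex.mul_re, Complex.mul_im] at hu hv
    rw [hodgeStar_wedge_eq_iff]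
    simp only [bivectorCoord_wedge, hu, hv]
    generalize b.repr u = u at *
    generalize b.repr v = v at *
    refine ⟨?_, ?_, ?_⟩
    · linear_combination (-(u 0 * v 1 - u 1 * v 0)) * hc
    · ring
    · ring

theorem exists_eq_circlePlane {g : LinearMap.BilinForm ℝ V} {b : Basis (Fin 4) ℝ V}
    {o : Orientation ℝ V (Fin 4)}
    (hb : IsOrthoBasis g splitSig b) (ho : b.orientation = o)
    (N : Submodule ℝ V) (hN : IsSelfdualNullPlane g o N) :
    ∃ c, circlePlane b c = N := by
  have : FiniteDimensional ℝ V := Module.Finite.of_basis b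
  let f : N →ₗ[ℝ] (Fin 2 → ℝ) := LinearMap.pi ![(b.coord 0).comp N.subtype,
    (b.coord 1).comp N.subtype]
  have hf0 : ∀ n, f n 0 = b.repr (n : V) 0 := fun n => rfl
  have hf1 : ∀ n, f n 1 = b.repr (n : V) 1 := fun n => rfl
  have hinj : Injective f := by
    rw [← LinearMap.ker_eq_bot, LinearMap.ker_eq_bot']
    rintro ⟨n, hn⟩ h
    have h0 : b.repr n 0 = 0 := by rw [← hf0 ⟨n, hn⟩, h]; rfl
    have h1 : b.repr n 1 = 0 := by rw [← hf1 ⟨n, hn⟩, h]; rfl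
    have hnull := hN.null n hn n hn
    simp only [hb.apply_eq, h0, h1] at hnull
    have h2 : b.repr n 2 = 0 := by nlinarith [sq_nonneg (b.repr n 2), sq_nonneg (b.repr n 3)]
    have h3 : b.repr n 3 = 0 := by nlinarith [sq_nonneg (b.repr n 2), sq_nonneg (b.repr n 3)]
    ext
    apply b.ext_elem
    intro i
    fin_cases i <;> simp [h0, h1, h2, h3]
  have hsurj : Surjective f := by
    rw [← LinearMap.injective_iff_surjective_of_finrank_eq_finrank]
    · exact hinj
    · rw [hN.finrank_eq]; simp
  obtain ⟨⟨m, hm⟩, hm'⟩ := hsurj ![1, 0]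
  obtain ⟨⟨n, hn⟩, hn'⟩ := hsurj ![0, 1]
  have m0 : b.repr m 0 = 1 := by rw [← hf0 ⟨m, hm⟩, hm']; rfl
  have m1 : b.repr m 1 = 0 := by rw [← hf1 ⟨m, hm⟩, hm']; rfl
  have n0 : b.repr n 0 = 0 := by rw [← hf0 ⟨n, hn⟩, hn']; rfl
  have n1 : b.repr n 1 = 1 := by rw [← hf1 ⟨n, hn⟩, hn']; rfl
  have e1 := hN.null m hm m hm
  have e2 := hN.null m hm n hn
  have e3 := ((hodgeStar_wedge_eq_iff b m n).1 (hN.selfdual b hb ho m hm n hn)).1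
  simp only [hb.apply_eq, bivectorCoord_wedge, m0, m1, n0, n1] at e1 e2 e3
  set p := b.repr m 2
  set q := b.repr m 3
  have hn2 : b.repr n 2 = - q := by linear_combination (b.repr n 2) * e1 - p * e2 + q * e3
  have hn3 : b.repr n 3 = p := by linear_combination (b.repr n 3) * e1 - q * e2 - p * e3
  have hpq : ‖(⟨p, q⟩ : ℂ)‖ = 1 := by
    rw [← sq_eq_sq₀ (norm_nonneg _) zero_le_one, ← Complex.normSq_eq_norm_sq, Complex.normSq_apply]
    simp only; linarith
  obtain ⟨c, hc⟩ := exists_circle_coe_eq hpq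
  have hcp : (c : ℂ).re = p := by rw [hc]
  have hcq : (c : ℂ).im = q := by rw [hc]
  refine ⟨c, ?_⟩
  apply Submodule.eq_of_le_of_finrank_eq
  · rw [circlePlane, Submodule.span_le]
    rintro w (rfl | rfl)
    · change _ ∈ N
      convert hm using 1
      apply b.ext_elem
      intro i
      fin_cases i <;> simp [m0, m1, hcp, hcq, p, q]
    · change _ ∈ N
      convert hn using 1
      apply b.ext_elem
      intro i
      fin_cases i <;> simp [n0, n1, hn2, hn3, hcp, hcq]
  · rw [finrank_circlePlane, hN.finrank_eq]

/-- In an oriented orthonormal basis the selfdual totally null planes are parametrized by the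
circle. -/
def circlePlaneEquiv {g : LinearMap.BilinForm ℝ V} {b : Basis (Fin 4) ℝ V}
    {o : Orientation ℝ V (Fin 4)}
    (hb : IsOrthoBasis g splitSig b) (ho : b.orientation = o) :
    Circle ≃ {N : Submodule ℝ V // IsSelfdualNullPlane g o N} :=
  Equiv.ofBijective (fun c => ⟨circlePlane b c, isSelfdualNullPlane_circlePlane hb ho c⟩)
    ⟨fun _ _ h => circlePlane_injective b (congrArg Subtype.val h), fun N => by
      obtain ⟨c, hc⟩ := exists_eq_circlePlane hb ho N.1 N.2
      exact ⟨c, Subtype.ext hc⟩⟩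

variable {W : Type*} [AddCommGroup W] [Module ℝ W]

/-- The signature `(+,+)`. -/
def riemSig : Fin 2 → ℝ := ![1, 1]

/-- A rotation `A : V → W` between oriented Euclidean planes: an orientation preserving linear
isometry. -/
structure IsRotation (g : LinearMap.BilinForm ℝ V) (o : Orientation ℝ V (Fin 2))
    (h : LinearMap.BilinForm ℝ W) (o' : Orientation ℝ W (Fin 2)) (A : V ≃ₗ[ℝ] W) : Prop where
  isometry : ∀ u v, h (A u) (A v) = g u v
  oriented : Orientation.map (Fin 2) A o = o'

theorem IsOrthoBasis.apply_eq_two {g : LinearMap.BilinForm ℝ V} {b : Basis (Fin 2) ℝ V}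
    (hb : IsOrthoBasis g riemSig b) (u v : V) :
    g u v = b.repr u 0 * b.repr v 0 + b.repr u 1 * b.repr v 1 := by
  have h : ∀ i j, g (b i) (b j) = Matrix.diagonal riemSig i j := hb
  have hu := b.sum_repr u
  have hv := b.sum_repr v
  rw [Fin.sum_univ_two] at hu hv
  conv_lhs => rw [← hu, ← hv]
  simp only [map_add, map_smul, LinearMap.add_apply, LinearMap.smul_apply, h]
  simp [riemSig]
  ring

/-- The identification of a plane with a basis with `ℂ`. -/
def basisToComplex (b : Basis (Fin 2) ℝ V) : V ≃ₗ[ℝ] ℂ :=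
  b.equivFun.trans Complex.basisOneI.equivFun.symm

theorem basisToComplex_apply (b : Basis (Fin 2) ℝ V) (v : V) :
    basisToComplex b v = complexCoord b 0 1 v := by
  simp [basisToComplex, complexCoord, Complex.ext_iff]

/-- The rotation by the angle `φ`, `c = exp (iφ)`, in the bases `b` and `b'`. -/
def rotationMap (b : Basis (Fin 2) ℝ V) (b' : Basis (Fin 2) ℝ W) (c : Circle) : V ≃ₗ[ℝ] W :=
  (basisToComplex b).trans ((rotation c).toLinearEquiv.trans (basisToComplex b').symm)

theorem eq_rotationMap_iff (b : Basis (Fin 2) ℝ V) (b' : Basis (Fin 2) ℝ W) (c : Circle)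
    (A : V ≃ₗ[ℝ] W) :
    A = rotationMap b b' c ↔ ∀ v, complexCoord b' 0 1 (A v) = c * complexCoord b 0 1 v := by
  rw [LinearEquiv.ext_iff]
  refine forall_congr' fun v => ?_
  rw [rotationMap, LinearEquiv.trans_apply, LinearEquiv.trans_apply, LinearEquiv.eq_symm_apply,
    basisToComplex_apply, basisToComplex_apply]
  exact Iff.rfl

theorem rotationMap_apply_zero (b : Basis (Fin 2) ℝ V) (b' : Basis (Fin 2) ℝ W) (c : Circle) :
    rotationMap b b' c (b 0) = (c : ℂ).re • b' 0 + (c : ℂ).im • b' 1 := by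
  have h := (eq_rotationMap_iff b b' c _).1 rfl (b 0)
  simp only [complexCoord, Complex.ext_iff, Complex.mul_re, Complex.mul_im] at h
  simp at h
  apply b'.ext_elem
  intro i
  fin_cases i <;> simp [h]

theorem orientation_map_eq_iff (b : Basis (Fin 2) ℝ V) (b' : Basis (Fin 2) ℝ W)
    {o : Orientation ℝ V (Fin 2)} {o' : Orientation ℝ W (Fin 2)}
    (ho : b.orientation = o) (ho' : b'.orientation = o') (A : V ≃ₗ[ℝ] W) :
    Orientation.map (Fin 2) A o = o' ↔
      0 < b'.repr (A (b 0)) 0 * b'.repr (A (b 1)) 1 - b'.repr (A (b 1)) 0 * b'.repr (A (b 0)) 1 := by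
  rw [← ho, ← ho', ← Basis.orientation_map, eq_comm, Basis.orientation_eq_iff_det_pos,
    Basis.det_apply, Matrix.det_fin_two]
  simp [Basis.toMatrix_apply]

theorem isRotation_rotationMap {g : LinearMap.BilinForm ℝ V} {h : LinearMap.BilinForm ℝ W}
    {o : Orientation ℝ V (Fin 2)} {o' : Orientation ℝ W (Fin 2)}
    {b : Basis (Fin 2) ℝ V} {b' : Basis (Fin 2) ℝ W}
    (hb : IsOrthoBasis g riemSig b) (ho : b.orientation = o)
    (hb' : IsOrthoBasis h riemSig b') (ho' : b'.orientation = o') (c : Circle) :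
    IsRotation g o h o' (rotationMap b b' c) := by
  have hc : (c : ℂ).re ^ 2 + (c : ℂ).im ^ 2 = 1 := by
    have := c.normSq_coe
    rw [Complex.normSq_apply] at this
    linarith
  have key := (eq_rotationMap_iff b b' c _).1 rfl
  simp only [complexCoord, Complex.ext_iff, Complex.mul_re, Complex.mul_im] at key
  constructor
  · intro u v
    rw [hb.apply_eq_two, hb'.apply_eq_two, (key u).1, (key u).2, (key v).1, (key v).2]
    linear_combination (b.repr u 0 * b.repr v 0 + b.repr u 1 * b.repr v 1) * hc
  · rw [orientation_map_eq_iff b b' ho ho', (key _).1, (key _).2, (key _).1, (key _).2]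
    simp
    nlinarith

theorem exists_eq_rotationMap {g : LinearMap.BilinForm ℝ V} {h : LinearMap.BilinForm ℝ W}
    {o : Orientation ℝ V (Fin 2)} {o' : Orientation ℝ W (Fin 2)}
    {b : Basis (Fin 2) ℝ V} {b' : Basis (Fin 2) ℝ W}
    (hb : IsOrthoBasis g riemSig b) (ho : b.orientation = o)
    (hb' : IsOrthoBasis h riemSig b') (ho' : b'.orientation = o') (A : V ≃ₗ[ℝ] W)
    (hA : IsRotation g o h o' A) : ∃ c, rotationMap b b' c = A := by
  have e1 := hA.isometry (b 0) (b 0)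
  have e2 := hA.isometry (b 0) (b 1)
  have e3 := hA.isometry (b 1) (b 1)
  have e4 := (orientation_map_eq_iff b b' ho ho' A).1 hA.oriented
  simp only [hb.apply_eq_two, hb'.apply_eq_two, Basis.repr_self] at e1 e2 e3
  simp at e1 e2 e3
  set p := b'.repr (A (b 0)) 0
  set q := b'.repr (A (b 0)) 1
  set r := b'.repr (A (b 1)) 0 with hr
  set s := b'.repr (A (b 1)) 1 with hs
  have e5 : p * s - r * q = 1 := by
    have : (p * s - r * q) ^ 2 = 1 := by
      linear_combination (r * r + s * s) * e1 + e3 - (p * r + q * s) * e2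
    nlinarith
  have hr' : r = - q := by linear_combination (-r) * e1 + p * e2 - q * e5
  have hs' : s = p := by linear_combination (-s) * e1 + q * e2 + p * e5
  have hpq : ‖(⟨p, q⟩ : ℂ)‖ = 1 := by
    rw [← sq_eq_sq₀ (norm_nonneg _) zero_le_one, ← Complex.normSq_eq_norm_sq, Complex.normSq_apply]
    simp only; linarith
  obtain ⟨c, hc⟩ := exists_circle_coe_eq hpq
  refine ⟨c, ((eq_rotationMap_iff b b' c A).2 fun v => ?_).symm⟩
  have hv := b.sum_repr v
  rw [Fin.sum_univ_two] at hv
  have hAv : ∀ i, b'.repr (A v) i = b.repr v 0 * b'.repr (A (b 0)) i +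
      b.repr v 1 * b'.repr (A (b 1)) i := by
    intro i
    conv_lhs => rw [← hv]
    simp
  simp only [complexCoord, hAv, hc, Complex.ext_iff, Complex.mul_re, Complex.mul_im]
  rw [← hr, ← hs, hr', hs']
  constructor <;> ring

theorem rotationMap_injective (b : Basis (Fin 2) ℝ V) (b' : Basis (Fin 2) ℝ W) :
    Injective (rotationMap b b') := by
  intro c d h
  have h1 := (eq_rotationMap_iff b b' c _).1 rfl (b 0)
  have h2 := (eq_rotationMap_iff b b' d _).1 rfl (b 0)
  rw [h, h2] at h1
  have : complexCoord b 0 1 (b 0) = 1 := by simp [complexCoord, Complex.ext_iff]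
  rw [this, mul_one, mul_one] at h1
  exact (Circle.ext h1).symm

/-- In oriented orthonormal bases the rotations are parametrized by the circle. -/
def rotationEquiv {g : LinearMap.BilinForm ℝ V} {h : LinearMap.BilinForm ℝ W}
    {o : Orientation ℝ V (Fin 2)} {o' : Orientation ℝ W (Fin 2)}
    {b : Basis (Fin 2) ℝ V} {b' : Basis (Fin 2) ℝ W}
    (hb : IsOrthoBasis g riemSig b) (ho : b.orientation = o)
    (hb' : IsOrthoBasis h riemSig b') (ho' : b'.orientation = o') :
    Circle ≃ {A : V ≃ₗ[ℝ] W // IsRotation g o h o' A} :=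
  Equiv.ofBijective (fun c => ⟨rotationMap b b' c, isRotation_rotationMap hb ho hb' ho' c⟩)
    ⟨fun _ _ h => rotationMap_injective b b' (congrArg Subtype.val h), fun A => by
      obtain ⟨c, hc⟩ := exists_eq_rotationMap hb ho hb' ho' A.1 A.2
      exact ⟨c, Subtype.ext hc⟩⟩

end LinearAlgebra


section SmoothLemmas

variable {EX : Type*} [NormedAddCommGroup EX] [NormedSpace ℝ EX]
    {HX : Type*} [TopologicalSpace HX] {IX : ModelWithCorners ℝ EX HX}
    {X : Type*} [TopologicalSpace X] [ChartedSpace HX X]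

theorem contMDiffOn_sphere_of_coe {F : Type*} [NormedAddCommGroup F] [InnerProductSpace ℝ F]
    {n : ℕ} [Fact (finrank ℝ F = n + 1)] [IsManifold IX ∞ X]
    {f : X → Metric.sphere (0 : F) 1} {s : Set X}
    (hf : ContMDiffOn IX 𝓘(ℝ, F) ∞ (fun x => (f x : F)) s) : ContMDiffOn IX (𝓡 n) ∞ f s := by
  rw [contMDiffOn_iff_target]
  refine ⟨(Topology.IsInducing.subtypeVal.continuousOn_iff).2 hf.continuousOn, ?_⟩
  intro v
  let U : _ ≃ₗᵢ[ℝ] _ :=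
    (OrthonormalBasis.fromOrthogonalSpanSingleton n (ne_zero_of_mem_unit_sphere (-v))).repr
  have h : ContDiffOn ℝ ω _ Set.univ := U.contDiff.contDiffOn
  have H₁ := (h.comp_inter contDiffOn_stereoToFun).contMDiffOn
  convert! (H₁.of_le (m := ∞) le_top).comp' hf using 1
  ext x
  have hfxv : (f x : F) = -↑v ↔ inner ℝ (f x : F) (-↑v : F) = 1 := by
    have hfx : ‖(f x : F)‖ = 1 := by simp
    rw [inner_eq_one_iff_of_norm_eq_one hfx]
    exact norm_eq_of_mem_sphere (-v)
  simp [chartAt, ChartedSpace.chartAt, Subtype.ext_iff, hfxv, real_inner_comm]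

theorem contMDiffOn_circle_of_coe [IsManifold IX ∞ X] {f : X → Circle} {s : Set X}
    (hf : ContMDiffOn IX 𝓘(ℝ, ℂ) ∞ (fun x => (f x : ℂ)) s) : ContMDiffOn IX (𝓡 1) ∞ f s :=
  have : Fact (finrank ℝ ℂ = 1 + 1) := finrank_real_complex_fact'
  contMDiffOn_sphere_of_coe (F := ℂ) hf

variable [IsManifold IX ∞ X]

theorem contMDiffOn_frame_coord {n : ℕ} {vec : Fin n → ∀ y : X, TangentSpace IX y} {u s : Set X}
    (hvec : IsLocalFrameOn IX EX ∞ vec u) (hu : IsOpen u) (hs : IsOpen s) (hsu : s ⊆ u)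
    {v : ∀ y : X, TangentSpace IX y}
    (hv : ContMDiffOn IX IX.tangent ∞ (fun y => (⟨y, v y⟩ : TangentBundle IX X)) s) (i : Fin n) :
    ContMDiffOn IX 𝓘(ℝ, ℝ) ∞ (fun y => hvec.coeff i y (v y)) s := by
  intro y₀ hy₀
  apply ContMDiffAt.contMDiffWithinAt
  let e := trivializationAt EX (TangentSpace IX) y₀
  have hb : y₀ ∈ e.baseSet := FiberBundle.mem_baseSet_trivializationAt' y₀
  have hcoord : ∀ w : ∀ y : X, TangentSpace IX y,
      ContMDiffAt IX IX.tangent ∞ (fun y => (⟨y, w y⟩ : TangentBundle IX X)) y₀ →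
      ContMDiffAt IX 𝓘(ℝ, EX) ∞ (fun y => (e ⟨y, w y⟩).2) y₀ := by
    intro w hw
    exact ((Bundle.contMDiffAt_section (s := w) (x₀ := y₀)).1 hw)
  let L : X → (Fin n → ℝ) →L[ℝ] EX := fun y =>
    ∑ k, (ContinuousLinearMap.proj (R := ℝ) (φ := fun _ : Fin n => ℝ) k).smulRight
      ((e ⟨y, vec k y⟩).2)
  have hL : ContMDiffAt IX 𝓘(ℝ, (Fin n → ℝ) →L[ℝ] EX) ∞ L y₀ := by
    apply contMDiffAt_finsetSum
    intro k _
    have h1 := hcoord (vec k) (hvec.contMDiffAt hu (hsu hy₀) k)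
    exact ((ContinuousLinearMap.smulRightL ℝ (Fin n → ℝ) EX
      (ContinuousLinearMap.proj (R := ℝ) (φ := fun _ : Fin n => ℝ) k)).contDiff.contMDiff).contMDiffAt.comp y₀ h1
  have hLA : ∀ y (hye : y ∈ e.baseSet) (hyu : y ∈ u) (x : Fin n → ℝ), L y x =
      ((hvec.toBasisAt hyu).equivFun.symm.trans (e.linearEquivAt ℝ y hye)) x := by
    intro y hye hyu x
    have h1 : ∀ w : TangentSpace IX y, (e ⟨y, w⟩).2 = e.linearEquivAt ℝ y hye w := fun w => rfl
    simp only [L, h1, LinearEquiv.trans_apply, Basis.equivFun_symm_apply, map_sum, map_smul,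
      IsLocalFrameOn.toBasisAt_coe, sum_apply,
      ContinuousLinearMap.smulRight_apply, ContinuousLinearMap.proj_apply]
  have hLv : ∀ y ∈ e.baseSet ∩ u, ∀ w : TangentSpace IX y,
      L y (fun k => hvec.coeff k y w) = (e ⟨y, w⟩).2 := by
    rintro y ⟨hye, hyu⟩ w
    have h1 : (fun k => hvec.coeff k y w) = (hvec.toBasisAt hyu).equivFun w := by
      ext k
      simp [IsLocalFrameOn.coeff, hyu]
    rw [hLA y hye hyu, h1, LinearEquiv.trans_apply, LinearEquiv.symm_apply_apply]
    rfl
  have hinv : ∀ y ∈ e.baseSet ∩ u, (L y).IsInvertible := by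
    rintro y ⟨hye, hyu⟩
    let A := (hvec.toBasisAt hyu).equivFun.symm.trans (e.linearEquivAt ℝ y hye)
    refine ⟨A.toContinuousLinearEquiv, ?_⟩
    ext1 x
    exact (hLA y hye hyu x).symm
  have hinvsmooth : ContMDiffAt IX 𝓘(ℝ, EX →L[ℝ] (Fin n → ℝ)) ∞
      (fun y => ContinuousLinearMap.inverse (L y)) y₀ := by
    obtain ⟨A, hA⟩ := hinv y₀ ⟨hb, hsu hy₀⟩
    have h1 := contDiffAt_map_inverse (n := ∞) A
    rw [hA] at h1
    exact h1.contMDiffAt.comp y₀ hL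
  have h2 := hinvsmooth.clm_apply (hcoord v (hv.contMDiffAt (hs.mem_nhds hy₀)))
  have h3 : ContMDiffAt IX 𝓘(ℝ, ℝ) ∞ (fun y => (ContinuousLinearMap.inverse (L y)
      (e ⟨y, v y⟩).2) i) y₀ :=
    ((ContinuousLinearMap.proj (R := ℝ) (φ := fun _ : Fin n => ℝ) i).contDiff.contMDiff).contMDiffAt.comp y₀ h2
  refine h3.congr_of_eventuallyEq ?_
  filter_upwards [(e.open_baseSet.inter hu).mem_nhds ⟨hb, hsu hy₀⟩] with y hy
  rw [← hLv y hy]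
  obtain ⟨A, hA⟩ := hinv y hy
  rw [← hA, ContinuousLinearMap.inverse_equiv]
  simp

end SmoothLemmas


section Frames

variable {EM : Type*} [NormedAddCommGroup EM] [NormedSpace ℝ EM]
    {HM : Type*} [TopologicalSpace HM] (IM : ModelWithCorners ℝ EM HM)
    {M : Type*} [TopologicalSpace M] [ChartedSpace HM M] [IsManifold IM ∞ M]

/-- A smooth local frame on an open set `dom` which is orthonormal of signature `η` for the family
`g` of bilinear forms on the tangent spaces and positive for the orientation `o`. -/
structure OrthoFrame {n : ℕ} (η : Fin n → ℝ)
    (g : ∀ y : M, LinearMap.BilinForm ℝ (TangentSpace IM y))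
    (o : ∀ y : M, Orientation ℝ (TangentSpace IM y) (Fin n)) where
  dom : Set M
  isOpen_dom : IsOpen dom
  vec : Fin n → ∀ y : M, TangentSpace IM y
  isFrame : IsLocalFrameOn IM EM ∞ vec dom
  ortho : ∀ y (hy : y ∈ dom), IsOrthoBasis (g y) η (isFrame.toBasisAt hy)
  oriented : ∀ y (hy : y ∈ dom), (isFrame.toBasisAt hy).orientation = o y

variable (M) in
/-- A smooth metric of split signature `(+,+,-,-)` and an orientation on a 4-manifold `M`: every
point has a neighbourhood with a smooth frame that is orthonormal and positively oriented. (Such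
frames make the metric a smooth nondegenerate symmetric tensor and the orientation continuous.) -/
structure OrientedSplitMetric where
  form : ∀ y : M, LinearMap.BilinForm ℝ (TangentSpace IM y)
  orient : ∀ y : M, Orientation ℝ (TangentSpace IM y) (Fin 4)
  exists_frame : ∀ y : M, ∃ f : OrthoFrame IM splitSig form orient, y ∈ f.dom

variable {IM}

/-- The fibre over `y` of the twistor bundle: the selfdual totally null planes in `T_y M`. -/
abbrev TwistorFiber (G : OrientedSplitMetric IM M) (y : M) : Type _ :=
  {N : Submodule ℝ (TangentSpace IM y) // IsSelfdualNullPlane (G.form y) (G.orient y) N}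

theorem OrthoFrame.contMDiffOn_coord {n : ℕ} {η η' : Fin n → ℝ}
    {g g' : ∀ y : M, LinearMap.BilinForm ℝ (TangentSpace IM y)}
    {o o' : ∀ y : M, Orientation ℝ (TangentSpace IM y) (Fin n)}
    (f : OrthoFrame IM η g o) (f' : OrthoFrame IM η' g' o') (i j : Fin n) :
    ContMDiffOn IM 𝓘(ℝ, ℝ) ∞ (fun y => f'.isFrame.coeff i y (f.vec j y)) (f.dom ∩ f'.dom) :=
  contMDiffOn_frame_coord f'.isFrame f'.isOpen_dom (f.isOpen_dom.inter f'.isOpen_dom)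
    inter_subset_right ((f.isFrame.contMDiffOn j).mono inter_subset_left) i

theorem contMDiffOn_mk_complex {EX : Type*} [NormedAddCommGroup EX] [NormedSpace ℝ EX]
    {HX : Type*} [TopologicalSpace HX] {IX : ModelWithCorners ℝ EX HX}
    {X : Type*} [TopologicalSpace X] [ChartedSpace HX X] {s : Set X} {p q : X → ℝ}
    (hp : ContMDiffOn IX 𝓘(ℝ, ℝ) ∞ p s) (hq : ContMDiffOn IX 𝓘(ℝ, ℝ) ∞ q s) :
    ContMDiffOn IX 𝓘(ℝ, ℂ) ∞ (fun x => (⟨p x, q x⟩ : ℂ)) s :=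
  Complex.equivRealProdCLM.symm.contDiff.contMDiff.comp_contMDiffOn (hp.prodMk_space hq)

theorem contMDiffOn_complex_div {EX : Type*} [NormedAddCommGroup EX] [NormedSpace ℝ EX]
    {HX : Type*} [TopologicalSpace HX] {IX : ModelWithCorners ℝ EX HX}
    {X : Type*} [TopologicalSpace X] [ChartedSpace HX X] {s : Set X} {p q : X → ℂ}
    (hp : ContMDiffOn IX 𝓘(ℝ, ℂ) ∞ p s) (hq : ContMDiffOn IX 𝓘(ℝ, ℂ) ∞ q s)
    (h0 : ∀ x ∈ s, q x ≠ 0) :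
    ContMDiffOn IX 𝓘(ℝ, ℂ) ∞ (fun x => p x * (q x)⁻¹) s := by
  intro x hx
  have h : ContDiffAt ℝ ∞ (fun z : ℂ × ℂ => z.1 * z.2⁻¹) (p x, q x) :=
    contDiffAt_fst.mul (contDiffAt_snd.inv (h0 x hx))
  exact h.contMDiffAt.comp_contMDiffWithinAt x ((hp x hx).prodMk_space (hq x hx))

theorem contMDiff_circle_coe : ContMDiff (𝓡 1) 𝓘(ℝ, ℂ) ∞ (fun c : Circle => (c : ℂ)) :=
  have : Fact (finrank ℝ ℂ = 1 + 1) := finrank_real_complex_fact'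
  contMDiff_coe_sphere (E := ℂ)

theorem contMDiff_circle_re : ContMDiff (𝓡 1) 𝓘(ℝ, ℝ) ∞ (fun c : Circle => (c : ℂ).re) :=
  Complex.reCLM.contDiff.contMDiff.comp contMDiff_circle_coe

theorem contMDiff_circle_im : ContMDiff (𝓡 1) 𝓘(ℝ, ℝ) ∞ (fun c : Circle => (c : ℂ).im) :=
  Complex.imCLM.contDiff.contMDiff.comp contMDiff_circle_coe

open Classical in
/-- The twistor circle bundle: over an oriented orthonormal frame `(e₁, e₂, e₃, e₄)` the angle `φ`
is the coordinate of the plane spanned by `e₁ + cos φ e₃ + sin φ e₄` and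
`e₂ - sin φ e₃ + cos φ e₄`. -/
def twistorAtlas (G : OrientedSplitMetric IM M) : CircleAtlas IM (TwistorFiber G) where
  ι := OrthoFrame IM splitSig G.form G.orient
  dom f := f.dom
  isOpen_dom f := f.isOpen_dom
  exists_mem := G.exists_frame
  angle f y hy := (circlePlaneEquiv (f.ortho y hy) (f.oriented y hy)).symm
  smooth_change f f' := by
    let τ : M × Circle → Circle := fun p => if h : p.1 ∈ f.dom ∩ f'.dom then
      (circlePlaneEquiv (f'.ortho p.1 h.2) (f'.oriented p.1 h.2)).symm
        (circlePlaneEquiv (f.ortho p.1 h.1) (f.oriented p.1 h.1) p.2) else 1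
    refine ⟨τ, ?_, ?_⟩
    · have : IsManifold (𝓡 1) ∞ Circle := IsManifold.of_le (n := ω) le_top
      apply contMDiffOn_circle_of_coe
      let k : Fin 4 → M × Circle → ℝ := fun i p =>
        f'.isFrame.coeff i p.1 (f.vec 0 p.1) + (p.2 : ℂ).re * f'.isFrame.coeff i p.1 (f.vec 2 p.1) +
          (p.2 : ℂ).im * f'.isFrame.coeff i p.1 (f.vec 3 p.1)
      have hk : ∀ i, ContMDiffOn (IM.prod (𝓡 1)) 𝓘(ℝ, ℝ) ∞ (k i)
          ((f.dom ∩ f'.dom) ×ˢ univ) := by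
        intro i
        have hc : ∀ j, ContMDiffOn (IM.prod (𝓡 1)) 𝓘(ℝ, ℝ) ∞
            (fun p : M × Circle => f'.isFrame.coeff i p.1 (f.vec j p.1))
            ((f.dom ∩ f'.dom) ×ˢ univ) := fun j =>
          (f.contMDiffOn_coord f' i j).comp contMDiffOn_fst (fun p hp => hp.1)
        exact ((hc 0).add ((contMDiff_circle_re.comp contMDiff_snd).contMDiffOn.mul (hc 2))).add
          ((contMDiff_circle_im.comp contMDiff_snd).contMDiffOn.mul (hc 3))
      have hZ : ∀ p ∈ (f.dom ∩ f'.dom) ×ˢ (univ : Set Circle),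
          (⟨k 2 p, k 3 p⟩ : ℂ) = (τ p : ℂ) * ⟨k 0 p, k 1 p⟩ ∧ (⟨k 0 p, k 1 p⟩ : ℂ) ≠ 0 := by
        rintro ⟨y, c⟩ ⟨hy, -⟩
        have hy' : y ∈ f.dom ∩ f'.dom := hy
        let v : TangentSpace IM y := f.vec 0 y + (c : ℂ).re • f.vec 2 y + (c : ℂ).im • f.vec 3 y
        have hv : ∀ i, k i (y, c) = (f'.isFrame.toBasisAt hy'.2).repr v i := by
          intro i
          simp [k, v, IsLocalFrameOn.coeff, hy'.2]
        have hvN : v ∈ circlePlane (f.isFrame.toBasisAt hy'.1) c := by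
          apply Submodule.subset_span
          simp [v]
        have hvN' : v ∈ circlePlane (f'.isFrame.toBasisAt hy'.2) (τ (y, c)) := by
          have h1 := (circlePlaneEquiv (f'.ortho y hy'.2) (f'.oriented y hy'.2)).apply_symm_apply
            (circlePlaneEquiv (f.ortho y hy'.1) (f.oriented y hy'.1) c)
          have h2 := congrArg Subtype.val h1
          have h3 : τ (y, c) = (circlePlaneEquiv (f'.ortho y hy'.2) (f'.oriented y hy'.2)).symm
            (circlePlaneEquiv (f.ortho y hy'.1) (f.oriented y hy'.1) c) := by
            simp only [τ]; rw [dif_pos hy']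
          rw [h3]
          change circlePlane _ _ = circlePlane _ _ at h2
          rw [h2]
          exact hvN
        rw [mem_circlePlane] at hvN'
        simp only [complexCoord, ← hv] at hvN'
        refine ⟨hvN', fun h0 => ?_⟩
        rw [h0, mul_zero] at hvN'
        have hv0 : v = 0 := by
          apply (f'.isFrame.toBasisAt hy'.2).ext_elem
          intro i
          rw [← hv]
          have a := congrArg Complex.re h0
          have b := congrArg Complex.im h0
          have c := congrArg Complex.re hvN'
          have d := congrArg Complex.im hvN'
          simp at a b c d
          fin_cases i <;> simp [a, b, c, d]
        have hv1 : (f.isFrame.toBasisAt hy'.1).repr v 0 = 1 := by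
          simp only [v, ← f.isFrame.toBasisAt_coe hy'.1]
          generalize f.isFrame.toBasisAt hy'.1 = b
          simp
        rw [hv0] at hv1
        simp at hv1
      have hd := contMDiffOn_complex_div (contMDiffOn_mk_complex (hk 2) (hk 3))
        (contMDiffOn_mk_complex (hk 0) (hk 1)) fun p hp => (hZ p hp).2
      refine hd.congr fun p hp => ?_
      have := hZ p hp
      rw [this.1, mul_assoc, mul_inv_cancel₀ this.2, mul_one]
    · intro y hi hj a
      have h : (y ∈ f.dom ∩ f'.dom) := ⟨hi, hj⟩
      simp only [τ]
      rw [dif_pos h, Equiv.apply_symm_apply]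

/-- The twistor circle bundle `𝕋(M)`. -/
def TwistorBundle (G : OrientedSplitMetric IM M) : Type _ := BundlePoint (TwistorFiber G)

instance (G : OrientedSplitMetric IM M) : TopologicalSpace (TwistorBundle G) :=
  (twistorAtlas G).topology

instance (G : OrientedSplitMetric IM M) :
    ChartedSpace (ModelProd HM (EuclideanSpace ℝ (Fin 1))) (TwistorBundle G) :=
  (twistorAtlas G).chartedSpace

instance (G : OrientedSplitMetric IM M) : IsManifold (IM.prod (𝓡 1)) ∞ (TwistorBundle G) :=
  (twistorAtlas G).isManifold

end Frames


section GramSchmidt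

variable {V : Type*} [AddCommGroup V] [Module ℝ V]

/-- The first vector of the Gram-Schmidt process. -/
def gramOne (g : V → V → ℝ) (u : V) : V := (√(g u u))⁻¹ • u

/-- The second vector of the Gram-Schmidt process. -/
def gramTwo (g : V → V → ℝ) (u v : V) : V :=
  (√(g v v - g u v ^ 2 / g u u))⁻¹ • (v + (-(g u v / g u u)) • u)

theorem gram_pos {g : LinearMap.BilinForm ℝ V} (hsymm : ∀ u v, g u v = g v u)
    (hpos : ∀ v, v ≠ 0 → 0 < g v v) (b : Basis (Fin 2) ℝ V) :
    0 < g (b 0) (b 0) ∧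
    0 < g (b 1) (b 1) - g (b 0) (b 1) ^ 2 / g (b 0) (b 0) := by
  have ha : 0 < g (b 0) (b 0) := hpos _ (b.ne_zero 0)
  refine ⟨ha, ?_⟩
  have hw : b 1 + (-(g (b 0) (b 1) / g (b 0) (b 0))) • b 0 ≠ 0 := by
    intro h
    have := congrArg (fun w => b.repr w 1) h
    simp at this
  have h := hpos _ hw
  simp only [map_add, map_smul, LinearMap.add_apply, LinearMap.smul_apply, smul_eq_mul,
    hsymm (b 1) (b 0)] at h
  convert h using 1
  field_simp
  ring

theorem gram_frame {g : LinearMap.BilinForm ℝ V} (hsymm : ∀ u v, g u v = g v u)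
    (hpos : ∀ v, v ≠ 0 → 0 < g v v) (b : Basis (Fin 2) ℝ V) :
    LinearIndependent ℝ ![gramOne (fun u v => g u v) (b 0), gramTwo (fun u v => g u v) (b 0) (b 1)] ∧
    ∀ B : Basis (Fin 2) ℝ V, B 0 = gramOne (fun u v => g u v) (b 0) →
      B 1 = gramTwo (fun u v => g u v) (b 0) (b 1) →
      IsOrthoBasis g riemSig B ∧ B.orientation = b.orientation := by
  obtain ⟨ha, hq⟩ := gram_pos hsymm hpos b
  simp only [gramOne, gramTwo]
  set a := g (b 0) (b 0)
  set c := g (b 0) (b 1)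
  set d := g (b 1) (b 1)
  have hsa : 0 < √a := Real.sqrt_pos.2 ha
  have hsq : 0 < √(d - c ^ 2 / a) := Real.sqrt_pos.2 hq
  have hsa2 : √a ^ 2 = a := Real.sq_sqrt ha.le
  have hsq2 : √(d - c ^ 2 / a) ^ 2 = d - c ^ 2 / a := Real.sq_sqrt hq.le
  refine ⟨?_, ?_⟩
  · rw [LinearIndependent.pair_iff]
    intro s t h
    have h1 := congrArg (fun w => b.repr w 1) h
    have h0 := congrArg (fun w => b.repr w 0) h
    simp [hsq.ne'] at h1
    simp [h1, hsa.ne'] at h0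
    exact ⟨h0, h1⟩
  · intro B h0 h1
    have g01 : g (b 1) (b 0) = c := hsymm _ _
    have e00 : g (B 0) (B 0) = 1 := by
      rw [h0]
      simp only [map_smul, LinearMap.smul_apply, smul_eq_mul]
      change (√a)⁻¹ * ((√a)⁻¹ * a) = 1
      field_simp
      exact hsa2.symm
    have e01 : g (B 0) (B 1) = 0 := by
      rw [h0, h1]
      simp only [map_smul, map_add, LinearMap.smul_apply, smul_eq_mul]
      change (√(d - c ^ 2 / a))⁻¹ * ((√a)⁻¹ * c + -(c / a) * ((√a)⁻¹ * a)) = 0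
      field_simp
      ring
    have e11 : g (B 1) (B 1) = 1 := by
      rw [h1]
      simp only [map_smul, map_add, LinearMap.smul_apply, LinearMap.add_apply, smul_eq_mul, g01]
      change (√(d - c ^ 2 / a))⁻¹ * ((√(d - c ^ 2 / a))⁻¹ * (d + -(c / a) * c) +
        -(c / a) * ((√(d - c ^ 2 / a))⁻¹ * (c + -(c / a) * a))) = 1
      have : d + -(c / a) * c + -(c / a) * (c + -(c / a) * a) = √(d - c ^ 2 / a) ^ 2 := by
        rw [hsq2]; field_simp; ring
      have h2 : (√(d - c ^ 2 / a))⁻¹ * √(d - c ^ 2 / a) = 1 := inv_mul_cancel₀ hsq.ne'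
      linear_combination (√(d - c ^ 2 / a))⁻¹ ^ 2 * this +
        ((√(d - c ^ 2 / a))⁻¹ * √(d - c ^ 2 / a) + 1) * h2
    constructor
    · intro i j
      fin_cases i <;> fin_cases j
      · simpa [riemSig] using e00
      · simpa [riemSig] using e01
      · simpa [riemSig] using (hsymm _ _).trans e01
      · simpa [riemSig] using e11
    · rw [eq_comm, Basis.orientation_eq_iff_det_pos, Basis.det_apply, Matrix.det_fin_two]
      simp only [Basis.toMatrix_apply, h0, h1]
      simp
      positivity

end GramSchmidt

section Surfaces

variable (S : Type*) [TopologicalSpace S] [ChartedSpace (EuclideanSpace ℝ (Fin 2)) S]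
  [IsManifold (𝓡 2) ∞ S]

/-- A smooth Riemannian metric on a surface. -/
abbrev SurfaceMetric : Type _ :=
  ContMDiffRiemannianMetric (𝓡 2) ∞ (EuclideanSpace ℝ (Fin 2))
    (fun x : S => TangentSpace (𝓡 2) x)

/-- An orientation of a surface: an orientation of every tangent plane, such that near every point
there is a positively oriented smooth frame. -/
structure SurfaceOrientation where
  orient : ∀ x : S, Orientation ℝ (TangentSpace (𝓡 2) x) (Fin 2)
  exists_frame : ∀ x₀ : S, ∃ (U : Set S) (s : Fin 2 → ∀ x : S, TangentSpace (𝓡 2) x)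
    (hs : IsLocalFrameOn (𝓡 2) (EuclideanSpace ℝ (Fin 2)) ∞ s U), IsOpen U ∧ x₀ ∈ U ∧
      ∀ x (hx : x ∈ U), (hs.toBasisAt hx).orientation = orient x

variable {S}

/-- The metric at `x` as a bilinear form on `T_x S`. -/
def metricForm (g : SurfaceMetric S) (x : S) : LinearMap.BilinForm ℝ (TangentSpace (𝓡 2) x) :=
  LinearMap.mk₂ ℝ (fun u v => g.inner x u v) (by simp) (by simp) (by simp) (by simp)

theorem contMDiffOn_metric (g : SurfaceMetric S) {U : Set S} {s t : ∀ x : S, TangentSpace (𝓡 2) x}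
    (hs : ContMDiffOn (𝓡 2) (𝓡 2).tangent ∞ (fun x => (⟨x, s x⟩ : TangentBundle (𝓡 2) S)) U)
    (ht : ContMDiffOn (𝓡 2) (𝓡 2).tangent ∞ (fun x => (⟨x, t x⟩ : TangentBundle (𝓡 2) S)) U) :
    ContMDiffOn (𝓡 2) 𝓘(ℝ, ℝ) ∞ (fun x => g.inner x (s x) (t x)) U := by
  have : ContMDiffOn (𝓡 2) ((𝓡 2).prod 𝓘(ℝ)) ∞
      (fun m ↦ TotalSpace.mk' ℝ (E := Bundle.Trivial S ℝ) m (g.inner m (s m) (t m))) U := by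
    apply ContMDiffOn.clm_bundle_apply₂ (F₁ := EuclideanSpace ℝ (Fin 2))
      (F₂ := EuclideanSpace ℝ (Fin 2))
    · exact g.contMDiff.contMDiffOn
    · exact hs
    · exact ht
  intro x hx
  have h := this x hx
  simp only [contMDiffWithinAt_totalSpace] at h
  exact h.2

/-- The oriented orthonormal frames of an oriented Riemannian surface. -/
abbrev SurfaceFrame (g : SurfaceMetric S) (o : SurfaceOrientation S) : Type _ :=
  OrthoFrame (𝓡 2) riemSig (metricForm g) o.orient

theorem exists_surfaceFrame (g : SurfaceMetric S) (o : SurfaceOrientation S) (x₀ : S) :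
    ∃ f : SurfaceFrame g o, x₀ ∈ f.dom := by
  obtain ⟨U, s, hs, hU, hx₀, ho⟩ := o.exists_frame x₀
  let G : ∀ x : S, TangentSpace (𝓡 2) x → TangentSpace (𝓡 2) x → ℝ := fun x u v => metricForm g x u v
  let vec : Fin 2 → ∀ x : S, TangentSpace (𝓡 2) x := fun i x =>
    ![gramOne (G x) (s 0 x), gramTwo (G x) (s 0 x) (s 1 x)] i
  have hsymm : ∀ x u v, metricForm g x u v = metricForm g x v u := fun x u v => g.symm x u v
  have hpos : ∀ x v, v ≠ 0 → 0 < metricForm g x v v := fun x v hv => g.pos x v hv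
  have key := fun x (hx : x ∈ U) => gram_frame (hsymm x) (hpos x) (hs.toBasisAt hx)
  have keyp := fun x (hx : x ∈ U) => gram_pos (hsymm x) (hpos x) (hs.toBasisAt hx)
  simp only [IsLocalFrameOn.toBasisAt_coe] at key keyp
  have hG : ∀ i j, ContMDiffOn (𝓡 2) 𝓘(ℝ, ℝ) ∞ (fun x => G x (s i x) (s j x)) U := fun i j =>
    contMDiffOn_metric g (hs.contMDiffOn i) (hs.contMDiffOn j)
  have hvecli : ∀ x ∈ U, LinearIndependent ℝ (fun i => vec i x) := fun x hx => (key x hx).1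
  have hsqrt : ∀ {f : S → ℝ}, ContMDiffOn (𝓡 2) 𝓘(ℝ, ℝ) ∞ f U → (∀ x ∈ U, 0 < f x) →
      ContMDiffOn (𝓡 2) 𝓘(ℝ, ℝ) ∞ (fun x => (√(f x))⁻¹) U := by
    intro f hf h0 x hx
    have h : ContDiffAt ℝ ∞ (fun t : ℝ => (√t)⁻¹) (f x) :=
      (Real.contDiffAt_sqrt (h0 x hx).ne').inv (Real.sqrt_pos.2 (h0 x hx)).ne'
    exact h.contMDiffAt.comp_contMDiffWithinAt x (hf x hx)
  have hdiv : ∀ {f k : S → ℝ}, ContMDiffOn (𝓡 2) 𝓘(ℝ, ℝ) ∞ f U →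
      ContMDiffOn (𝓡 2) 𝓘(ℝ, ℝ) ∞ k U → (∀ x ∈ U, 0 < k x) →
      ContMDiffOn (𝓡 2) 𝓘(ℝ, ℝ) ∞ (fun x => f x / k x) U := by
    intro f k hf hk h0
    exact hf.div₀ hk fun x hx => (h0 x hx).ne'
  have h0pos : ∀ x ∈ U, 0 < G x (s 0 x) (s 0 x) := fun x hx => (keyp x hx).1
  have hframe : IsLocalFrameOn (𝓡 2) (EuclideanSpace ℝ (Fin 2)) ∞ vec U := by
    refine ⟨fun {x} hx => hvecli x hx, fun {x} hx => ?_, fun i => ?_⟩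
    · rw [(hvecli x hx).span_eq_top_of_card_eq_finrank]
      rw [finrank_eq_card_basis (hs.toBasisAt hx)]
    · have hone : ContMDiffOn (𝓡 2) (𝓡 2).tangent ∞
          (fun x => (⟨x, gramOne (G x) (s 0 x)⟩ : TangentBundle (𝓡 2) S)) U :=
        (hsqrt (hG 0 0) h0pos).smul_section (hs.contMDiffOn 0)
      have htwo : ContMDiffOn (𝓡 2) (𝓡 2).tangent ∞
          (fun x => (⟨x, gramTwo (G x) (s 0 x) (s 1 x)⟩ : TangentBundle (𝓡 2) S)) U :=
        (hsqrt ((hG 1 1).sub (hdiv ((hG 0 1).pow 2) (hG 0 0) h0pos))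
          fun x hx => (keyp x hx).2).smul_section ((hs.contMDiffOn 1).add_section
          ((hdiv (hG 0 1) (hG 0 0) h0pos).neg.smul_section (hs.contMDiffOn 0)))
      fin_cases i
      · exact hone
      · exact htwo
  have hB := fun x (hx : x ∈ U) => (key x hx).2 (hframe.toBasisAt hx)
    (by rw [IsLocalFrameOn.toBasisAt_coe]; rfl) (by rw [IsLocalFrameOn.toBasisAt_coe]; rfl)
  exact ⟨⟨U, hU, vec, hframe, fun x hx => (hB x hx).1, fun x hx => (hB x hx).2.trans (ho x hx)⟩,
    hx₀⟩

end Surfaces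


section ProductOrientation

variable {V W : Type*} [AddCommGroup V] [Module ℝ V] [AddCommGroup W] [Module ℝ W]

/-- The basis `(e₁, e₂, e₃, e₄)` of `V × W` made of bases `(e₁, e₂)` of `V` and `(e₃, e₄)` of
`W`. -/
def prodBasis (b : Basis (Fin 2) ℝ V) (b' : Basis (Fin 2) ℝ W) : Basis (Fin 4) ℝ (V × W) :=
  (b.prod b').reindex finSumFinEquiv

theorem prodBasis_zero (b : Basis (Fin 2) ℝ V) (b' : Basis (Fin 2) ℝ W) :
    prodBasis b b' 0 = (b 0, 0) := by
  have : (finSumFinEquiv (m := 2) (n := 2)).symm 0 = Sum.inl 0 := rfl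
  ext <;> simp [prodBasis, this]

theorem prodBasis_one (b : Basis (Fin 2) ℝ V) (b' : Basis (Fin 2) ℝ W) :
    prodBasis b b' 1 = (b 1, 0) := by
  have : (finSumFinEquiv (m := 2) (n := 2)).symm 1 = Sum.inl 1 := rfl
  ext <;> simp [prodBasis, this]

theorem prodBasis_two (b : Basis (Fin 2) ℝ V) (b' : Basis (Fin 2) ℝ W) :
    prodBasis b b' 2 = (0, b' 0) := by
  have : (finSumFinEquiv (m := 2) (n := 2)).symm 2 = Sum.inr 0 := rfl
  ext <;> simp [prodBasis, this]

theorem prodBasis_three (b : Basis (Fin 2) ℝ V) (b' : Basis (Fin 2) ℝ W) :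
    prodBasis b b' 3 = (0, b' 1) := by
  have : (finSumFinEquiv (m := 2) (n := 2)).symm 3 = Sum.inr 1 := rfl
  ext <;> simp [prodBasis, this]

/-- The product orientation: `(e₁, e₂, e₃, e₄)` is positive if `(e₁, e₂)` and `(e₃, e₄)` are. -/
def prodOrientation [FiniteDimensional ℝ V] [FiniteDimensional ℝ W] (hV : finrank ℝ V = 2)
    (hW : finrank ℝ W = 2) (o : Orientation ℝ V (Fin 2)) (o' : Orientation ℝ W (Fin 2)) :
    Orientation ℝ (V × W) (Fin 4) :=
  (prodBasis (o.someBasis (by simp [hV])) (o'.someBasis (by simp [hW]))).orientation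

theorem prodBasis_orientation [FiniteDimensional ℝ V] [FiniteDimensional ℝ W]
    (hV : finrank ℝ V = 2) (hW : finrank ℝ W = 2) (b : Basis (Fin 2) ℝ V) (b' : Basis (Fin 2) ℝ W) :
    (prodBasis b b').orientation = prodOrientation hV hW b.orientation b'.orientation := by
  rw [prodOrientation]
  have h1 := Orientation.someBasis_orientation b.orientation (by simp [hV])
  have h2 := Orientation.someBasis_orientation b'.orientation (by simp [hW])
  generalize (b.orientation).someBasis _ = c at *
  generalize (b'.orientation).someBasis _ = c' at *
  rw [prodBasis, prodBasis, Basis.orientation_reindex, Basis.orientation_reindex]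
  congr 1
  rw [Basis.orientation_eq_iff_det_pos, Basis.det_apply]
  have hm : (b.prod b').toMatrix (c.prod c') = Matrix.fromBlocks (b.toMatrix c) 0 0 (b'.toMatrix c') := by
    ext i j
    rcases i with i | i <;> rcases j with j | j <;> simp [Basis.toMatrix_apply]
  rw [hm, Matrix.det_fromBlocks_zero₂₁]
  have h3 := (b.orientation_eq_iff_det_pos c).1 h1.symm
  have h4 := (b'.orientation_eq_iff_det_pos c').1 h2.symm
  rw [Basis.det_apply] at h3 h4
  exact mul_pos h3 h4

end ProductOrientation

section Product

variable {S₁ : Type*} [TopologicalSpace S₁] [ChartedSpace (EuclideanSpace ℝ (Fin 2)) S₁]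
  [IsManifold (𝓡 2) ∞ S₁]
  {S₂ : Type*} [TopologicalSpace S₂] [ChartedSpace (EuclideanSpace ℝ (Fin 2)) S₂]
  [IsManifold (𝓡 2) ∞ S₂]

/-- The form `g₁ ⊕ (-g₂)` on `T_y (S₁ × S₂)`, i.e. `π₁^* g₁ - π₂^* g₂`. -/
def splitForm (g₁ : SurfaceMetric S₁) (g₂ : SurfaceMetric S₂) (y : S₁ × S₂) :
    LinearMap.BilinForm ℝ (TangentSpace ((𝓡 2).prod (𝓡 2)) y) :=
  (metricForm g₁ y.1).compl₁₂
      (mfderiv ((𝓡 2).prod (𝓡 2)) (𝓡 2) (Prod.fst : S₁ × S₂ → S₁) y).toLinearMap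
      (mfderiv ((𝓡 2).prod (𝓡 2)) (𝓡 2) (Prod.fst : S₁ × S₂ → S₁) y).toLinearMap -
    (metricForm g₂ y.2).compl₁₂
      (mfderiv ((𝓡 2).prod (𝓡 2)) (𝓡 2) (Prod.snd : S₁ × S₂ → S₂) y).toLinearMap
      (mfderiv ((𝓡 2).prod (𝓡 2)) (𝓡 2) (Prod.snd : S₁ × S₂ → S₂) y).toLinearMap

/-- The canonical identification `T_{y₁} S₁ × T_{y₂} S₂ = T_y (S₁ × S₂)`. -/
def tangentProd (y : S₁ × S₂) : (TangentSpace (𝓡 2) y.1 × TangentSpace (𝓡 2) y.2) ≃ₗ[ℝ]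
    TangentSpace ((𝓡 2).prod (𝓡 2)) y :=
  LinearEquiv.refl ℝ (EuclideanSpace ℝ (Fin 2) × EuclideanSpace ℝ (Fin 2))

instance (x : S₁) : FiniteDimensional ℝ (TangentSpace (𝓡 2) x) :=
  inferInstanceAs (FiniteDimensional ℝ (EuclideanSpace ℝ (Fin 2)))

theorem finrank_tangentSpace (x : S₁) : finrank ℝ (TangentSpace (𝓡 2) x) = 2 :=
  finrank_euclideanSpace_fin (𝕜 := ℝ) (n := 2)

/-- The product orientation of `S₁ × S₂`. -/
def splitOrient (o₁ : SurfaceOrientation S₁) (o₂ : SurfaceOrientation S₂) (y : S₁ × S₂) :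
    Orientation ℝ (TangentSpace ((𝓡 2).prod (𝓡 2)) y) (Fin 4) :=
  Orientation.map (Fin 4) (tangentProd y) (prodOrientation (finrank_tangentSpace y.1)
    (finrank_tangentSpace y.2) (o₁.orient y.1) (o₂.orient y.2))

theorem mfderiv_fst_tangentProd (y : S₁ × S₂) (u : TangentSpace (𝓡 2) y.1)
    (v : TangentSpace (𝓡 2) y.2) :
    mfderiv ((𝓡 2).prod (𝓡 2)) (𝓡 2) (Prod.fst : S₁ × S₂ → S₁) y (tangentProd y (u, v)) = u := by
  rw [mfderiv_fst]; rfl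

theorem mfderiv_snd_tangentProd (y : S₁ × S₂) (u : TangentSpace (𝓡 2) y.1)
    (v : TangentSpace (𝓡 2) y.2) :
    mfderiv ((𝓡 2).prod (𝓡 2)) (𝓡 2) (Prod.snd : S₁ × S₂ → S₂) y (tangentProd y (u, v)) = v := by
  rw [mfderiv_snd]; rfl

theorem splitForm_tangentProd (g₁ : SurfaceMetric S₁) (g₂ : SurfaceMetric S₂) (y : S₁ × S₂)
    (u u' : TangentSpace (𝓡 2) y.1) (v v' : TangentSpace (𝓡 2) y.2) :
    splitForm g₁ g₂ y (tangentProd y (u, v)) (tangentProd y (u', v')) =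
      metricForm g₁ y.1 u u' - metricForm g₂ y.2 v v' := by
  simp only [splitForm, LinearMap.sub_apply, LinearMap.compl₁₂_apply,
    ContinuousLinearMap.coe_coe]
  rw [mfderiv_fst_tangentProd, mfderiv_fst_tangentProd, mfderiv_snd_tangentProd,
    mfderiv_snd_tangentProd]

theorem contMDiffOn_tangentProd {U : Set S₁} {U' : Set S₂} {s : ∀ x : S₁, TangentSpace (𝓡 2) x}
    {t : ∀ x : S₂, TangentSpace (𝓡 2) x}
    (hs : ContMDiffOn (𝓡 2) (𝓡 2).tangent ∞ (fun x => (⟨x, s x⟩ : TangentBundle (𝓡 2) S₁)) U)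
    (ht : ContMDiffOn (𝓡 2) (𝓡 2).tangent ∞ (fun x => (⟨x, t x⟩ : TangentBundle (𝓡 2) S₂)) U') :
    ContMDiffOn ((𝓡 2).prod (𝓡 2)) ((𝓡 2).prod (𝓡 2)).tangent ∞
      (fun y : S₁ × S₂ => (⟨y, tangentProd y (s y.1, t y.2)⟩ :
        TangentBundle ((𝓡 2).prod (𝓡 2)) (S₁ × S₂))) (U ×ˢ U') :=
  (contMDiff_equivTangentBundleProd_symm (I := 𝓡 2) (M := S₁) (I' := 𝓡 2) (M' := S₂)
    (n := ∞)).comp_contMDiffOn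
    ((hs.comp contMDiffOn_fst fun _ h => h.1).prodMk (ht.comp contMDiffOn_snd fun _ h => h.2))

theorem exists_splitFrame (g₁ : SurfaceMetric S₁) (o₁ : SurfaceOrientation S₁)
    (g₂ : SurfaceMetric S₂) (o₂ : SurfaceOrientation S₂) (y₀ : S₁ × S₂) :
    ∃ f : OrthoFrame ((𝓡 2).prod (𝓡 2)) splitSig (splitForm g₁ g₂) (splitOrient o₁ o₂),
      y₀ ∈ f.dom := by
  obtain ⟨f, hf⟩ := exists_surfaceFrame g₁ o₁ y₀.1
  obtain ⟨f', hf'⟩ := exists_surfaceFrame g₂ o₂ y₀.2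
  let vec : Fin 4 → ∀ y : S₁ × S₂, TangentSpace ((𝓡 2).prod (𝓡 2)) y := fun i y =>
    tangentProd y (![(f.vec 0 y.1, 0), (f.vec 1 y.1, 0), (0, f'.vec 0 y.2), (0, f'.vec 1 y.2)] i)
  let bas : ∀ y ∈ f.dom ×ˢ f'.dom, Basis (Fin 4) ℝ (TangentSpace ((𝓡 2).prod (𝓡 2)) y) :=
    fun y hy => (prodBasis (f.isFrame.toBasisAt hy.1) (f'.isFrame.toBasisAt hy.2)).map
      (tangentProd y)
  have hbas : ∀ y (hy : y ∈ f.dom ×ˢ f'.dom) i, bas y hy i = vec i y := by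
    intro y hy i
    simp only [bas, vec, Basis.map_apply]
    congr 1
    fin_cases i
    · exact (prodBasis_zero _ _).trans (by simp)
    · exact (prodBasis_one _ _).trans (by simp)
    · exact (prodBasis_two _ _).trans (by simp)
    · exact (prodBasis_three _ _).trans (by simp)
  have hbas' : ∀ y (hy : y ∈ f.dom ×ˢ f'.dom), (fun i => vec i y) = bas y hy := by
    intro y hy
    ext1 i
    exact (hbas y hy i).symm
  have hz₁ : ContMDiffOn (𝓡 2) (𝓡 2).tangent ∞
      (fun x => (⟨x, 0⟩ : TangentBundle (𝓡 2) S₁)) f.dom :=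
    (Bundle.contMDiff_zeroSection ℝ _).contMDiffOn
  have hz₂ : ContMDiffOn (𝓡 2) (𝓡 2).tangent ∞
      (fun x => (⟨x, 0⟩ : TangentBundle (𝓡 2) S₂)) f'.dom :=
    (Bundle.contMDiff_zeroSection ℝ _).contMDiffOn
  have hframe : IsLocalFrameOn ((𝓡 2).prod (𝓡 2))
      (EuclideanSpace ℝ (Fin 2) × EuclideanSpace ℝ (Fin 2)) ∞ vec (f.dom ×ˢ f'.dom) := by
    refine ⟨fun {y} hy => ?_, fun {y} hy => ?_, fun i => ?_⟩
    · rw [hbas' y hy]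
      exact (bas y hy).linearIndependent
    · rw [hbas' y hy, (bas y hy).span_eq]
    · fin_cases i
      · exact contMDiffOn_tangentProd (f.isFrame.contMDiffOn 0) hz₂
      · exact contMDiffOn_tangentProd (f.isFrame.contMDiffOn 1) hz₂
      · exact contMDiffOn_tangentProd hz₁ (f'.isFrame.contMDiffOn 0)
      · exact contMDiffOn_tangentProd hz₁ (f'.isFrame.contMDiffOn 1)
  have hB : ∀ y (hy : y ∈ f.dom ×ˢ f'.dom), hframe.toBasisAt hy = bas y hy := by
    intro y hy
    apply Basis.eq_of_apply_eq
    intro i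
    exact (hframe.toBasisAt_coe hy i).trans (hbas y hy i).symm
  refine ⟨⟨f.dom ×ˢ f'.dom, f.isOpen_dom.prod f'.isOpen_dom, vec, hframe, ?_, ?_⟩, hf, hf'⟩
  · intro y hy i j
    have h₁ := f.ortho y.1 hy.1
    have h₂ := f'.ortho y.2 hy.2
    simp only [IsOrthoBasis, IsLocalFrameOn.toBasisAt_coe] at h₁ h₂
    rw [IsLocalFrameOn.toBasisAt_coe, IsLocalFrameOn.toBasisAt_coe]
    simp only [vec]
    fin_cases i <;> fin_cases j <;>
      (refine (splitForm_tangentProd g₁ g₂ y _ _ _ _).trans ?_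
       simp [h₁, h₂, riemSig, splitSig])
  · intro y hy
    rw [hB y hy]
    simp only [bas, splitOrient]
    rw [Basis.orientation_map, prodBasis_orientation (finrank_tangentSpace y.1)
      (finrank_tangentSpace y.2), f.oriented, f'.oriented]

/-- The oriented split signature 4-manifold `(S₁ × S₂, g₁ ⊕ (-g₂))`. -/
def splitProduct (g₁ : SurfaceMetric S₁) (o₁ : SurfaceOrientation S₁)
    (g₂ : SurfaceMetric S₂) (o₂ : SurfaceOrientation S₂) :
    OrientedSplitMetric ((𝓡 2).prod (𝓡 2)) (S₁ × S₂) where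
  form := splitForm g₁ g₂
  orient := splitOrient o₁ o₂
  exists_frame := exists_splitFrame g₁ o₁ g₂ o₂

/-- The fibre of the configuration space over `y = (x, x')`: the rotations `T_x S₁ → T_{x'} S₂`. -/
abbrev RollingFiber (g₁ : SurfaceMetric S₁) (o₁ : SurfaceOrientation S₁)
    (g₂ : SurfaceMetric S₂) (o₂ : SurfaceOrientation S₂) (y : S₁ × S₂) : Type _ :=
  {A : TangentSpace (𝓡 2) y.1 ≃ₗ[ℝ] TangentSpace (𝓡 2) y.2 //
    IsRotation (metricForm g₁ y.1) (o₁.orient y.1) (metricForm g₂ y.2) (o₂.orient y.2) A}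

open Classical in
/-- The circle bundle of configurations: over oriented orthonormal frames `(e₁, e₂)` of `S₁` and
`(e₃, e₄)` of `S₂`, the angle `φ` is the coordinate of the rotation by `φ`, i.e. of
`e₁ ↦ cos φ e₃ + sin φ e₄`, `e₂ ↦ - sin φ e₃ + cos φ e₄`. -/
def rollingAtlas (g₁ : SurfaceMetric S₁) (o₁ : SurfaceOrientation S₁)
    (g₂ : SurfaceMetric S₂) (o₂ : SurfaceOrientation S₂) :
    CircleAtlas ((𝓡 2).prod (𝓡 2)) (RollingFiber g₁ o₁ g₂ o₂) where
  ι := SurfaceFrame g₁ o₁ × SurfaceFrame g₂ o₂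
  dom f := f.1.dom ×ˢ f.2.dom
  isOpen_dom f := f.1.isOpen_dom.prod f.2.isOpen_dom
  exists_mem y := by
    obtain ⟨f, hf⟩ := exists_surfaceFrame g₁ o₁ y.1
    obtain ⟨f', hf'⟩ := exists_surfaceFrame g₂ o₂ y.2
    exact ⟨(f, f'), hf, hf'⟩
  angle f y hy := (rotationEquiv (f.1.ortho y.1 hy.1) (f.1.oriented y.1 hy.1)
    (f.2.ortho y.2 hy.2) (f.2.oriented y.2 hy.2)).symm
  smooth_change f f' := by
    let D : Set (S₁ × S₂) := f.1.dom ×ˢ f.2.dom ∩ f'.1.dom ×ˢ f'.2.dom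
    let τ : (S₁ × S₂) × Circle → Circle := fun p => if h : p.1 ∈ D then
      (rotationEquiv (f'.1.ortho p.1.1 h.2.1) (f'.1.oriented p.1.1 h.2.1)
        (f'.2.ortho p.1.2 h.2.2) (f'.2.oriented p.1.2 h.2.2)).symm
        (rotationEquiv (f.1.ortho p.1.1 h.1.1) (f.1.oriented p.1.1 h.1.1)
          (f.2.ortho p.1.2 h.1.2) (f.2.oriented p.1.2 h.1.2) p.2) else 1
    refine ⟨τ, ?_, ?_⟩
    · have : IsManifold (𝓡 1) ∞ Circle := IsManifold.of_le (n := ω) le_top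
      apply contMDiffOn_circle_of_coe
      let k : Fin 2 → (S₁ × S₂) × Circle → ℝ := fun i p => f'.1.isFrame.coeff i p.1.1 (f.1.vec 0 p.1.1)
      let l : Fin 2 → (S₁ × S₂) × Circle → ℝ := fun i p =>
        (p.2 : ℂ).re * f'.2.isFrame.coeff i p.1.2 (f.2.vec 0 p.1.2) +
          (p.2 : ℂ).im * f'.2.isFrame.coeff i p.1.2 (f.2.vec 1 p.1.2)
      have hk : ∀ i, ContMDiffOn (((𝓡 2).prod (𝓡 2)).prod (𝓡 1)) 𝓘(ℝ, ℝ) ∞ (k i) (D ×ˢ univ) := by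
        intro i
        exact (f.1.contMDiffOn_coord f'.1 i 0).comp (contMDiff_fst.comp contMDiff_fst).contMDiffOn
          fun p hp => ⟨hp.1.1.1, hp.1.2.1⟩
      have hl : ∀ i, ContMDiffOn (((𝓡 2).prod (𝓡 2)).prod (𝓡 1)) 𝓘(ℝ, ℝ) ∞ (l i) (D ×ˢ univ) := by
        intro i
        have hc : ∀ j, ContMDiffOn (((𝓡 2).prod (𝓡 2)).prod (𝓡 1)) 𝓘(ℝ, ℝ) ∞
            (fun p : (S₁ × S₂) × Circle => f'.2.isFrame.coeff i p.1.2 (f.2.vec j p.1.2))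
            (D ×ˢ univ) := fun j =>
          (f.2.contMDiffOn_coord f'.2 i j).comp (contMDiff_snd.comp contMDiff_fst).contMDiffOn
            fun p hp => ⟨hp.1.1.2, hp.1.2.2⟩
        exact ((contMDiff_circle_re.comp contMDiff_snd).contMDiffOn.mul (hc 0)).add
          ((contMDiff_circle_im.comp contMDiff_snd).contMDiffOn.mul (hc 1))
      have hZ : ∀ p ∈ D ×ˢ (univ : Set Circle),
          (⟨l 0 p, l 1 p⟩ : ℂ) = (τ p : ℂ) * ⟨k 0 p, k 1 p⟩ ∧ (⟨k 0 p, k 1 p⟩ : ℂ) ≠ 0 := by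
        rintro ⟨y, c⟩ ⟨hy, -⟩
        have hy' : y ∈ D := hy
        have hτ : τ (y, c) = (rotationEquiv (f'.1.ortho y.1 hy'.2.1) (f'.1.oriented y.1 hy'.2.1)
            (f'.2.ortho y.2 hy'.2.2) (f'.2.oriented y.2 hy'.2.2)).symm
            (rotationEquiv (f.1.ortho y.1 hy'.1.1) (f.1.oriented y.1 hy'.1.1)
              (f.2.ortho y.2 hy'.1.2) (f.2.oriented y.2 hy'.1.2) c) := by
          simp only [τ]; rw [dif_pos hy']
        have h1 := (rotationEquiv (f'.1.ortho y.1 hy'.2.1) (f'.1.oriented y.1 hy'.2.1)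
            (f'.2.ortho y.2 hy'.2.2) (f'.2.oriented y.2 hy'.2.2)).apply_symm_apply
            (rotationEquiv (f.1.ortho y.1 hy'.1.1) (f.1.oriented y.1 hy'.1.1)
              (f.2.ortho y.2 hy'.1.2) (f.2.oriented y.2 hy'.1.2) c)
        rw [← hτ] at h1
        have h2 := congrArg Subtype.val h1
        change rotationMap (f'.1.isFrame.toBasisAt hy'.2.1) (f'.2.isFrame.toBasisAt hy'.2.2) _ =
          rotationMap (f.1.isFrame.toBasisAt hy'.1.1) (f.2.isFrame.toBasisAt hy'.1.2) _ at h2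
        have h3 := (eq_rotationMap_iff _ _ _ _).1 h2.symm (f.1.vec 0 y.1)
        have h4 : rotationMap (f.1.isFrame.toBasisAt hy'.1.1) (f.2.isFrame.toBasisAt hy'.1.2) c
            (f.1.vec 0 y.1) = (c : ℂ).re • f.2.vec 0 y.2 + (c : ℂ).im • f.2.vec 1 y.2 := by
          have h5 := rotationMap_apply_zero (f.1.isFrame.toBasisAt hy'.1.1)
            (f.2.isFrame.toBasisAt hy'.1.2) c
          simpa only [IsLocalFrameOn.toBasisAt_coe] using h5
        rw [h4] at h3
        refine ⟨?_, fun h0 => ?_⟩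
        · simpa [complexCoord, k, l, IsLocalFrameOn.coeff, hy'.2.1, hy'.2.2] using h3
        · have hv0 : f.1.vec 0 y.1 = 0 := by
            apply (f'.1.isFrame.toBasisAt hy'.2.1).ext_elem
            intro i
            have a := congrArg Complex.re h0
            have b := congrArg Complex.im h0
            simp [k, IsLocalFrameOn.coeff, hy'.2.1] at a b
            fin_cases i <;> simp [a, b]
          exact (f.1.isFrame.linearIndependent hy'.1.1).ne_zero 0 hv0
      have hd := contMDiffOn_complex_div (contMDiffOn_mk_complex (hl 0) (hl 1))
        (contMDiffOn_mk_complex (hk 0) (hk 1)) fun p hp => (hZ p hp).2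
      refine hd.congr fun p hp => ?_
      have := hZ p hp
      rw [this.1, mul_assoc, mul_inv_cancel₀ this.2, mul_one]
    · intro y hi hj a
      have h : y ∈ D := ⟨hi, hj⟩
      simp only [τ]
      rw [dif_pos h, Equiv.apply_symm_apply]

/-- The configuration space `C(S₁, S₂)` of two rolling surfaces: triples `(x, x', A)` with `x ∈ S₁`,
`x' ∈ S₂` and a rotation `A : T_x S₁ → T_{x'} S₂`. -/
def RollingSpace (g₁ : SurfaceMetric S₁) (o₁ : SurfaceOrientation S₁)
    (g₂ : SurfaceMetric S₂) (o₂ : SurfaceOrientation S₂) : Type _ :=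
  BundlePoint (RollingFiber g₁ o₁ g₂ o₂)

variable (g₁ : SurfaceMetric S₁) (o₁ : SurfaceOrientation S₁)
  (g₂ : SurfaceMetric S₂) (o₂ : SurfaceOrientation S₂)

instance : TopologicalSpace (RollingSpace g₁ o₁ g₂ o₂) := (rollingAtlas g₁ o₁ g₂ o₂).topology

instance : ChartedSpace (ModelProd (ModelProd (EuclideanSpace ℝ (Fin 2))
    (EuclideanSpace ℝ (Fin 2))) (EuclideanSpace ℝ (Fin 1))) (RollingSpace g₁ o₁ g₂ o₂) :=
  (rollingAtlas g₁ o₁ g₂ o₂).chartedSpace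

instance : IsManifold (((𝓡 2).prod (𝓡 2)).prod (𝓡 1)) ∞ (RollingSpace g₁ o₁ g₂ o₂) :=
  (rollingAtlas g₁ o₁ g₂ o₂).isManifold

end Product


section Curves

variable {EX : Type*} [NormedAddCommGroup EX] [NormedSpace ℝ EX]
    {HX : Type*} [TopologicalSpace HX] (IX : ModelWithCorners ℝ EX HX)
    {X : Type*} [TopologicalSpace X] [ChartedSpace HX X]

/-- The velocity `γ'(t)` of a curve, as a vector of the tangent space at `γ t`. -/
def velocityAt (γ : ℝ → X) (t : ℝ) : TangentSpace IX (γ t) :=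
  mfderiv 𝓘(ℝ, ℝ) IX γ t (1 : ℝ)

/-- The velocity `γ'(t)` of a curve, as a point of the tangent bundle. -/
def velocity (γ : ℝ → X) (t : ℝ) : TangentBundle IX X :=
  ⟨γ t, velocityAt IX γ t⟩

variable [IsManifold IX 1 X]

variable {IX} in
/-- The matrix `(g_ij)` of a family `g` of bilinear forms on the tangent spaces in the chart at
`x₀`: the value `g(a^i ∂_i, b^j ∂_j)` at the point with coordinates `u`. -/
def chartForm (g : ∀ x : X, LinearMap.BilinForm ℝ (TangentSpace IX x)) (x₀ : X) (u a b : EX) : ℝ :=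
  g ((extChartAt IX x₀).symm u)
    ((trivializationAt EX (TangentSpace IX) x₀).symm ((extChartAt IX x₀).symm u) a)
    ((trivializationAt EX (TangentSpace IX) x₀).symm ((extChartAt IX x₀).symm u) b)

variable {IX} in
/-- The coordinates in the chart at `x₀` of a tangent vector of `X`. -/
def chartCoord (x₀ : X) {x : X} (w : TangentSpace IX x) : EX :=
  (trivializationAt EX (TangentSpace IX) x₀ (⟨x, w⟩ : TangentBundle IX X)).2

variable {IX} in
/-- For a vector field `V` along a curve `γ`, the pairing `g(∇V/dt, Z)` at time `t`, where `∇` is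
the Levi-Civita connection of `g` and `Z = Z^k ∂_k`, in the chart at `x₀ = γ t`:
`g_ij (dV^i/dt) Z^j + Γ_{ijk} (dγ^i/dt) V^j Z^k` with the Christoffel symbols of the first kind
`Γ_{ijk} = (∂_i g_jk + ∂_j g_ik - ∂_k g_ij) / 2`. -/
def covDerivPairing (g : ∀ x : X, LinearMap.BilinForm ℝ (TangentSpace IX x)) (γ : ℝ → X)
    (V : ∀ t, TangentSpace IX (γ t)) (t : ℝ) (Z : EX) : ℝ :=
  let u : EX := extChartAt IX (γ t) (γ t)
  let v : EX := chartCoord (γ t) (V t)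
  let dv : EX := deriv (fun s => chartCoord (γ t) (V s)) t
  let dc : EX := deriv (fun s => extChartAt IX (γ t) (γ s)) t
  let dg : EX → EX → EX → ℝ := fun w a b => fderiv ℝ (fun u' => chartForm g (γ t) u' a b) u w
  chartForm g (γ t) u dv Z + (dg dc v Z + dg v dc Z - dg Z dc v) / 2

variable {IX} in
/-- `V` is a (differentiable) vector field along `γ` that is parallel, `∇V/dt = 0`, at the times
`t ∈ J`. Here `g` is nondegenerate, so that `∇V/dt = 0` means `g(∇V/dt, Z) = 0` for all `Z`. -/
def IsParallelAlong (g : ∀ x : X, LinearMap.BilinForm ℝ (TangentSpace IX x)) (γ : ℝ → X)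
    (V : ∀ t, TangentSpace IX (γ t)) (J : Set ℝ) : Prop :=
  ∀ t ∈ J, MDifferentiableAt 𝓘(ℝ, ℝ) IX.tangent (fun s => (⟨γ s, V s⟩ : TangentBundle IX X)) t ∧
    ∀ Z : EX, covDerivPairing g γ V t Z = 0

end Curves

section TwistorDistribution

variable {EM : Type*} [NormedAddCommGroup EM] [NormedSpace ℝ EM]
    {HM : Type*} [TopologicalSpace HM] {IM : ModelWithCorners ℝ EM HM}
    {M : Type*} [TopologicalSpace M] [ChartedSpace HM M] [IsManifold IM ∞ M]

/-- A curve of planes `N(t)` along `y(t)` is horizontal at the times `t ∈ J` if it arises by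
parallel transport along `y`, i.e. if `N(t)` is spanned by two parallel vector fields. -/
def IsHorizontal (G : OrientedSplitMetric IM M) (γ : ℝ → TwistorBundle G) (J : Set ℝ) : Prop :=
  ∃ n : Fin 2 → ∀ t, TangentSpace IM (γ t).base,
    (∀ i, IsParallelAlong G.form (fun t => (γ t).base) (n i) J) ∧
    ∀ t ∈ J, (γ t).fiber.1 = Submodule.span ℝ (range fun i => n i t)

/-- The twistor distribution: at `(y, N)` it consists of the horizontal lifts to `(y, N)` of the
vectors in `N`, i.e. of the velocities at `t = 0` of horizontal smooth curves through `(y, N)` whose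
projection `y(t)` has velocity `y'(0) ∈ N`. -/
def twistorDistribution (G : OrientedSplitMetric IM M) :
    Set (TangentBundle (IM.prod (𝓡 1)) (TwistorBundle G)) :=
  {w | ∃ γ : ℝ → TwistorBundle G, ∃ ε > (0 : ℝ),
    ContMDiffOn 𝓘(ℝ, ℝ) (IM.prod (𝓡 1)) ∞ γ (Ioo (-ε) ε) ∧
    IsHorizontal G γ (Ioo (-ε) ε) ∧
    velocityAt IM (fun t => (γ t).base) 0 ∈ (γ 0).fiber.1 ∧
    w = velocity (IM.prod (𝓡 1)) γ 0}

end TwistorDistribution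

section Rolling

variable {S₁ : Type*} [TopologicalSpace S₁] [ChartedSpace (EuclideanSpace ℝ (Fin 2)) S₁]
  [IsManifold (𝓡 2) ∞ S₁]
  {S₂ : Type*} [TopologicalSpace S₂] [ChartedSpace (EuclideanSpace ℝ (Fin 2)) S₂]
  [IsManifold (𝓡 2) ∞ S₂]
  {g₁ : SurfaceMetric S₁} {o₁ : SurfaceOrientation S₁}
  {g₂ : SurfaceMetric S₂} {o₂ : SurfaceOrientation S₂}

/-- Rolling without slipping at the times `t ∈ J`: `A(t) x'(t)` is the velocity of the second
contact point. -/
def NoSlip (γ : ℝ → RollingSpace g₁ o₁ g₂ o₂) (J : Set ℝ) : Prop :=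
  ∀ t ∈ J, (γ t).fiber.1 (velocityAt (𝓡 2) (fun s => (γ s).base.1) t) =
    velocityAt (𝓡 2) (fun s => (γ s).base.2) t

/-- Rolling without twisting at the times `t ∈ J`: `A` maps every parallel vector field along the
first contact curve (over any open time interval in `J`) to a parallel vector field along the
second one. -/
def NoTwist (γ : ℝ → RollingSpace g₁ o₁ g₂ o₂) (J : Set ℝ) : Prop :=
  ∀ a b : ℝ, Ioo a b ⊆ J → ∀ v : ∀ t, TangentSpace (𝓡 2) (γ t).base.1,
    IsParallelAlong (metricForm g₁) (fun t => (γ t).base.1) v (Ioo a b) →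
    IsParallelAlong (metricForm g₂) (fun t => (γ t).base.2) (fun t => (γ t).fiber.1 (v t)) (Ioo a b)

variable (g₁ o₁ g₂ o₂) in
/-- The distribution of the velocities of all smooth motions without slipping and twisting. -/
def rollingDistribution :
    Set (TangentBundle (((𝓡 2).prod (𝓡 2)).prod (𝓡 1)) (RollingSpace g₁ o₁ g₂ o₂)) :=
  {w | ∃ γ : ℝ → RollingSpace g₁ o₁ g₂ o₂, ∃ ε > (0 : ℝ),
    ContMDiffOn 𝓘(ℝ, ℝ) (((𝓡 2).prod (𝓡 2)).prod (𝓡 1)) ∞ γ (Ioo (-ε) ε) ∧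
    NoSlip γ (Ioo (-ε) ε) ∧ NoTwist γ (Ioo (-ε) ε) ∧
    w = velocity (((𝓡 2).prod (𝓡 2)).prod (𝓡 1)) γ 0}

end Rolling

section

variable {EX : Type*} [NormedAddCommGroup EX] [NormedSpace ℝ EX]
    {HX : Type*} [TopologicalSpace HX] {IX : ModelWithCorners ℝ EX HX}
    {X : Type*} [TopologicalSpace X] [ChartedSpace HX X]

/-- A family of tangent vectors is a field of `r`-planes if over each point of `X` it is a linear
subspace of the tangent space of dimension `r`. -/
def IsPlaneField (r : ℕ) (D : Set (TangentBundle IX X)) : Prop :=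
  ∀ x : X, ∃ W : Submodule ℝ (TangentSpace IX x), finrank ℝ W = r ∧
    ∀ w : TangentSpace IX x, (⟨x, w⟩ : TangentBundle IX X) ∈ D ↔ w ∈ W

end

end

open Set Function Manifold Bundle Module
open scoped Topology ContDiff

noncomputable section

/-! ### Tangent vectors and velocities in a chart -/

section ChartCoord

variable {EX : Type*} [NormedAddCommGroup EX] [NormedSpace ℝ EX]
    {HX : Type*} [TopologicalSpace HX] {IX : ModelWithCorners ℝ EX HX}
    {X : Type*} [TopologicalSpace X] [ChartedSpace HX X] [IsManifold IX 1 X]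

/-! Everything is read in oriented orthonormal frames `(e₁, e₂)` of the first surface and `(e₃, e₄)`
of the second, each tangent plane being identified with `ℂ`. A rotation by `φ` is multiplication by
`e^{iφ}`, and its graph, the set of pairs `(u, v)` with `v = e^{iφ} u`, is the null plane with
twistor coordinate `φ` (`graphPlane_rotationMap`). So the graph map is the identity in the
trivializations given by a pair of frames (`angle_graphFiber`), and it is a diffeomorphism.

For the distributions, the Levi-Civita connection of `g₁ ⊕ (-g₂)` is the product connection: the
sign does not change which fields are parallel (`isParallelAt_split_iff`). In a frame with
connection form `α`, the Koszul formula shows that a field with complex coordinate `z` along `γ` is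
parallel exactly when `z' = -i α(γ') z` (`isParallelAt_iff`). Hence if `z ≠ 0` is parallel along
`x`, then `e^{iθ} z` is parallel along `x̂` exactly when `θ' = α₁(x') - α₂(x̂')`. This equation
expresses the absence of twisting. It also expresses that the graph of `A` moves by parallel
transport, because parallel fields spanning the graph have the form `(v, A v)`. Absence of slipping
means that the velocity of the base curve lies in the graph. So in the coordinates `((x, x̂), θ)`
both distributions are the image of the injective linear map `w ↦ (w, e^{iθ} w, α₁(w) - α₂(e^{iθ}
w))` on `ℂ` (`rollingVector`).

The two definitions differ in one respect: a rolling motion does not slip during a whole time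
interval, whereas a curve defining a twistor vector has its velocity in the plane only at `t = 0`.
The curves therefore do not correspond one to one, and only velocities are compared. Every
horizontal curve of graphs with velocity in the plane at `t = 0` has a velocity of the above form
(`exists_velocity_eq_rollingLift`). Rolling motions give such curves
(`exists_isHorizontal_of_noTwist`). Conversely, an ordinary differential equation with `w` held
constant produces a rolling motion with any prescribed velocity of that form
(`rollingLift_mem_rollingDistribution`). -/

theorem chartCoord_eq_clm (x₀ : X) {x : X} (hx : x ∈ (chartAt HX x₀).source)
    (w : TangentSpace IX x) : chartCoord x₀ w =
      (trivializationAt EX (TangentSpace IX) x₀).continuousLinearMapAt ℝ x w := by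
  rw [Trivialization.continuousLinearMapAt_apply, Trivialization.coe_linearMapAt_of_mem]
  · rfl
  · simpa using hx

theorem chartCoord_eq_mfderiv (x₀ : X) {x : X} (hx : x ∈ (chartAt HX x₀).source)
    (w : TangentSpace IX x) : chartCoord x₀ w = mfderiv IX 𝓘(ℝ, EX) (extChartAt IX x₀) x w := by
  rw [chartCoord_eq_clm x₀ hx, TangentBundle.continuousLinearMapAt_trivializationAt hx]
  rfl

/-- The tangent space at `x` is modelled through the preferred chart at `x`, whose derivative there
is the identity. -/
theorem chartCoord_self (x : X) (w : TangentSpace IX x) : chartCoord x w = w := by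
  rw [chartCoord_eq_mfderiv x (mem_chart_source HX x), mfderiv_extChartAt_self]
  rfl

theorem chartCoord_symm (x₀ : X) {x : X} (hx : x ∈ (chartAt HX x₀).source) (a : EX) :
    chartCoord x₀ ((trivializationAt EX (TangentSpace IX) x₀).symm x a) = a := by
  rw [chartCoord, Trivialization.apply_mk_symm]
  simpa using hx

theorem symm_chartCoord (x₀ : X) {x : X} (hx : x ∈ (chartAt HX x₀).source)
    (w : TangentSpace IX x) :
    (trivializationAt EX (TangentSpace IX) x₀).symm x (chartCoord x₀ w) = w := by
  rw [chartCoord]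
  exact Trivialization.symm_proj_apply _ (⟨x, w⟩ : TangentBundle IX X) (by simpa using hx)

/-- The test takes place in the chart at `γ t`, the one in which `covDerivPairing` is written. -/
theorem mdifferentiableAt_tangent_iff {γ : ℝ → X} {V : ∀ t, TangentSpace IX (γ t)} {t : ℝ} :
    MDifferentiableAt 𝓘(ℝ, ℝ) IX.tangent (fun s => (⟨γ s, V s⟩ : TangentBundle IX X)) t ↔
      MDifferentiableAt 𝓘(ℝ, ℝ) IX γ t ∧
        DifferentiableAt ℝ (fun s => chartCoord (γ t) (V s)) t := by
  rw [← mdifferentiableAt_iff_differentiableAt]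
  exact mdifferentiableAt_totalSpace IX (IM := 𝓘(ℝ, ℝ)) (fun s => (⟨γ s, V s⟩ : TangentBundle IX X))

theorem hasDerivAt_extChartAt_comp {γ : ℝ → X} {t : ℝ} (x₀ : X)
    (hx : γ t ∈ (chartAt HX x₀).source) (h : MDifferentiableAt 𝓘(ℝ, ℝ) IX γ t) :
    HasDerivAt (fun s => extChartAt IX x₀ (γ s)) (chartCoord x₀ (velocityAt IX γ t)) t := by
  have h1 := (mdifferentiableAt_extChartAt (I := IX) hx).hasMFDerivAt.comp t h.hasMFDerivAt
  have h2 : HasFDerivAt (fun s => extChartAt IX x₀ (γ s)) (show ℝ →L[ℝ] EX from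
    (mfderiv IX 𝓘(ℝ, EX) (extChartAt IX x₀) (γ t)).comp (mfderiv 𝓘(ℝ, ℝ) IX γ t)) t :=
    hasMFDerivAt_iff_hasFDerivAt.1 h1
  rw [chartCoord_eq_mfderiv x₀ hx]
  exact h2.hasDerivAt

end ChartCoord

/-! ### Smooth integral curves -/

section ODE

variable {E : Type*} [NormedAddCommGroup E] [NormedSpace ℝ E] [CompleteSpace E]

/-- Integral curves of smooth vector fields exist and are smooth. -/
theorem exists_contDiffOn_integralCurve {U : Set E} (hU : IsOpen U) {F : E → E}
    (hF : ContDiffOn ℝ ∞ F U) {u₀ : E} (hu₀ : u₀ ∈ U) :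
    ∃ α : ℝ → E, ∃ ε > (0 : ℝ), α 0 = u₀ ∧ ContDiffOn ℝ ∞ α (Ioo (-ε) ε) ∧
      ∀ t ∈ Ioo (-ε) ε, α t ∈ U ∧ HasDerivAt α (F (α t)) t := by
  obtain ⟨α, h0, ε, hε, hα⟩ :=
    ((hF.contDiffAt (hU.mem_nhds hu₀)).of_le (by simp)).exists_forall_mem_closedBall_exists_eq_forall_mem_Ioo_hasDerivAt₀ 0
  simp only [zero_sub, zero_add] at hα
  have hc : ContinuousAt α 0 := (hα 0 ⟨by linarith, hε⟩).continuousAt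
  have hn : α ⁻¹' U ∈ 𝓝 (0 : ℝ) := hc (hU.mem_nhds (by rwa [h0]))
  obtain ⟨δ, hδ, hδU⟩ := Metric.mem_nhds_iff.1 hn
  rw [Real.ball_eq_Ioo] at hδU
  simp only [zero_sub, zero_add] at hδU
  -- Halving makes the closed interval `[-r, r]` fit inside both the interval of existence and the
  -- preimage of `U`; the regularity theorem used below lives on a closed interval.
  set r := min ε δ / 2
  have hm : 0 < min ε δ := lt_min hε hδ
  have hrε : r < ε := by have := min_le_left ε δ; simp only [r]; linarith
  have hrδ : r < δ := by have := min_le_right ε δ; simp only [r]; linarith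
  have hr : 0 < r := by simp only [r]; linarith
  have h1 : ∀ t ∈ Icc (-r) r, HasDerivAt α (F (α t)) t := fun t ht =>
    hα t ⟨by linarith [ht.1], by linarith [ht.2]⟩
  have h2 : MapsTo α (Icc (-r) r) U := fun t ht => hδU ⟨by linarith [ht.1], by linarith [ht.2]⟩
  refine ⟨α, r, hr, h0, ?_, fun t ht => ⟨h2 (Ioo_subset_Icc_self ht), h1 t (Ioo_subset_Icc_self ht)⟩⟩
  -- Solutions inherit the smoothness of the field; the autonomous `F` is regarded as a
  -- time-dependent field that ignores the time.
  refine ContDiffOn.mono (ODE.contDiffOn_enat_Icc_of_hasDerivWithinAt (f := fun _ => F) (u := U)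
    (n := ⊤) ?_ (fun t ht => (h1 t ht).hasDerivWithinAt) h2) Ioo_subset_Icc_self
  exact hF.comp contDiffOn_snd fun p hp => hp.2

end ODE

/-! ### The Koszul formula for an orthonormal frame in a vector space -/

section Koszul

variable {E : Type*} [NormedAddCommGroup E] [NormedSpace ℝ E]

/-- The expression `g(∇V, Z)` of `covDerivPairing` in a vector space with metric `G`, at a point `u`
where the field along the curve has value `v` and derivative `dv`, and the curve has velocity `w`. -/
def flatPairing (G : E → E →L[ℝ] E →L[ℝ] ℝ) (u v dv w Z : E) : ℝ :=
  G u dv Z + (fderiv ℝ G u w v Z + fderiv ℝ G u v w Z - fderiv ℝ G u Z w v) / 2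

variable {G : E → E →L[ℝ] E →L[ℝ] ℝ} {u : E} {ι : Type*} {e : ι → E → E} {η : ι → ι → ℝ}

/-- The function `y ↦ g(eᵢ, eⱼ)` is locally constant, and the product rule writes out its zero
derivative. -/
theorem fderiv_metric_frame (hG : DifferentiableAt ℝ G u) (he : ∀ i, DifferentiableAt ℝ (e i) u)
    (ho : ∀ i j, ∀ᶠ y in 𝓝 u, G y (e i y) (e j y) = η i j) (i j : ι) (w : E) :
    fderiv ℝ G u w (e i u) (e j u) + G u (fderiv ℝ (e i) u w) (e j u) +
      G u (e i u) (fderiv ℝ (e j) u w) = 0 := by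
  have h1 := (hG.hasFDerivAt.clm_apply (he i).hasFDerivAt).clm_apply (he j).hasFDerivAt
  have h2 : HasFDerivAt (fun y => G y (e i y) (e j y)) (0 : E →L[ℝ] ℝ) u :=
    (hasFDerivAt_const (η i j) u).congr_of_eventuallyEq (ho i j)
  have h3 := congrArg (fun T : E →L[ℝ] ℝ => T w) (h1.unique h2)
  simp at h3
  linarith

/-- The Koszul formula for a frame with constant inner products. -/
theorem flatPairing_frame (hG : DifferentiableAt ℝ G u) (he : ∀ i, DifferentiableAt ℝ (e i) u)
    (hs : ∀ᶠ y in 𝓝 u, ∀ a b, G y a b = G y b a)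
    (ho : ∀ i j, ∀ᶠ y in 𝓝 u, G y (e i y) (e j y) = η i j) (i j k : ι) :
    flatPairing G u (e j u) (fderiv ℝ (e j) u (e i u)) (e i u) (e k u) =
      (G u (VectorField.lieBracket ℝ (e i) (e j) u) (e k u) -
        G u (VectorField.lieBracket ℝ (e i) (e k) u) (e j u) -
        G u (VectorField.lieBracket ℝ (e j) (e k) u) (e i u)) / 2 := by
  have m := fderiv_metric_frame hG he ho
  have s := fun a b => hs.self_of_nhds a b
  simp only [flatPairing, VectorField.lieBracket, map_sub, sub_apply]
  -- The derivatives of `g(eⱼ, eₖ)`, `g(eᵢ, eₖ)`, `g(eᵢ, eⱼ)` along `eᵢ`, `eⱼ`, `eₖ`: these are the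
  -- derivative terms of the Koszul formula, all zero here. The bracket terms remain.
  have m1 := m j k (e i u)
  have m2 := m i k (e j u)
  have m3 := m i j (e k u)
  rw [s (e j u) _] at m1
  rw [s (e i u) _] at m2 m3
  linarith

-- Here `a` holds the components of the field, `da` their derivatives and `c` the components of the
-- velocity `w`. A frame of two vectors has a single bracket up to sign, so one number, `g([e₀, e₁],
-- w)`, carries the whole connection, and it acts as an infinitesimal rotation of the components.
set_option synthInstance.maxHeartbeats 200000 in
theorem flatPairing_lie {e : Fin 2 → E → E} (hG : DifferentiableAt ℝ G u)
    (he : ∀ i, DifferentiableAt ℝ (e i) u)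
    (hs : ∀ᶠ y in 𝓝 u, ∀ a b, G y a b = G y b a)
    (ho : ∀ i j, ∀ᶠ y in 𝓝 u, G y (e i y) (e j y) = if i = j then 1 else 0) (a da c : Fin 2 → ℝ) :
    let w := c 0 • e 0 u + c 1 • e 1 u
    let dv := (da 0 • e 0 u + a 0 • fderiv ℝ (e 0) u w) + (da 1 • e 1 u + a 1 • fderiv ℝ (e 1) u w)
    flatPairing G u (a 0 • e 0 u + a 1 • e 1 u) dv w (e 0 u) =
        da 0 + a 1 * G u (VectorField.lieBracket ℝ (e 0) (e 1) u) w ∧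
      flatPairing G u (a 0 • e 0 u + a 1 • e 1 u) dv w (e 1 u) =
        da 1 - a 0 * G u (VectorField.lieBracket ℝ (e 0) (e 1) u) w := by
  intro w dv
  -- Bilinearity in field and velocity: apart from the `da` terms, only the pairings of `∇_{eᵢ} eⱼ`
  -- with `eₖ` occur, which `flatPairing_frame` evaluates.
  have key : ∀ k, flatPairing G u (a 0 • e 0 u + a 1 • e 1 u) dv w (e k u) =
      (da 0 * G u (e 0 u) (e k u) + da 1 * G u (e 1 u) (e k u)) +
      c 0 * a 0 * flatPairing G u (e 0 u) (fderiv ℝ (e 0) u (e 0 u)) (e 0 u) (e k u) +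
      c 0 * a 1 * flatPairing G u (e 1 u) (fderiv ℝ (e 1) u (e 0 u)) (e 0 u) (e k u) +
      c 1 * a 0 * flatPairing G u (e 0 u) (fderiv ℝ (e 0) u (e 1 u)) (e 1 u) (e k u) +
      c 1 * a 1 * flatPairing G u (e 1 u) (fderiv ℝ (e 1) u (e 1 u)) (e 1 u) (e k u) := by
    intro k
    simp only [flatPairing, dv, w]
    generalize fderiv ℝ G u = D
    simp only [map_add, map_smul, add_apply, smul_apply, smul_eq_mul]
    ring
  have hw := VectorField.lieBracket_swap (𝕜 := ℝ) (V := e 1) (W := e 0) (x := u)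
  have h00 := (ho 0 0).self_of_nhds
  have h01 := (ho 0 1).self_of_nhds
  have h10 := (ho 1 0).self_of_nhds
  have h11 := (ho 1 1).self_of_nhds
  simp only [key, flatPairing_frame hG he hs ho, VectorField.lieBracket_self, hw, map_neg,
    neg_apply, h00, h01, h10, h11]
  simp only [w, map_add, map_smul, smul_eq_mul]
  constructor <;> simp <;> ring

end Koszul

/-! ### Vector fields and Lie brackets in a chart -/

section ChartField

variable {EX : Type*} [NormedAddCommGroup EX] [NormedSpace ℝ EX]
    {HX : Type*} [TopologicalSpace HX] {IX : ModelWithCorners ℝ EX HX}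
    {X : Type*} [TopologicalSpace X] [ChartedSpace HX X] [IsManifold IX ∞ X]

/-- A vector field in the chart at `x₀`. -/
def chartField (x₀ : X) (s : ∀ x : X, TangentSpace IX x) (u : EX) : EX :=
  chartCoord x₀ (s ((extChartAt IX x₀).symm u))

theorem symm_mem_chart_source (x₀ : X) {u : EX} (hu : u ∈ (extChartAt IX x₀).target) :
    (extChartAt IX x₀).symm u ∈ (chartAt HX x₀).source := by
  rw [← extChartAt_source (I := IX)]
  exact (extChartAt IX x₀).map_target hu

theorem isOpen_chart_preimage [IX.Boundaryless] (x₀ : X) {U : Set X} (hU : IsOpen U) :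
    IsOpen ((extChartAt IX x₀).target ∩ (extChartAt IX x₀).symm ⁻¹' U) :=
  (continuousOn_extChartAt_symm x₀).isOpen_inter_preimage (isOpen_extChartAt_target x₀) hU

theorem contDiffOn_chartFun [IX.Boundaryless] {F : Type*} [NormedAddCommGroup F] [NormedSpace ℝ F]
    (x₀ : X) {U : Set X} {f : X → F}
    (hf : ContMDiffOn IX 𝓘(ℝ, F) ∞ f U) :
    ContDiffOn ℝ ∞ (fun u => f ((extChartAt IX x₀).symm u))
      ((extChartAt IX x₀).target ∩ (extChartAt IX x₀).symm ⁻¹' U) :=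
  contMDiffOn_iff_contDiffOn.1 (hf.comp ((contMDiffOn_extChartAt_symm x₀).mono inter_subset_left)
    fun _ h => h.2)

theorem contDiffOn_chartField [IX.Boundaryless] (x₀ : X) {U : Set X} (hU : IsOpen U)
    {s : ∀ x : X, TangentSpace IX x}
    (hs : ContMDiffOn IX IX.tangent ∞ (fun x => (⟨x, s x⟩ : TangentBundle IX X)) U) :
    ContDiffOn ℝ ∞ (chartField x₀ s)
      ((extChartAt IX x₀).target ∩ (extChartAt IX x₀).symm ⁻¹' U) := by
  have h1 : ContMDiffOn IX 𝓘(ℝ, EX) ∞ (fun x => chartCoord x₀ (s x))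
      (U ∩ (chartAt HX x₀).source) := by
    have := (Trivialization.contMDiffOn_section_iff (IB := IX) (n := ∞) (s := s)
      (trivializationAt EX (TangentSpace IX) x₀)
      (a := U ∩ (chartAt HX x₀).source) (hU.inter (chartAt HX x₀).open_source)
      (by simp)).1 (hs.mono inter_subset_left)
    exact this
  refine (contDiffOn_chartFun x₀ h1).mono fun u hu => ⟨hu.1, hu.2, symm_mem_chart_source x₀ hu.1⟩

/-- These are the constant-coefficient fields of the chart; inserted into the metric they give its
smooth coefficients. -/
theorem contMDiffOn_symm_const (x₀ : X) (a : EX) :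
    ContMDiffOn IX IX.tangent ∞
      (fun x => (⟨x, (trivializationAt EX (TangentSpace IX) x₀).symm x a⟩ : TangentBundle IX X))
      (chartAt HX x₀).source := by
  refine (Trivialization.contMDiffOn_section_iff (IB := IX) (n := ∞)
    (s := fun x => (trivializationAt EX (TangentSpace IX) x₀).symm x a)
    (trivializationAt EX (TangentSpace IX) x₀) (chartAt HX x₀).open_source (by simp)).2 ?_
  exact (contMDiffOn_const (c := a)).congr fun x hx => chartCoord_symm x₀ hx a

/-- The bracket on the manifold is the bracket of the fields pulled back to the chart at `x₀`,
carried back by the derivative of the chart. At `x₀` that derivative is the identity, and without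
boundary the range of the model is the whole space. -/
theorem mlieBracket_eq_lieBracket_chartField [IX.Boundaryless] [CompleteSpace EX] (x₀ : X)
    (s t : ∀ x : X, TangentSpace IX x) : VectorField.mlieBracket IX s t x₀ =
      VectorField.lieBracket ℝ (chartField x₀ s) (chartField x₀ t) (extChartAt IX x₀ x₀) := by
  have h1 : ∀ s : ∀ x : X, TangentSpace IX x,
      VectorField.mpullbackWithin 𝓘(ℝ, EX) IX (extChartAt IX x₀).symm s (range IX) =ᶠ[𝓝 (extChartAt IX x₀ x₀)]
        chartField x₀ s := by
    intro s
    filter_upwards [extChartAt_target_mem_nhds (I := IX) x₀] with u hu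
    have hx := symm_mem_chart_source x₀ hu
    rw [VectorField.mpullbackWithin_apply, chartField]
    have hb : (extChartAt IX x₀).symm u ∈
      (trivializationAt EX (TangentSpace IX) x₀).baseSet := by simpa using hx
    have h2 := TangentBundle.symmL_trivializationAt (I := IX) hx
    rw [(extChartAt IX x₀).right_inv hu] at h2
    let T : TangentSpace IX ((extChartAt IX x₀).symm u) →L[ℝ] TangentSpace 𝓘(ℝ, EX) u :=
      (trivializationAt EX (TangentSpace IX) x₀).continuousLinearMapAt ℝ ((extChartAt IX x₀).symm u)
    -- The trivialization at `x₀` inverts the derivative of the inverse chart, so the pullback of a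
    -- field is its coordinate expression `chartField`.
    have h3 : (mfderivWithin 𝓘(ℝ, EX) IX (extChartAt IX x₀).symm (range IX) u).inverse = T := by
      refine ContinuousLinearMap.inverse_eq ?_ ?_
      · rw [← h2]
        ext1 a
        exact Trivialization.symmL_continuousLinearMapAt _ hb a
      · rw [← h2]
        ext1 a
        exact Trivialization.continuousLinearMapAt_symmL _ hb a
    rw [h3]
    exact (chartCoord_eq_clm x₀ hx _).symm
  have h2 := Filter.EventuallyEq.lieBracket_vectorField_eq (𝕜 := ℝ) (h1 s) (h1 t)
  rw [← VectorField.mlieBracketWithin_univ,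
    VectorField.mlieBracketWithin_apply, mfderiv_extChartAt_self, preimage_univ, univ_inter]
  have h5 : (ContinuousLinearMap.id ℝ EX).inverse = ContinuousLinearMap.id ℝ EX :=
    ContinuousLinearMap.inverse_id
  have h6 : ∀ (V W : EX → EX) (u : EX), VectorField.lieBracketWithin ℝ V W (range IX) u =
      VectorField.lieBracket ℝ V W u := by
    intro V W u
    rw [IX.range_eq_univ, VectorField.lieBracketWithin_univ]
  exact ((congrArg (fun T : EX →L[ℝ] EX => T _) h5).trans (h6 _ _ _)).trans h2

end ChartField

/-! ### The metric of a surface in a chart -/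

section SurfaceChart

variable {S : Type*} [TopologicalSpace S] [ChartedSpace (EuclideanSpace ℝ (Fin 2)) S]
  [IsManifold (𝓡 2) ∞ S]

local notation "E2" => EuclideanSpace ℝ (Fin 2)

/-- The metric in the chart at `x₀`. -/
def chartMetric (g : SurfaceMetric S) (x₀ : S) (u : E2) : E2 →L[ℝ] E2 →L[ℝ] ℝ :=
  let B : E2 →L[ℝ] E2 →L[ℝ] ℝ := g.inner ((extChartAt (𝓡 2) x₀).symm u)
  let L : E2 →L[ℝ] E2 :=
    (trivializationAt E2 (TangentSpace (𝓡 2)) x₀).symmL ℝ ((extChartAt (𝓡 2) x₀).symm u)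
  B.bilinearComp L L

/-- Replaces `chartForm`, a bare function of two vectors at each point, by a map into continuous
bilinear forms, which can be differentiated as a whole. -/
theorem chartForm_eq_chartMetric (g : SurfaceMetric S) (x₀ : S) {u : E2}
    (hu : u ∈ (extChartAt (𝓡 2) x₀).target) (a b : E2) :
    chartForm (metricForm g) x₀ u a b = chartMetric g x₀ u a b := by
  have hb : (extChartAt (𝓡 2) x₀).symm u ∈ (trivializationAt E2 (TangentSpace (𝓡 2)) x₀).baseSet := by
    simpa using symm_mem_chart_source x₀ hu
  rw [chartForm, ← Trivialization.symmL_apply (R := ℝ) _ hb, ← Trivialization.symmL_apply (R := ℝ) _ hb]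
  rfl

/-- In finite dimension a map into bilinear forms is smooth as soon as its values on each fixed pair
of vectors are, that is, the metric coefficients. -/
theorem contDiffOn_chartMetric (g : SurfaceMetric S) (x₀ : S) :
    ContDiffOn ℝ ∞ (chartMetric g x₀) (extChartAt (𝓡 2) x₀).target := by
  refine contDiffOn_clm_apply.2 fun a => contDiffOn_clm_apply.2 fun b => ?_
  have h := contDiffOn_chartFun x₀ (contMDiffOn_metric g (contMDiffOn_symm_const x₀ a)
    (contMDiffOn_symm_const x₀ b))
  exact (h.mono fun u hu => ⟨hu, symm_mem_chart_source x₀ hu⟩).congr fun u hu =>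
    (chartForm_eq_chartMetric g x₀ hu a b).symm

theorem chartMetric_symm (g : SurfaceMetric S) (x₀ : S) (u a b : E2) :
    chartMetric g x₀ u a b = chartMetric g x₀ u b a := g.symm _ _ _

theorem chartMetric_chartCoord (g : SurfaceMetric S) (x₀ : S) {u : E2}
    (hu : u ∈ (extChartAt (𝓡 2) x₀).target)
    (v w : TangentSpace (𝓡 2) ((extChartAt (𝓡 2) x₀).symm u)) :
    chartMetric g x₀ u (chartCoord x₀ v) (chartCoord x₀ w) = metricForm g _ v w := by
  rw [← chartForm_eq_chartMetric g x₀ hu, chartForm, symm_chartCoord x₀ (symm_mem_chart_source x₀ hu),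
    symm_chartCoord x₀ (symm_mem_chart_source x₀ hu)]

end SurfaceChart

/-! ### Parallel fields in an orthonormal frame -/

theorem hasDerivAt_complex_iff {a b : ℝ → ℝ} {z : ℂ} {t : ℝ} :
    HasDerivAt (fun s => (⟨a s, b s⟩ : ℂ)) z t ↔ HasDerivAt a z.re t ∧ HasDerivAt b z.im t := by
  constructor
  · intro h
    exact ⟨Complex.reCLM.hasFDerivAt.comp_hasDerivAt t h, Complex.imCLM.hasFDerivAt.comp_hasDerivAt t h⟩
  · rintro ⟨h1, h2⟩
    exact Complex.equivRealProdCLM.symm.toContinuousLinearMap.hasFDerivAt.comp_hasDerivAt t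
      (h1.prodMk h2)

section FrameCoord

variable {S : Type*} [TopologicalSpace S] [ChartedSpace (EuclideanSpace ℝ (Fin 2)) S]
  [IsManifold (𝓡 2) ∞ S] {g : SurfaceMetric S} {o : SurfaceOrientation S}

local notation "E2" => EuclideanSpace ℝ (Fin 2)

/-- The complex coordinate `v¹ + √-1 v²` of a tangent vector in an oriented orthonormal frame. -/
def frameCoord (f : SurfaceFrame g o) (x : S) (v : TangentSpace (𝓡 2) x) : ℂ :=
  ⟨f.isFrame.coeff 0 x v, f.isFrame.coeff 1 x v⟩

/-- The tangent vector with a given complex coordinate in an oriented orthonormal frame. -/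
def frameVec (f : SurfaceFrame g o) (x : S) : ℂ →ₗ[ℝ] TangentSpace (𝓡 2) x :=
  Complex.reLm.smulRight (f.vec 0 x) + Complex.imLm.smulRight (f.vec 1 x)

theorem frameVec_apply (f : SurfaceFrame g o) (x : S) (w : ℂ) :
    frameVec f x w = w.re • f.vec 0 x + w.im • f.vec 1 x := rfl

/-- The connection form `v ↦ g(∇_v e₁, e₂) = -g([e₁, e₂], v)` of an oriented orthonormal frame. -/
def connForm (f : SurfaceFrame g o) (x : S) : TangentSpace (𝓡 2) x →ₗ[ℝ] ℝ :=
  -(metricForm g x (VectorField.mlieBracket (𝓡 2) (f.vec 0) (f.vec 1) x))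

theorem frameVec_frameCoord (f : SurfaceFrame g o) {x : S} (hx : x ∈ f.dom)
    (v : TangentSpace (𝓡 2) x) : frameVec f x (frameCoord f x v) = v := by
  have h := (f.isFrame.toBasisAt hx).sum_repr v
  rw [Fin.sum_univ_two] at h
  simpa [frameVec_apply, frameCoord, IsLocalFrameOn.coeff, hx] using h

theorem frameCoord_frameVec (f : SurfaceFrame g o) {x : S} (hx : x ∈ f.dom) (w : ℂ) :
    frameCoord f x (frameVec f x w) = w := by
  rw [frameVec_apply, ← f.isFrame.toBasisAt_coe hx 0, ← f.isFrame.toBasisAt_coe hx 1]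
  simp only [frameCoord, IsLocalFrameOn.coeff, hx, dite_true, map_add, map_smul, Basis.coord_apply,
    Basis.repr_self]
  simp

theorem metricForm_vec (f : SurfaceFrame g o) {x : S} (hx : x ∈ f.dom) (i j : Fin 2) :
    metricForm g x (f.vec i x) (f.vec j x) = if i = j then 1 else 0 := by
  have h := f.ortho x hx i j
  rw [f.isFrame.toBasisAt_coe, f.isFrame.toBasisAt_coe] at h
  rw [h]
  fin_cases i <;> fin_cases j <;> simp [riemSig]

/-- Orthonormality makes the coefficients inner products, so that along a curve they inherit
differentiability from the metric, the frame and the field. -/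
theorem coeff_eq_metricForm (f : SurfaceFrame g o) {x : S} (hx : x ∈ f.dom) (i : Fin 2)
    (v : TangentSpace (𝓡 2) x) : f.isFrame.coeff i x v = metricForm g x v (f.vec i x) := by
  conv_rhs => rw [← frameVec_frameCoord f hx v, frameVec_apply]
  simp only [map_add, map_smul, LinearMap.add_apply, LinearMap.smul_apply, metricForm_vec f hx]
  fin_cases i <;> simp [frameCoord]

set_option synthInstance.maxHeartbeats 200000 in
theorem flatPairing_add_smul {E : Type*} [NormedAddCommGroup E] [NormedSpace ℝ E]
    (G : E → E →L[ℝ] E →L[ℝ] ℝ) (u v dv w Z Z' : E) (r r' : ℝ) :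
    flatPairing G u v dv w (r • Z + r' • Z') =
      r * flatPairing G u v dv w Z + r' * flatPairing G u v dv w Z' := by
  simp only [flatPairing]
  generalize fderiv ℝ G u = D
  simp only [map_add, map_smul, add_apply, smul_apply, smul_eq_mul]
  ring

theorem differentiableAt_bilin_comp {E : Type*} [NormedAddCommGroup E] [NormedSpace ℝ E]
    {G : E → E →L[ℝ] E →L[ℝ] ℝ} {u v w : ℝ → E} {t : ℝ} (hG : DifferentiableAt ℝ G (u t))
    (hu : DifferentiableAt ℝ u t) (hv : DifferentiableAt ℝ v t) (hw : DifferentiableAt ℝ w t) :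
    DifferentiableAt ℝ (fun s => G (u s) (v s) (w s)) t := by
  have h : DifferentiableAt ℝ (fun s => G (u s)) t :=
    DifferentiableAt.comp (G := E →L[ℝ] E →L[ℝ] ℝ) t hG hu
  exact (h.clm_apply hv).clm_apply hw

set_option synthInstance.maxHeartbeats 200000 in
/-- Parallel vector fields in an oriented orthonormal frame with connection form `α`: in complex
coordinates `z' = -√-1 α(γ') z`. -/
theorem isParallelAt_iff (f : SurfaceFrame g o) {γ : ℝ → S} {V : ∀ t, TangentSpace (𝓡 2) (γ t)}
    {t : ℝ} (ht : γ t ∈ f.dom) :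
    (MDifferentiableAt 𝓘(ℝ, ℝ) (𝓡 2).tangent (fun s => (⟨γ s, V s⟩ : TangentBundle (𝓡 2) S)) t ∧
      ∀ Z : E2, covDerivPairing (metricForm g) γ V t Z = 0) ↔
    MDifferentiableAt 𝓘(ℝ, ℝ) (𝓡 2) γ t ∧
      HasDerivAt (fun s => frameCoord f (γ s) (V s))
        (-(connForm f (γ t) (velocityAt (𝓡 2) γ t) : ℂ) * Complex.I * frameCoord f (γ t) (V t)) t := by
  -- Differentiability of `γ` occurs on both sides and is split off; what remains compares the
  -- vanishing of the covariant derivative with the equation for `z`.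
  rw [mdifferentiableAt_tangent_iff, and_assoc]
  refine and_congr_right fun hγ => ?_
  set x₀ := γ t with hx₀
  set u : ℝ → E2 := fun s => extChartAt (𝓡 2) x₀ (γ s) with hu
  set v : ℝ → E2 := fun s => chartCoord x₀ (V s) with hv
  let e : Fin 2 → E2 → E2 := fun i => chartField x₀ (f.vec i)
  let G := chartMetric g x₀
  let c : Fin 2 → ℝ → ℝ := fun i s => f.isFrame.coeff i (γ s) (V s)
  have hT : (extChartAt (𝓡 2) x₀).target ∩ (extChartAt (𝓡 2) x₀).symm ⁻¹' f.dom ∈ 𝓝 (u t) := by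
    refine (isOpen_chart_preimage x₀ f.isOpen_dom).mem_nhds ⟨mem_extChartAt_target x₀, ?_⟩
    exact (congrArg (· ∈ f.dom) (extChartAt_to_inv (I := 𝓡 2) x₀)).mpr ht
  have hT' : (extChartAt (𝓡 2) x₀).target ∈ 𝓝 (u t) := Filter.mem_of_superset hT inter_subset_left
  have hev : ∀ᶠ s in 𝓝 t, γ s ∈ (chartAt E2 x₀).source ∩ f.dom :=
    hγ.continuousAt.preimage_mem_nhds (((chartAt E2 x₀).open_source.inter f.isOpen_dom).mem_nhds
      ⟨mem_chart_source E2 _, ht⟩)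
  have hud : HasDerivAt u (velocityAt (𝓡 2) γ t) t := by
    have := hasDerivAt_extChartAt_comp x₀ (mem_chart_source E2 _) hγ
    rwa [chartCoord_self] at this
  have hG : DifferentiableAt ℝ G (u t) :=
    ((contDiffOn_chartMetric g x₀).contDiffAt hT').differentiableAt (by simp)
  have he : ∀ i, DifferentiableAt ℝ (e i) (u t) := fun i =>
    ((contDiffOn_chartField x₀ f.isOpen_dom (f.isFrame.contMDiffOn i)).contDiffAt hT).differentiableAt
      (by simp)
  have hs : ∀ᶠ y in 𝓝 (u t), ∀ a b, G y a b = G y b a :=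
    Filter.Eventually.of_forall fun y a b => chartMetric_symm g x₀ y a b
  have ho : ∀ i j, ∀ᶠ y in 𝓝 (u t), G y (e i y) (e j y) = if i = j then 1 else 0 := by
    intro i j
    filter_upwards [hT] with y hy
    exact (chartMetric_chartCoord g x₀ hy.1 _ _).trans (metricForm_vec f hy.2 i j)
  have hinv : ∀ s, γ s ∈ (chartAt E2 x₀).source → (extChartAt (𝓡 2) x₀).symm (u s) = γ s :=
    fun s h => (extChartAt (𝓡 2) x₀).left_inv (by rwa [extChartAt_source])
  have hee : ∀ i s, γ s ∈ (chartAt E2 x₀).source → e i (u s) = chartCoord x₀ (f.vec i (γ s)) := by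
    intro i s h
    simp only [e, chartField]
    rw [hinv s h]
  have hGg : ∀ s, γ s ∈ (chartAt E2 x₀).source → ∀ a b : TangentSpace (𝓡 2) (γ s),
      G (u s) (chartCoord x₀ a) (chartCoord x₀ b) = metricForm g (γ s) a b := by
    intro s h
    have h1 : u s ∈ (extChartAt (𝓡 2) x₀).target :=
      (extChartAt (𝓡 2) x₀).map_source (by rwa [extChartAt_source])
    have h2 := chartMetric_chartCoord g x₀ h1
    rw [hinv s h] at h2
    exact h2
  have hlin : ∀ s, γ s ∈ (chartAt E2 x₀).source → ∀ (p q : ℝ) (a b : TangentSpace (𝓡 2) (γ s)),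
      chartCoord x₀ (p • a + q • b) = p • chartCoord x₀ a + q • chartCoord x₀ b := by
    intro s h p q a b
    simp only [chartCoord_eq_clm x₀ h, map_add, map_smul]
  have hexp : ∀ s, γ s ∈ (chartAt E2 x₀).source ∩ f.dom → ∀ a : TangentSpace (𝓡 2) (γ s),
      chartCoord x₀ a = (frameCoord f (γ s) a).re • e 0 (u s) + (frameCoord f (γ s) a).im • e 1 (u s) := by
    intro s h a
    rw [hee 0 s h.1, hee 1 s h.1, ← hlin s h.1, ← frameVec_apply, frameVec_frameCoord f h.2]
  -- The expansion of the field in the frame. Since `hcG` recovers the coefficients as inner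
  -- products, `v` is differentiable exactly when the coefficients are.
  have hvc : v =ᶠ[𝓝 t] fun s => c 0 s • e 0 (u s) + c 1 s • e 1 (u s) := by
    filter_upwards [hev] with s h using hexp s h (V s)
  have hcG : ∀ i, c i =ᶠ[𝓝 t] fun s => G (u s) (v s) (e i (u s)) := by
    intro i
    filter_upwards [hev] with s h
    rw [hee i s h.1, hGg s h.1]
    exact coeff_eq_metricForm f h.2 i (V s)
  have heu : ∀ i, HasDerivAt (fun s => e i (u s)) (fderiv ℝ (e i) (u t) (velocityAt (𝓡 2) γ t)) t :=
    fun i => (he i).hasFDerivAt.comp_hasDerivAt t hud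
  have hdiff : DifferentiableAt ℝ v t → ∀ i, DifferentiableAt ℝ (c i) t := fun h i =>
    (differentiableAt_bilin_comp hG hud.differentiableAt h (heu i).differentiableAt).congr_of_eventuallyEq (hcG i)
  have ht' : γ t ∈ (chartAt E2 x₀).source ∩ f.dom := hev.self_of_nhds
  set w := frameCoord f (γ t) (velocityAt (𝓡 2) γ t) with hw
  have hwe : (velocityAt (𝓡 2) γ t : E2) = w.re • e 0 (u t) + w.im • e 1 (u t) := by
    rw [← hexp t ht' (velocityAt (𝓡 2) γ t), chartCoord_self]
  -- The bracket of the coordinate expressions is the bracket on the surface, so the bracket term of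
  -- `flatPairing_lie` is minus the connection form on the velocity.
  have hL : G (u t) (VectorField.lieBracket ℝ (e 0) (e 1) (u t))
      (w.re • e 0 (u t) + w.im • e 1 (u t)) = - connForm f (γ t) (velocityAt (𝓡 2) γ t) := by
    have h1 := mlieBracket_eq_lieBracket_chartField x₀ (f.vec 0) (f.vec 1)
    have h2 := hGg t ht'.1 (VectorField.mlieBracket (𝓡 2) (f.vec 0) (f.vec 1) x₀)
      (velocityAt (𝓡 2) γ t)
    rw [chartCoord_self, chartCoord_self] at h2
    rw [← hwe]
    simp only [connForm, LinearMap.neg_apply, neg_neg]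
    exact (congrArg (fun a : E2 => G (u t) a _) h1.symm).trans h2
  have hvt : v t = c 0 t • e 0 (u t) + c 1 t • e 1 (u t) := hvc.self_of_nhds
  -- The product rule gives the derivative of `v`; inserted in `covDerivPairing`, it yields the
  -- expression that `flatPairing_lie` evaluates on `e₀` and `e₁`.
  have hpair : ∀ da : Fin 2 → ℝ, (∀ i, HasDerivAt (c i) (da i) t) →
      (DifferentiableAt ℝ v t ∧ ∀ Z, covDerivPairing (metricForm g) γ V t Z = flatPairing G (u t)
        (c 0 t • e 0 (u t) + c 1 t • e 1 (u t))
        ((da 0 • e 0 (u t) + c 0 t • fderiv ℝ (e 0) (u t) (w.re • e 0 (u t) + w.im • e 1 (u t))) +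
        (da 1 • e 1 (u t) + c 1 t • fderiv ℝ (e 1) (u t) (w.re • e 0 (u t) + w.im • e 1 (u t))))
        (w.re • e 0 (u t) + w.im • e 1 (u t)) Z) := by
    intro da hda
    have h1 := (((hda 0).smul (heu 0)).add ((hda 1).smul (heu 1))).congr_of_eventuallyEq hvc
    refine ⟨h1.differentiableAt, fun Z => ?_⟩
    have hdg : ∀ p a b : E2, fderiv ℝ (fun y => chartForm (metricForm g) x₀ y a b) (u t) p =
        fderiv ℝ G (u t) p a b := by
      intro p a b
      have h2 := (hG.hasFDerivAt.clm_apply (hasFDerivAt_const a (u t))).clm_apply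
        (hasFDerivAt_const b (u t))
      have h3 : (fun y => chartForm (metricForm g) x₀ y a b) =ᶠ[𝓝 (u t)] fun y => G y a b := by
        filter_upwards [hT'] with y hy using chartForm_eq_chartMetric g x₀ hy a b
      rw [(h2.congr_of_eventuallyEq h3).fderiv]
      simp
    simp only [covDerivPairing]
    change chartForm (metricForm g) x₀ (u t) (deriv v t) Z +
      (fderiv ℝ (fun y => chartForm (metricForm g) x₀ y (v t) Z) (u t) (deriv u t) +
      fderiv ℝ (fun y => chartForm (metricForm g) x₀ y (deriv u t) Z) (u t) (v t) -
      fderiv ℝ (fun y => chartForm (metricForm g) x₀ y (deriv u t) (v t)) (u t) Z) / 2 = _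
    rw [hdg, hdg, hdg, chartForm_eq_chartMetric g x₀ (mem_of_mem_nhds hT'), h1.deriv, hud.deriv,
      hvt, hwe, flatPairing, add_comm (da 0 • _), add_comm (da 1 • _)]
  -- With `q` the connection form on the velocity, the components of the covariant derivative become
  -- `c₀' - q c₁` and `c₁' + q c₀`. Both vanish exactly when `z = c₀ + i c₁` satisfies `z' = -i q
  -- z`.
  have hlie := fun da => flatPairing_lie hG he hs ho (fun i => c i t) da ![w.re, w.im]
  simp only [Matrix.cons_val_zero, Matrix.cons_val_one] at hlie
  simp only [hL] at hlie
  set q := connForm f (γ t) (velocityAt (𝓡 2) γ t)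
  have hcomp : HasDerivAt (fun s => frameCoord f (γ s) (V s))
        (-(q : ℂ) * Complex.I * frameCoord f (γ t) (V t)) t ↔
      HasDerivAt (c 0) (q * c 1 t) t ∧ HasDerivAt (c 1) (- q * c 0 t) t := by
    refine hasDerivAt_complex_iff.trans ?_
    simp [frameCoord, c]
  refine Iff.trans ?_ hcomp.symm
  constructor
  · rintro ⟨h1, h2⟩
    have h3 := fun i => (hdiff h1 i).hasDerivAt
    have h4 := (hpair _ h3).2
    have h5 := hlie (fun i => deriv (c i) t)
    rw [← h4, ← h4, h2, h2] at h5
    have h60 := h3 0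
    have h61 := h3 1
    have e0 : deriv (c 0) t = q * c 1 t := by linarith [h5.1]
    have e1 : deriv (c 1) t = - q * c 0 t := by linarith [h5.2]
    rw [e0] at h60
    rw [e1] at h61
    exact ⟨h60, h61⟩
  · rintro ⟨h1, h2⟩
    have h3 : ∀ i, HasDerivAt (c i) (![q * c 1 t, - q * c 0 t] i) t := by
      intro i; fin_cases i
      · exact h1
      · exact h2
    obtain ⟨h4, h5⟩ := hpair _ h3
    refine ⟨h4, fun Z => ?_⟩
    have h6 := hlie ![q * c 1 t, - q * c 0 t]
    -- The pairing is linear in `Z` and the frame spans, so testing on `e₀` and `e₁` suffices.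
    have hZ : Z = (frameCoord f (γ t) Z).re • e 0 (u t) + (frameCoord f (γ t) Z).im • e 1 (u t) := by
      rw [← hexp t ht' Z]
      exact (chartCoord_self x₀ (show TangentSpace (𝓡 2) x₀ from Z)).symm
    rw [h5, hZ, flatPairing_add_smul, h6.1, h6.2]
    simp
    ring

end FrameCoord

/-! ### The Levi-Civita connection of the product metric -/

section ProductParallel

variable {S₁ : Type*} [TopologicalSpace S₁] [ChartedSpace (EuclideanSpace ℝ (Fin 2)) S₁]
  [IsManifold (𝓡 2) ∞ S₁]
  {S₂ : Type*} [TopologicalSpace S₂] [ChartedSpace (EuclideanSpace ℝ (Fin 2)) S₂]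
  [IsManifold (𝓡 2) ∞ S₂]

local notation "E2" => EuclideanSpace ℝ (Fin 2)

/-- The chart of the product is the product of the charts, and so is its derivative. -/
theorem chartCoord_tangentProd (y₀ : S₁ × S₂) {y : S₁ × S₂}
    (hy : y ∈ (chartAt (ModelProd E2 E2) y₀).source)
    (a : TangentSpace (𝓡 2) y.1) (b : TangentSpace (𝓡 2) y.2) :
    chartCoord (IX := (𝓡 2).prod (𝓡 2)) y₀ (tangentProd y (a, b)) =
      (chartCoord y₀.1 a, chartCoord y₀.2 b) := by
  have hy' : y.1 ∈ (chartAt E2 y₀.1).source ∧ y.2 ∈ (chartAt E2 y₀.2).source := by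
    simpa [prodChartedSpace_chartAt] using hy
  have h1 := (mdifferentiableAt_extChartAt (I := 𝓡 2) hy'.1).hasMFDerivAt.comp y
    (hasMFDerivAt_fst (I := 𝓡 2) (I' := 𝓡 2) y)
  have h2 := (mdifferentiableAt_extChartAt (I := 𝓡 2) hy'.2).hasMFDerivAt.comp y
    (hasMFDerivAt_snd (I := 𝓡 2) (I' := 𝓡 2) y)
  have h3 : HasMFDerivAt ((𝓡 2).prod (𝓡 2)) 𝓘(ℝ, E2 × E2)
      (fun x => ((extChartAt (𝓡 2) y₀.1 ∘ Prod.fst) x, (extChartAt (𝓡 2) y₀.2 ∘ Prod.snd) x)) y _ :=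
    ⟨h1.1.prodMk h2.1, h1.2.prodMk h2.2⟩
  rw [chartCoord_eq_mfderiv y₀ hy, chartCoord_eq_mfderiv y₀.1 hy'.1, chartCoord_eq_mfderiv y₀.2 hy'.2]
  have h4 : ⇑(extChartAt ((𝓡 2).prod (𝓡 2)) y₀) =
      fun x => ((extChartAt (𝓡 2) y₀.1 ∘ Prod.fst) x, (extChartAt (𝓡 2) y₀.2 ∘ Prod.snd) x) := by
    rw [extChartAt_prod]; rfl
  rw [h4, h3.mfderiv]
  rfl

theorem trivializationAt_symm_prod (y₀ : S₁ × S₂) {y : S₁ × S₂}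
    (hy : y ∈ (chartAt (ModelProd E2 E2) y₀).source) (a : E2 × E2) :
    (trivializationAt (E2 × E2) (TangentSpace ((𝓡 2).prod (𝓡 2))) y₀).symm y a =
      tangentProd y ((trivializationAt E2 (TangentSpace (𝓡 2)) y₀.1).symm y.1 a.1,
        (trivializationAt E2 (TangentSpace (𝓡 2)) y₀.2).symm y.2 a.2) := by
  have hy' : y.1 ∈ (chartAt E2 y₀.1).source ∧ y.2 ∈ (chartAt E2 y₀.2).source := by
    simpa [prodChartedSpace_chartAt] using hy
  rw [← symm_chartCoord y₀ hy (tangentProd y _), chartCoord_tangentProd y₀ hy,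
    chartCoord_symm _ hy'.1, chartCoord_symm _ hy'.2]

variable (g₁ : SurfaceMetric S₁) (g₂ : SurfaceMetric S₂)

theorem chartForm_split (y₀ : S₁ × S₂) {u : E2 × E2}
    (h1 : u.1 ∈ (extChartAt (𝓡 2) y₀.1).target) (h2 : u.2 ∈ (extChartAt (𝓡 2) y₀.2).target)
    (a b : E2 × E2) : chartForm (splitForm g₁ g₂) y₀ u a b =
      chartForm (metricForm g₁) y₀.1 u.1 a.1 b.1 - chartForm (metricForm g₂) y₀.2 u.2 a.2 b.2 := by
  have hu : u ∈ (extChartAt ((𝓡 2).prod (𝓡 2)) y₀).target := by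
    rw [extChartAt_prod]; exact ⟨h1, h2⟩
  have hs := symm_mem_chart_source y₀ hu
  simp only [chartForm]
  rw [trivializationAt_symm_prod y₀ hs, trivializationAt_symm_prod y₀ hs, splitForm_tangentProd]
  have h3 : (extChartAt ((𝓡 2).prod (𝓡 2)) y₀).symm u =
      ((extChartAt (𝓡 2) y₀.1).symm u.1, (extChartAt (𝓡 2) y₀.2).symm u.2) := by
    rw [extChartAt_prod]; rfl
  rw [h3]

theorem differentiableAt_chartForm {S : Type*} [TopologicalSpace S] [ChartedSpace E2 S]
    [IsManifold (𝓡 2) ∞ S] (g : SurfaceMetric S) (x₀ : S) {u : E2}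
    (hu : u ∈ (extChartAt (𝓡 2) x₀).target) (a b : E2) :
    DifferentiableAt ℝ (fun y => chartForm (metricForm g) x₀ y a b) u := by
  have hn := (isOpen_extChartAt_target (I := 𝓡 2) x₀).mem_nhds hu
  have h : ContDiffOn ℝ ∞ (fun y => chartMetric g x₀ y a b) (extChartAt (𝓡 2) x₀).target :=
    ((contDiffOn_chartMetric g x₀).clm_apply contDiffOn_const).clm_apply contDiffOn_const
  refine ((h.contDiffAt hn).differentiableAt (by simp)).congr_of_eventuallyEq ?_
  filter_upwards [hn] with y hy using chartForm_eq_chartMetric g x₀ hy a b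

/-- Near `u` each metric coefficient is a function of the first point minus a function of the
second, so derivatives do not mix the factors. This is why the Christoffel symbols split. -/
theorem fderiv_chartForm_split (y₀ : S₁ × S₂) {u : E2 × E2}
    (h1 : u.1 ∈ (extChartAt (𝓡 2) y₀.1).target) (h2 : u.2 ∈ (extChartAt (𝓡 2) y₀.2).target)
    (a b w : E2 × E2) : fderiv ℝ (fun y => chartForm (splitForm g₁ g₂) y₀ y a b) u w =
      fderiv ℝ (fun y => chartForm (metricForm g₁) y₀.1 y a.1 b.1) u.1 w.1 -
        fderiv ℝ (fun y => chartForm (metricForm g₂) y₀.2 y a.2 b.2) u.2 w.2 := by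
  have e1 := (differentiableAt_chartForm g₁ y₀.1 h1 a.1 b.1).hasFDerivAt.comp u hasFDerivAt_fst
  have e2 := (differentiableAt_chartForm g₂ y₀.2 h2 a.2 b.2).hasFDerivAt.comp u hasFDerivAt_snd
  have h3 : (fun y => chartForm (splitForm g₁ g₂) y₀ y a b) =ᶠ[𝓝 u]
      fun y => chartForm (metricForm g₁) y₀.1 y.1 a.1 b.1 -
        chartForm (metricForm g₂) y₀.2 y.2 a.2 b.2 := by
    have h4 : (extChartAt (𝓡 2) y₀.1).target ×ˢ (extChartAt (𝓡 2) y₀.2).target ∈ 𝓝 u :=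
      ((isOpen_extChartAt_target (I := 𝓡 2) y₀.1).prod
        (isOpen_extChartAt_target (I := 𝓡 2) y₀.2)).mem_nhds ⟨h1, h2⟩
    filter_upwards [h4] with y hy using chartForm_split g₁ g₂ y₀ hy.1 hy.2 a b
  rw [((e1.sub e2).congr_of_eventuallyEq h3).fderiv]
  rfl

/-- Makes the test vectors `(Z, 0)` and `(0, Z)` isolate one factor. The terms with a derivative of
`chartForm` in a zero slot vanish because that function is zero near the base point. -/
theorem covDerivPairing_zero {S : Type*} [TopologicalSpace S] [ChartedSpace E2 S]
    [IsManifold (𝓡 2) ∞ S] (g : SurfaceMetric S) (c : ℝ → S) (V : ∀ t, TangentSpace (𝓡 2) (c t))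
    (t : ℝ) : covDerivPairing (metricForm g) c V t 0 = 0 := by
  have hz : ∀ (x₀ : S) (u p : E2), u ∈ (extChartAt (𝓡 2) x₀).target →
      chartForm (metricForm g) x₀ u p 0 = 0 := by
    intro x₀ u p hu
    rw [chartForm_eq_chartMetric g x₀ hu, map_zero]
  have hz' : ∀ p w : E2, fderiv ℝ (fun y => chartForm (metricForm g) (c t) y p 0)
      (extChartAt (𝓡 2) (c t) (c t)) w = 0 := by
    intro p w
    have h : (fun y => chartForm (metricForm g) (c t) y p 0) =ᶠ[𝓝 (extChartAt (𝓡 2) (c t) (c t))]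
        fun _ => (0 : ℝ) := by
      filter_upwards [extChartAt_target_mem_nhds (I := 𝓡 2) (c t)] with y hy using hz _ _ _ hy
    rw [h.fderiv_eq]
    simp
  simp only [covDerivPairing]
  rw [hz', hz', hz _ _ _ (mem_extChartAt_target _)]
  simp

/-- A vector field is parallel in the product `(S₁ × S₂, g₁ ⊕ (-g₂))` if and only if both of its
components are parallel. -/
theorem isParallelAt_split_iff {γ : ℝ → S₁ × S₂} {a : ∀ t, TangentSpace (𝓡 2) (γ t).1}
    {b : ∀ t, TangentSpace (𝓡 2) (γ t).2} {t : ℝ} :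
    (MDifferentiableAt 𝓘(ℝ, ℝ) ((𝓡 2).prod (𝓡 2)).tangent (fun s =>
      (⟨γ s, tangentProd (γ s) (a s, b s)⟩ : TangentBundle ((𝓡 2).prod (𝓡 2)) (S₁ × S₂))) t ∧
      ∀ Z : E2 × E2, covDerivPairing (splitForm g₁ g₂) γ (fun s => tangentProd (γ s) (a s, b s)) t Z = 0) ↔
    (MDifferentiableAt 𝓘(ℝ, ℝ) (𝓡 2).tangent
        (fun s => (⟨(γ s).1, a s⟩ : TangentBundle (𝓡 2) S₁)) t ∧
      ∀ Z : E2, covDerivPairing (metricForm g₁) (fun s => (γ s).1) a t Z = 0) ∧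
    (MDifferentiableAt 𝓘(ℝ, ℝ) (𝓡 2).tangent
        (fun s => (⟨(γ s).2, b s⟩ : TangentBundle (𝓡 2) S₂)) t ∧
      ∀ Z : E2, covDerivPairing (metricForm g₂) (fun s => (γ s).2) b t Z = 0) := by
  rw [mdifferentiableAt_tangent_iff, mdifferentiableAt_tangent_iff, mdifferentiableAt_tangent_iff]
  have hγ : MDifferentiableAt 𝓘(ℝ, ℝ) ((𝓡 2).prod (𝓡 2)) γ t ↔
      MDifferentiableAt 𝓘(ℝ, ℝ) (𝓡 2) (fun s => (γ s).1) t ∧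
      MDifferentiableAt 𝓘(ℝ, ℝ) (𝓡 2) (fun s => (γ s).2) t :=
    ⟨fun h => ⟨h.fst, h.snd⟩, fun h => h.1.prodMk h.2⟩
  rw [hγ]
  -- If one of the component curves is not differentiable, both sides are false; `hd'` plays the
  -- same role for the component fields.
  by_cases hd : MDifferentiableAt 𝓘(ℝ, ℝ) (𝓡 2) (fun s => (γ s).1) t ∧
      MDifferentiableAt 𝓘(ℝ, ℝ) (𝓡 2) (fun s => (γ s).2) t
  swap
  · tauto
  have hc : (fun s => chartCoord (IX := (𝓡 2).prod (𝓡 2)) (γ t) (tangentProd (γ s) (a s, b s))) =ᶠ[𝓝 t]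
      fun s => (chartCoord (γ t).1 (a s), chartCoord (γ t).2 (b s)) := by
    have hcont : ContinuousAt γ t := (hγ.2 hd).continuousAt
    filter_upwards [hcont.preimage_mem_nhds ((chartAt (ModelProd E2 E2) (γ t)).open_source.mem_nhds
      (mem_chart_source (ModelProd E2 E2) (γ t)))] with s hs
    exact chartCoord_tangentProd (γ t) hs _ _
  have hV : DifferentiableAt ℝ
        (fun s => chartCoord (IX := (𝓡 2).prod (𝓡 2)) (γ t) (tangentProd (γ s) (a s, b s))) t ↔
      DifferentiableAt ℝ (fun s => chartCoord (γ t).1 (a s)) t ∧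
        DifferentiableAt ℝ (fun s => chartCoord (γ t).2 (b s)) t := by
    rw [hc.differentiableAt_iff]
    exact ⟨fun h => ⟨h.fst, h.snd⟩, fun h => h.1.prodMk h.2⟩
  rw [hV]
  by_cases hd' : DifferentiableAt ℝ (fun s => chartCoord (γ t).1 (a s)) t ∧
        DifferentiableAt ℝ (fun s => chartCoord (γ t).2 (b s)) t
  swap
  · tauto
  have h1 := mem_extChartAt_target (I := 𝓡 2) (γ t).1
  have h2 := mem_extChartAt_target (I := 𝓡 2) (γ t).2
  have hu : (extChartAt ((𝓡 2).prod (𝓡 2)) (γ t)) =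
      (extChartAt (𝓡 2) (γ t).1).prod (extChartAt (𝓡 2) (γ t).2) := extChartAt_prod _
  have hdu : deriv (fun s => extChartAt ((𝓡 2).prod (𝓡 2)) (γ t) (γ s)) t =
      (deriv (fun s => extChartAt (𝓡 2) (γ t).1 (γ s).1) t,
        deriv (fun s => extChartAt (𝓡 2) (γ t).2 (γ s).2) t) := by
    rw [hu]
    have e1 := (hasDerivAt_extChartAt_comp (γ t).1 (mem_chart_source E2 _) hd.1).differentiableAt
    have e2 := (hasDerivAt_extChartAt_comp (γ t).2 (mem_chart_source E2 _) hd.2).differentiableAt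
    exact (e1.hasDerivAt.prodMk e2.hasDerivAt).deriv
  have hdv : deriv (fun s => chartCoord (IX := (𝓡 2).prod (𝓡 2)) (γ t) (tangentProd (γ s) (a s, b s))) t =
      (deriv (fun s => chartCoord (γ t).1 (a s)) t, deriv (fun s => chartCoord (γ t).2 (b s)) t) := by
    rw [hc.deriv_eq]
    exact (hd'.1.hasDerivAt.prodMk hd'.2.hasDerivAt).deriv
  have hu0 : extChartAt ((𝓡 2).prod (𝓡 2)) (γ t) (γ t) =
      (extChartAt (𝓡 2) (γ t).1 (γ t).1, extChartAt (𝓡 2) (γ t).2 (γ t).2) := by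
    rw [hu]; rfl
  have hvt : chartCoord (IX := (𝓡 2).prod (𝓡 2)) (γ t) (tangentProd (γ t) (a t, b t)) =
      (chartCoord (γ t).1 (a t), chartCoord (γ t).2 (b t)) := hc.self_of_nhds
  -- The product pairing is the difference of the two pairings, with independent test vectors `Z.1`
  -- and `Z.2`. So it vanishes identically only if each does, and the minus sign is harmless.
  have key : ∀ Z : E2 × E2,
      covDerivPairing (splitForm g₁ g₂) γ (fun s => tangentProd (γ s) (a s, b s)) t Z =
      covDerivPairing (metricForm g₁) (fun s => (γ s).1) a t Z.1 -
        covDerivPairing (metricForm g₂) (fun s => (γ s).2) b t Z.2 := by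
    intro Z
    simp only [covDerivPairing]
    rw [hdu, hdv, hvt, hu0]
    rw [fderiv_chartForm_split g₁ g₂ (γ t) h1 h2, fderiv_chartForm_split g₁ g₂ (γ t) h1 h2,
      fderiv_chartForm_split g₁ g₂ (γ t) h1 h2, chartForm_split g₁ g₂ (γ t) h1 h2]
    ring
  constructor
  · rintro ⟨-, h⟩
    refine ⟨⟨⟨hd.1, hd'.1⟩, fun Z => ?_⟩, ⟨⟨hd.2, hd'.2⟩, fun Z => ?_⟩⟩
    · have := h (Z, 0)
      rwa [key, covDerivPairing_zero g₂, sub_zero] at this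
    · have := h (0, Z)
      rwa [key, covDerivPairing_zero g₁, zero_sub, neg_eq_zero] at this
  · rintro ⟨⟨-, h⟩, -, h'⟩
    refine ⟨⟨hd, hd'⟩, fun Z => ?_⟩
    rw [key, h, h', sub_zero]

end ProductParallel

/-! ### Smoothness of trivializations and of maps between circle bundles -/

namespace CircleAtlas

variable {EB : Type*} [NormedAddCommGroup EB] [NormedSpace ℝ EB]
    {HB : Type*} [TopologicalSpace HB] {IB : ModelWithCorners ℝ EB HB}
    {B : Type*} [TopologicalSpace B] [ChartedSpace HB B] {E : B → Type*}

/-- The total space of a circle bundle, as a manifold. -/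
def Total (_ : CircleAtlas IB E) : Type _ := BundlePoint E

instance (c : CircleAtlas IB E) : TopologicalSpace c.Total := c.topology

instance (c : CircleAtlas IB E) :
    ChartedSpace (ModelProd HB (EuclideanSpace ℝ (Fin 1))) c.Total := c.chartedSpace

/-- A local trivialization as a partial homeomorphism. -/
def trivHomeo (c : CircleAtlas IB E) (i : c.ι) : OpenPartialHomeomorph c.Total (B × Circle) :=
  c.core.openPartialHomeomorph (c.triv i) (mem_range_self i)

theorem trivHomeo_apply (c : CircleAtlas IB E) (i : c.ι) {p : c.Total}
    (hp : BundlePoint.base p ∈ c.dom i) : c.trivHomeo i p =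
      (BundlePoint.base p, c.angle i _ hp (BundlePoint.fiber p)) := by
  refine Prod.ext rfl ?_
  exact dif_pos hp

theorem contMDiffOn_triv_comp (c : CircleAtlas IB E) (i j : c.ι) :
    ContMDiffOn (IB.prod (𝓡 1)) (IB.prod (𝓡 1)) ∞ (c.trivHomeo j ∘ (c.trivHomeo i).symm)
      ((c.dom i ∩ c.dom j) ×ˢ univ) := c.triv_trans_contMDiffOn i j

/-- The index of the trivialization used in the chart at `p`. -/
def idx (c : CircleAtlas IB E) (p : c.Total) : c.ι := (c.exists_mem (BundlePoint.base p)).choose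

theorem mem_idx (c : CircleAtlas IB E) (p : c.Total) : BundlePoint.base p ∈ c.dom (c.idx p) :=
  (c.exists_mem (BundlePoint.base p)).choose_spec

/-- The chart of the total space at `p` is the trivialization `idx p` followed by a chart of `B ×
Circle`. Read in it, the trivialization `i` is a change of trivializations, smooth by assumption on
the atlas. -/
theorem contMDiffOn_trivHomeo (c : CircleAtlas IB E) (i : c.ι) :
    ContMDiffOn (IB.prod (𝓡 1)) (IB.prod (𝓡 1)) ∞ (c.trivHomeo i) (c.trivHomeo i).source := by
  intro p hp
  apply ContMDiffAt.contMDiffWithinAt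
  have hopen : IsOpen ((c.dom (c.idx p) ∩ c.dom i) ×ˢ (univ : Set Circle)) :=
    ((c.isOpen_dom _).inter (c.isOpen_dom _)).prod isOpen_univ
  have h := (c.contMDiffOn_triv_comp (c.idx p) i).contMDiffAt
    (hopen.mem_nhds (x := c.trivHomeo (c.idx p) p) ⟨⟨c.mem_idx p, hp⟩, mem_univ _⟩)
  rw [contMDiffAt_iff] at h ⊢
  refine ⟨(c.trivHomeo i).continuousAt hp, ?_⟩
  have h2 := h.2
  -- Only the centre of the target chart has to be rewritten; after that the two coordinate
  -- expressions coincide by definition.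
  have h3 : (c.trivHomeo i ∘ (c.trivHomeo (c.idx p)).symm) (c.trivHomeo (c.idx p) p) =
      c.trivHomeo i p := congrArg (c.trivHomeo i) ((c.trivHomeo (c.idx p)).left_inv (c.mem_idx p))
  rw [h3] at h2
  exact h2

theorem contMDiffOn_trivHomeo_symm (c : CircleAtlas IB E) (i : c.ι) :
    ContMDiffOn (IB.prod (𝓡 1)) (IB.prod (𝓡 1)) ∞ (c.trivHomeo i).symm (c.trivHomeo i).target := by
  intro q hq
  apply ContMDiffAt.contMDiffWithinAt
  set p := (c.trivHomeo i).symm q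
  have hopen : IsOpen ((c.dom i ∩ c.dom (c.idx p)) ×ˢ (univ : Set Circle)) :=
    ((c.isOpen_dom _).inter (c.isOpen_dom _)).prod isOpen_univ
  have h := (c.contMDiffOn_triv_comp i (c.idx p)).contMDiffAt
    (hopen.mem_nhds (x := q) ⟨⟨hq.1, c.mem_idx p⟩, mem_univ _⟩)
  rw [contMDiffAt_iff] at h ⊢
  exact ⟨(c.trivHomeo i).symm.continuousAt hq, h.2⟩

theorem contMDiff_base (c : CircleAtlas IB E) :
    ContMDiff (IB.prod (𝓡 1)) IB ∞ (fun p : c.Total => BundlePoint.base p) := by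
  intro p
  have h := (c.contMDiffOn_trivHomeo (c.idx p)).contMDiffAt
    ((c.trivHomeo (c.idx p)).open_source.mem_nhds (c.mem_idx p))
  exact contMDiffAt_fst.comp p h

variable {E' : B → Type*}

/-- The map of total spaces given by maps of the fibres. -/
def fiberMap (c : CircleAtlas IB E) (c' : CircleAtlas IB E') (e : ∀ y, E y → E' y) (p : c.Total) :
    c'.Total :=
  BundlePoint.mk (BundlePoint.base p) (e _ (BundlePoint.fiber p))

/-- Maps of fibres circle bundles that preserve angles in suitable trivializations
around every point form a smooth map. -/
theorem contMDiff_fiberMap (c : CircleAtlas IB E) (c' : CircleAtlas IB E') (e : ∀ y, E y → E' y)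
    (h : ∀ y, ∃ i j, y ∈ c.dom i ∧ c.dom i ⊆ c'.dom j ∧
      ∀ x (hi : x ∈ c.dom i) (hj : x ∈ c'.dom j) a, c'.angle j x hj (e x a) = c.angle i x hi a) :
    ContMDiff (IB.prod (𝓡 1)) (IB.prod (𝓡 1)) ∞ (c.fiberMap c' e) := by
  intro p
  obtain ⟨i, j, hy, hij, hang⟩ := h (BundlePoint.base p)
  have h1 := (c.contMDiffOn_trivHomeo i).contMDiffAt ((c.trivHomeo i).open_source.mem_nhds hy)
  have h2 := (c'.contMDiffOn_trivHomeo_symm j).contMDiffAt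
    ((c'.trivHomeo j).open_target.mem_nhds (x := c.trivHomeo i p) ⟨hij hy, mem_univ _⟩)
  -- Since angles are preserved, near `p` the map is the trivialization `i` followed by the inverse
  -- of the trivialization `j`.
  refine (h2.comp p h1).congr_of_eventuallyEq ?_
  filter_upwards [(c.trivHomeo i).open_source.mem_nhds hy] with x hx
  have hx' : BundlePoint.base x ∈ c.dom i := hx
  rw [Function.comp, (c'.trivHomeo j).eq_symm_apply _ _]
  · rw [c'.trivHomeo_apply j (p := c.fiberMap c' e x) (hij hx'), c.trivHomeo_apply i hx']
    exact Prod.ext rfl (hang _ hx' (hij hx') _)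
  · exact hij hx'
  · exact ⟨hij hx', mem_univ _⟩

end CircleAtlas

/-! ### Graphs of rotations as selfdual null planes, and the diffeomorphism -/

section ProductFrame

variable {V W : Type*} [AddCommGroup V] [Module ℝ V] [AddCommGroup W] [Module ℝ W]

theorem complexCoord_prodBasis_fst (b : Basis (Fin 2) ℝ V) (b' : Basis (Fin 2) ℝ W) (u : V) (v : W) :
    complexCoord (prodBasis b b') 0 1 (u, v) = complexCoord b 0 1 u := by
  have h0 : (finSumFinEquiv (m := 2) (n := 2)).symm 0 = Sum.inl 0 := rfl
  have h1 : (finSumFinEquiv (m := 2) (n := 2)).symm 1 = Sum.inl 1 := rfl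
  simp [complexCoord, prodBasis, h0, h1]

theorem complexCoord_prodBasis_snd (b : Basis (Fin 2) ℝ V) (b' : Basis (Fin 2) ℝ W) (u : V) (v : W) :
    complexCoord (prodBasis b b') 2 3 (u, v) = complexCoord b' 0 1 v := by
  have h0 : (finSumFinEquiv (m := 2) (n := 2)).symm 2 = Sum.inr 0 := rfl
  have h1 : (finSumFinEquiv (m := 2) (n := 2)).symm 3 = Sum.inr 1 := rfl
  simp [complexCoord, prodBasis, h0, h1]

end ProductFrame

section Graph

variable {S₁ : Type*} [TopologicalSpace S₁] [ChartedSpace (EuclideanSpace ℝ (Fin 2)) S₁]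
  [IsManifold (𝓡 2) ∞ S₁]
  {S₂ : Type*} [TopologicalSpace S₂] [ChartedSpace (EuclideanSpace ℝ (Fin 2)) S₂]
  [IsManifold (𝓡 2) ∞ S₂]
  {g₁ : SurfaceMetric S₁} {o₁ : SurfaceOrientation S₁}
  {g₂ : SurfaceMetric S₂} {o₂ : SurfaceOrientation S₂}

/-- The basis of `T_y (S₁ × S₂)` made of the values at `y` of two frames. -/
def splitBasis (f : SurfaceFrame g₁ o₁) (f' : SurfaceFrame g₂ o₂) (y : S₁ × S₂)
    (hy : y ∈ f.dom ×ˢ f'.dom) : Basis (Fin 4) ℝ (TangentSpace ((𝓡 2).prod (𝓡 2)) y) :=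
  (prodBasis (f.isFrame.toBasisAt hy.1) (f'.isFrame.toBasisAt hy.2)).map (tangentProd y)

/-- The vector fields `e₁, e₂, e₃, e₄` on `S₁ × S₂` given by frames `(e₁, e₂)` and `(e₃, e₄)`. -/
def splitVec (f : SurfaceFrame g₁ o₁) (f' : SurfaceFrame g₂ o₂) (i : Fin 4) (y : S₁ × S₂) :
    TangentSpace ((𝓡 2).prod (𝓡 2)) y :=
  tangentProd y (![(f.vec 0 y.1, 0), (f.vec 1 y.1, 0), (0, f'.vec 0 y.2), (0, f'.vec 1 y.2)] i)

theorem splitBasis_apply (f : SurfaceFrame g₁ o₁) (f' : SurfaceFrame g₂ o₂) {y : S₁ × S₂}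
    (hy : y ∈ f.dom ×ˢ f'.dom) (i : Fin 4) : splitBasis f f' y hy i = splitVec f f' i y := by
  simp only [splitBasis, splitVec, Basis.map_apply]
  congr 1
  fin_cases i
  · exact (prodBasis_zero _ _).trans (by simp)
  · exact (prodBasis_one _ _).trans (by simp)
  · exact (prodBasis_two _ _).trans (by simp)
  · exact (prodBasis_three _ _).trans (by simp)

theorem isLocalFrameOn_splitVec (f : SurfaceFrame g₁ o₁) (f' : SurfaceFrame g₂ o₂) :
    IsLocalFrameOn ((𝓡 2).prod (𝓡 2)) (EuclideanSpace ℝ (Fin 2) × EuclideanSpace ℝ (Fin 2)) ∞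
      (splitVec f f') (f.dom ×ˢ f'.dom) := by
  have hbas : ∀ y (hy : y ∈ f.dom ×ˢ f'.dom),
      (fun i => splitVec f f' i y) = splitBasis f f' y hy := fun y hy =>
    funext fun i => (splitBasis_apply f f' hy i).symm
  have hz₁ : ContMDiffOn (𝓡 2) (𝓡 2).tangent ∞
      (fun x => (⟨x, 0⟩ : TangentBundle (𝓡 2) S₁)) f.dom :=
    (Bundle.contMDiff_zeroSection ℝ _).contMDiffOn
  have hz₂ : ContMDiffOn (𝓡 2) (𝓡 2).tangent ∞
      (fun x => (⟨x, 0⟩ : TangentBundle (𝓡 2) S₂)) f'.dom :=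
    (Bundle.contMDiff_zeroSection ℝ _).contMDiffOn
  refine ⟨fun {y} hy => ?_, fun {y} hy => ?_, fun i => ?_⟩
  · rw [hbas y hy]
    exact (splitBasis f f' y hy).linearIndependent
  · rw [hbas y hy, (splitBasis f f' y hy).span_eq]
  · fin_cases i
    · exact contMDiffOn_tangentProd (f.isFrame.contMDiffOn 0) hz₂
    · exact contMDiffOn_tangentProd (f.isFrame.contMDiffOn 1) hz₂
    · exact contMDiffOn_tangentProd hz₁ (f'.isFrame.contMDiffOn 0)
    · exact contMDiffOn_tangentProd hz₁ (f'.isFrame.contMDiffOn 1)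

theorem toBasisAt_splitVec (f : SurfaceFrame g₁ o₁) (f' : SurfaceFrame g₂ o₂) {y : S₁ × S₂}
    (hy : y ∈ f.dom ×ˢ f'.dom) :
    (isLocalFrameOn_splitVec f f').toBasisAt hy = splitBasis f f' y hy :=
  Basis.eq_of_apply_eq fun i =>
    ((isLocalFrameOn_splitVec f f').toBasisAt_coe hy i).trans (splitBasis_apply f f' hy i).symm

/-- The oriented orthonormal frame of `S₁ × S₂` given by frames of the two surfaces. -/
def splitFrame (f : SurfaceFrame g₁ o₁) (f' : SurfaceFrame g₂ o₂) :
    OrthoFrame ((𝓡 2).prod (𝓡 2)) splitSig (splitProduct g₁ o₁ g₂ o₂).form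
      (splitProduct g₁ o₁ g₂ o₂).orient where
  dom := f.dom ×ˢ f'.dom
  isOpen_dom := f.isOpen_dom.prod f'.isOpen_dom
  vec := splitVec f f'
  isFrame := isLocalFrameOn_splitVec f f'
  ortho y hy i j := by
    have h₁ := f.ortho y.1 hy.1
    have h₂ := f'.ortho y.2 hy.2
    simp only [IsOrthoBasis, IsLocalFrameOn.toBasisAt_coe] at h₁ h₂
    rw [IsLocalFrameOn.toBasisAt_coe, IsLocalFrameOn.toBasisAt_coe]
    simp only [splitVec]
    fin_cases i <;> fin_cases j <;>
      (refine (splitForm_tangentProd g₁ g₂ y _ _ _ _).trans ?_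
       simp [h₁, h₂, riemSig, splitSig])
  oriented y hy := by
    rw [toBasisAt_splitVec f f' hy]
    simp only [splitBasis, splitProduct, splitOrient]
    rw [Basis.orientation_map, prodBasis_orientation (finrank_tangentSpace y.1)
      (finrank_tangentSpace y.2), f.oriented, f'.oriented]

/-- The graph of a linear map `T_x S₁ → T_{x'} S₂`, as a plane in `T_{(x, x')} (S₁ × S₂)`. -/
def graphPlane (y : S₁ × S₂) (A : TangentSpace (𝓡 2) y.1 ≃ₗ[ℝ] TangentSpace (𝓡 2) y.2) :
    Submodule ℝ (TangentSpace ((𝓡 2).prod (𝓡 2)) y) :=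
  LinearMap.eqLocus
    (A.toLinearMap ∘ₗ (mfderiv ((𝓡 2).prod (𝓡 2)) (𝓡 2) (Prod.fst : S₁ × S₂ → S₁) y).toLinearMap)
    (mfderiv ((𝓡 2).prod (𝓡 2)) (𝓡 2) (Prod.snd : S₁ × S₂ → S₂) y).toLinearMap

theorem mem_graphPlane (y : S₁ × S₂)
    (A : TangentSpace (𝓡 2) y.1 ≃ₗ[ℝ] TangentSpace (𝓡 2) y.2)
    (w : TangentSpace ((𝓡 2).prod (𝓡 2)) y) : w ∈ graphPlane y A ↔
      A (mfderiv ((𝓡 2).prod (𝓡 2)) (𝓡 2) (Prod.fst : S₁ × S₂ → S₁) y w) =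
        mfderiv ((𝓡 2).prod (𝓡 2)) (𝓡 2) (Prod.snd : S₁ × S₂ → S₂) y w := Iff.rfl

theorem tangentProd_mem_graphPlane (y : S₁ × S₂)
    (A : TangentSpace (𝓡 2) y.1 ≃ₗ[ℝ] TangentSpace (𝓡 2) y.2)
    (u : TangentSpace (𝓡 2) y.1) (v : TangentSpace (𝓡 2) y.2) :
    tangentProd y (u, v) ∈ graphPlane y A ↔ A u = v := by
  rw [mem_graphPlane, mfderiv_fst_tangentProd, mfderiv_snd_tangentProd]

/-- Let `ζ₁`, `ζ₂` be the complex coordinates of the two components of a vector. A rotation is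
multiplication by `c`, so the graph has the equation `ζ₂ = c ζ₁`; this is also the equation of
`circlePlane` in the product basis. -/
theorem graphPlane_rotationMap (f : SurfaceFrame g₁ o₁) (f' : SurfaceFrame g₂ o₂) {y : S₁ × S₂}
    (hy : y ∈ f.dom ×ˢ f'.dom) (c : Circle) :
    graphPlane y (rotationMap (f.isFrame.toBasisAt hy.1) (f'.isFrame.toBasisAt hy.2) c) =
      circlePlane ((splitFrame f f').isFrame.toBasisAt hy) c := by
  ext w
  obtain ⟨⟨u, v⟩, rfl⟩ := (tangentProd y).surjective w
  rw [tangentProd_mem_graphPlane, mem_circlePlane]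
  have h1 : (splitFrame f f').isFrame.toBasisAt hy = splitBasis f f' y hy := toBasisAt_splitVec f f' hy
  have h2 : ∀ i j, complexCoord (splitBasis f f' y hy) i j (tangentProd y (u, v)) =
      complexCoord (prodBasis (f.isFrame.toBasisAt hy.1) (f'.isFrame.toBasisAt hy.2)) i j (u, v) := by
    intro i j
    simp [complexCoord, splitBasis]
  rw [h1, h2, h2, complexCoord_prodBasis_fst, complexCoord_prodBasis_snd,
    ← (eq_rotationMap_iff (f.isFrame.toBasisAt hy.1) (f'.isFrame.toBasisAt hy.2) c _).1 rfl u,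
    ← basisToComplex_apply, ← basisToComplex_apply, (basisToComplex _).injective.eq_iff, eq_comm]

theorem exists_splitFrame_pair (g₁ : SurfaceMetric S₁) (o₁ : SurfaceOrientation S₁)
    (g₂ : SurfaceMetric S₂) (o₂ : SurfaceOrientation S₂) (y : S₁ × S₂) :
    ∃ (f : SurfaceFrame g₁ o₁) (f' : SurfaceFrame g₂ o₂), y ∈ f.dom ×ˢ f'.dom := by
  obtain ⟨f, hf⟩ := exists_surfaceFrame g₁ o₁ y.1
  obtain ⟨f', hf'⟩ := exists_surfaceFrame g₂ o₂ y.2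
  exact ⟨f, f', hf, hf'⟩

/-- The graph of a rotation is a selfdual totally null plane. -/
theorem isSelfdualNullPlane_graphPlane (y : S₁ × S₂) (A : RollingFiber g₁ o₁ g₂ o₂ y) :
    IsSelfdualNullPlane ((splitProduct g₁ o₁ g₂ o₂).form y) ((splitProduct g₁ o₁ g₂ o₂).orient y)
      (graphPlane y A.1) := by
  obtain ⟨f, f', hy⟩ := exists_splitFrame_pair g₁ o₁ g₂ o₂ y
  obtain ⟨c, hc⟩ := exists_eq_rotationMap (f.ortho _ hy.1) (f.oriented _ hy.1)
    (f'.ortho _ hy.2) (f'.oriented _ hy.2) A.1 A.2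
  rw [← hc, graphPlane_rotationMap f f' hy]
  exact isSelfdualNullPlane_circlePlane ((splitFrame f f').ortho y hy) ((splitFrame f f').oriented y hy) c

/-- The selfdual totally null plane of a configuration. -/
def graphFiber (y : S₁ × S₂) (A : RollingFiber g₁ o₁ g₂ o₂ y) :
    TwistorFiber (splitProduct g₁ o₁ g₂ o₂) y :=
  ⟨graphPlane y A.1, isSelfdualNullPlane_graphPlane y A⟩

/-- The graph map is thus the identity in matching trivializations, from which bijectivity on fibres
and smoothness in both directions follow. -/
theorem angle_graphFiber (f : SurfaceFrame g₁ o₁) (f' : SurfaceFrame g₂ o₂) {y : S₁ × S₂}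
    (hy : y ∈ f.dom ×ˢ f'.dom) (A : RollingFiber g₁ o₁ g₂ o₂ y) :
    (twistorAtlas (splitProduct g₁ o₁ g₂ o₂)).angle (splitFrame f f') y hy (graphFiber y A) =
      (rollingAtlas g₁ o₁ g₂ o₂).angle (f, f') y hy A := by
  obtain ⟨c, rfl⟩ := ((rollingAtlas g₁ o₁ g₂ o₂).angle (f, f') y hy).symm.surjective A
  rw [Equiv.apply_symm_apply]
  refine (Equiv.symm_apply_eq _).2 (Subtype.ext ?_)
  exact graphPlane_rotationMap f f' hy c

theorem graphFiber_bijective (y : S₁ × S₂) :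
    Bijective (graphFiber (g₁ := g₁) (o₁ := o₁) (g₂ := g₂) (o₂ := o₂) y) := by
  obtain ⟨f, f', hy⟩ := exists_splitFrame_pair g₁ o₁ g₂ o₂ y
  have h : graphFiber (g₁ := g₁) (o₁ := o₁) (g₂ := g₂) (o₂ := o₂) y =
      ((twistorAtlas (splitProduct g₁ o₁ g₂ o₂)).angle (splitFrame f f') y hy).symm ∘
        ((rollingAtlas g₁ o₁ g₂ o₂).angle (f, f') y hy) := by
    ext1 A
    rw [Function.comp, ← angle_graphFiber f f' hy, Equiv.symm_apply_apply]
  rw [h]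
  exact (Equiv.bijective _).comp (Equiv.bijective _)

variable (g₁ o₁ g₂ o₂) in
/-- The graph of a rotation, as a bijection onto the selfdual totally null planes. -/
def graphEquiv (y : S₁ × S₂) :
    RollingFiber g₁ o₁ g₂ o₂ y ≃ TwistorFiber (splitProduct g₁ o₁ g₂ o₂) y :=
  Equiv.ofBijective (graphFiber y) (graphFiber_bijective y)

variable (g₁ o₁ g₂ o₂) in
/-- The diffeomorphism `(x, x', A) ↦ ((x, x'), graph A)` of the configuration space onto the twistor
bundle. -/
def graphDiffeo : Diffeomorph (((𝓡 2).prod (𝓡 2)).prod (𝓡 1)) (((𝓡 2).prod (𝓡 2)).prod (𝓡 1))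
    (RollingSpace g₁ o₁ g₂ o₂) (TwistorBundle (splitProduct g₁ o₁ g₂ o₂)) ∞ where
  toFun p := BundlePoint.mk p.base (graphEquiv g₁ o₁ g₂ o₂ p.base p.fiber)
  invFun p := BundlePoint.mk p.base ((graphEquiv g₁ o₁ g₂ o₂ p.base).symm p.fiber)
  left_inv p := BundlePoint.ext rfl (heq_of_eq (Equiv.symm_apply_apply _ _))
  right_inv p := BundlePoint.ext rfl (heq_of_eq (Equiv.apply_symm_apply _ _))
  contMDiff_toFun := by
    refine (rollingAtlas g₁ o₁ g₂ o₂).contMDiff_fiberMap (twistorAtlas (splitProduct g₁ o₁ g₂ o₂))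
      (fun y => graphEquiv g₁ o₁ g₂ o₂ y) fun y => ?_
    obtain ⟨f, f', hy⟩ := exists_splitFrame_pair g₁ o₁ g₂ o₂ y
    exact ⟨(f, f'), splitFrame f f', hy, Subset.rfl, fun x hi hj a => angle_graphFiber f f' hi a⟩
  contMDiff_invFun := by
    refine (twistorAtlas (splitProduct g₁ o₁ g₂ o₂)).contMDiff_fiberMap (rollingAtlas g₁ o₁ g₂ o₂)
      (fun y => (graphEquiv g₁ o₁ g₂ o₂ y).symm) fun y => ?_
    obtain ⟨f, f', hy⟩ := exists_splitFrame_pair g₁ o₁ g₂ o₂ y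
    refine ⟨splitFrame f f', (f, f'), hy, Subset.rfl, fun x hi hj a => ?_⟩
    obtain ⟨A, rfl⟩ := (graphEquiv g₁ o₁ g₂ o₂ x).surjective a
    rw [Equiv.symm_apply_apply]
    exact (angle_graphFiber f f' hj A).symm

end Graph

/-! ### Local coordinates with a real angle, and velocities in them -/

section RollingParam

variable {S₁ : Type*} [TopologicalSpace S₁] [ChartedSpace (EuclideanSpace ℝ (Fin 2)) S₁]
  [IsManifold (𝓡 2) ∞ S₁]
  {S₂ : Type*} [TopologicalSpace S₂] [ChartedSpace (EuclideanSpace ℝ (Fin 2)) S₂]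
  [IsManifold (𝓡 2) ∞ S₂]
  {g₁ : SurfaceMetric S₁} {o₁ : SurfaceOrientation S₁}
  {g₂ : SurfaceMetric S₂} {o₂ : SurfaceOrientation S₂}

local notation "E2" => EuclideanSpace ℝ (Fin 2)

theorem frameCoord_eq_complexCoord (f : SurfaceFrame g₁ o₁) {x : S₁} (hx : x ∈ f.dom)
    (v : TangentSpace (𝓡 2) x) :
    frameCoord f x v = complexCoord (f.isFrame.toBasisAt hx) 0 1 v := by
  simp [frameCoord, complexCoord, IsLocalFrameOn.coeff, hx]

/-- The local trivialization of the configuration space given by a pair of frames. -/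
def rollingTriv (f : SurfaceFrame g₁ o₁) (f' : SurfaceFrame g₂ o₂) :
    OpenPartialHomeomorph (RollingSpace g₁ o₁ g₂ o₂) ((S₁ × S₂) × Circle) :=
  (rollingAtlas g₁ o₁ g₂ o₂).trivHomeo (f, f')

/-- In frame coordinates the configuration acts as multiplication by its angle, so the angle is a
quotient of coordinates of corresponding vectors. Derivatives of the angle are computed from this.
-/
theorem frameCoord_fiber (f : SurfaceFrame g₁ o₁) (f' : SurfaceFrame g₂ o₂)
    {p : RollingSpace g₁ o₁ g₂ o₂} (hp : p.base ∈ f.dom ×ˢ f'.dom)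
    (u : TangentSpace (𝓡 2) p.base.1) :
    frameCoord f' p.base.2 (p.fiber.1 u) = (rollingTriv f f' p).2 * frameCoord f p.base.1 u := by
  have h1 : rollingTriv f f' p = (p.base, (rollingAtlas g₁ o₁ g₂ o₂).angle (f, f') p.base hp p.fiber) :=
    (rollingAtlas g₁ o₁ g₂ o₂).trivHomeo_apply (f, f') hp
  rw [h1]
  simp only
  obtain ⟨c, hc⟩ := ((rollingAtlas g₁ o₁ g₂ o₂).angle (f, f') p.base hp).symm.surjective p.fiber
  rw [← hc, Equiv.apply_symm_apply, frameCoord_eq_complexCoord f hp.1,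
    frameCoord_eq_complexCoord f' hp.2]
  exact (eq_rotationMap_iff (f.isFrame.toBasisAt hp.1) (f'.isFrame.toBasisAt hp.2) c _).1 rfl u

/-- The configuration over `(x, x')` that rotates the first frame to the second by the angle `θ`. -/
def rollingParam (f : SurfaceFrame g₁ o₁) (f' : SurfaceFrame g₂ o₂) (q : (S₁ × S₂) × ℝ) :
    RollingSpace g₁ o₁ g₂ o₂ := (rollingTriv f f').symm (q.1, Circle.exp q.2)

theorem rollingTriv_rollingParam (f : SurfaceFrame g₁ o₁) (f' : SurfaceFrame g₂ o₂)
    {q : (S₁ × S₂) × ℝ} (hq : q.1 ∈ f.dom ×ˢ f'.dom) :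
    rollingTriv f f' (rollingParam f f' q) = (q.1, Circle.exp q.2) :=
  (rollingTriv f f').right_inv (x := (q.1, Circle.exp q.2)) ⟨hq, mem_univ _⟩

theorem rollingParam_eq (f : SurfaceFrame g₁ o₁) (f' : SurfaceFrame g₂ o₂)
    {p : RollingSpace g₁ o₁ g₂ o₂} (hp : p.base ∈ f.dom ×ˢ f'.dom) {θ : ℝ}
    (hθ : Circle.exp θ = (rollingTriv f f' p).2) : rollingParam f f' (p.base, θ) = p := by
  rw [rollingParam, hθ]
  exact (rollingTriv f f').left_inv hp

theorem contMDiffOn_rollingParam (f : SurfaceFrame g₁ o₁) (f' : SurfaceFrame g₂ o₂) :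
    ContMDiffOn (((𝓡 2).prod (𝓡 2)).prod 𝓘(ℝ, ℝ)) (((𝓡 2).prod (𝓡 2)).prod (𝓡 1)) ∞
      (rollingParam f f') ((f.dom ×ˢ f'.dom) ×ˢ univ) :=
  ((rollingAtlas g₁ o₁ g₂ o₂).contMDiffOn_trivHomeo_symm (f, f')).comp
    (contMDiff_fst.prodMk (contMDiff_circleExp.comp contMDiff_snd)).contMDiffOn
    fun _ hq => ⟨hq.1, mem_univ _⟩

theorem mdifferentiableAt_rollingParam (f : SurfaceFrame g₁ o₁) (f' : SurfaceFrame g₂ o₂)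
    {q : (S₁ × S₂) × ℝ} (hq : q.1 ∈ f.dom ×ˢ f'.dom) :
    MDifferentiableAt (((𝓡 2).prod (𝓡 2)).prod 𝓘(ℝ, ℝ)) (((𝓡 2).prod (𝓡 2)).prod (𝓡 1))
      (rollingParam f f') q :=
  ((contMDiffOn_rollingParam f f').contMDiffAt
    (((f.isOpen_dom.prod f'.isOpen_dom).prod isOpen_univ).mem_nhds ⟨hq, mem_univ _⟩)).mdifferentiableAt
    (by simp)

theorem contMDiff_rolling_base :
    ContMDiff (((𝓡 2).prod (𝓡 2)).prod (𝓡 1)) ((𝓡 2).prod (𝓡 2)) ∞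
      (fun p : RollingSpace g₁ o₁ g₂ o₂ => p.base) :=
  (rollingAtlas g₁ o₁ g₂ o₂).contMDiff_base

/-- The velocity `(w, e^{iθ} w, θ')` of the rolling motion with first contact velocity `w`, in the
coordinates given by frames. -/
def rollingVector (f : SurfaceFrame g₁ o₁) (f' : SurfaceFrame g₂ o₂) (q : (S₁ × S₂) × ℝ) :
    ℂ →ₗ[ℝ] TangentSpace ((𝓡 2).prod (𝓡 2)) q.1 × ℝ :=
  let L : ℂ →ₗ[ℝ] ℂ := LinearMap.mulLeft ℝ (Circle.exp q.2 : ℂ)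
  ((tangentProd q.1).toLinearMap ∘ₗ ((frameVec f q.1.1).prod (frameVec f' q.1.2 ∘ₗ L))).prod
    (connForm f q.1.1 ∘ₗ frameVec f q.1.1 - connForm f' q.1.2 ∘ₗ frameVec f' q.1.2 ∘ₗ L)

theorem rollingVector_apply (f : SurfaceFrame g₁ o₁) (f' : SurfaceFrame g₂ o₂)
    (q : (S₁ × S₂) × ℝ) (w : ℂ) : rollingVector f f' q w =
      (tangentProd q.1 (frameVec f q.1.1 w, frameVec f' q.1.2 (Circle.exp q.2 * w)),
        connForm f q.1.1 (frameVec f q.1.1 w) -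
          connForm f' q.1.2 (frameVec f' q.1.2 (Circle.exp q.2 * w))) := rfl

/-- The tangent vector of the configuration space with coordinates `rollingVector`. -/
def rollingLift (f : SurfaceFrame g₁ o₁) (f' : SurfaceFrame g₂ o₂) (q : (S₁ × S₂) × ℝ) :
    ℂ →ₗ[ℝ] TangentSpace (((𝓡 2).prod (𝓡 2)).prod (𝓡 1)) (rollingParam f f' q) :=
  (mfderiv (((𝓡 2).prod (𝓡 2)).prod 𝓘(ℝ, ℝ)) (((𝓡 2).prod (𝓡 2)).prod (𝓡 1))
    (rollingParam f f') q).toLinearMap ∘ₗ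
    (show ℂ →ₗ[ℝ] TangentSpace (((𝓡 2).prod (𝓡 2)).prod 𝓘(ℝ, ℝ)) q from rollingVector f f' q)

/-- The projection of the lifted vector to the first surface is the vector with frame coordinate
`w`, and it determines `w`. -/
theorem rollingLift_injective (f : SurfaceFrame g₁ o₁) (f' : SurfaceFrame g₂ o₂)
    {q : (S₁ × S₂) × ℝ} (hq : q.1 ∈ f.dom ×ˢ f'.dom) : Injective (rollingLift f f' q) := by
  have hcomp := ((contMDiff_rolling_base (g₁ := g₁) (o₁ := o₁) (g₂ := g₂) (o₂ := o₂)
    (rollingParam f f' q)).mdifferentiableAt (by simp)).hasMFDerivAt.comp q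
    (mdifferentiableAt_rollingParam f f' hq).hasMFDerivAt
  have hfst := hasMFDerivAt_fst (I := (𝓡 2).prod (𝓡 2)) (I' := 𝓘(ℝ, ℝ)) q
  -- The base point of `rollingParam` at `(y, θ)` is `y`, so base projection after `rollingParam`
  -- and the first projection are the same map and have the same derivative.
  have huniq := hasMFDerivAt_unique hcomp hfst
  rw [← LinearMap.ker_eq_bot, LinearMap.ker_eq_bot']
  intro w hw
  have h1 : (rollingVector f f' q w).1 = 0 := by
    have h2 := congrArg (fun T => T (show TangentSpace (((𝓡 2).prod (𝓡 2)).prod 𝓘(ℝ, ℝ)) q from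
      rollingVector f f' q w)) huniq
    refine h2.symm.trans ?_
    rw [ContinuousLinearMap.comp_apply]
    exact (congrArg _ hw).trans (map_zero _)
  rw [rollingVector_apply] at h1
  have h3 := (tangentProd q.1).map_eq_zero_iff.1 h1
  have h4 : frameVec f q.1.1 w = 0 := congrArg Prod.fst h3
  rw [← frameCoord_frameVec f hq.1 w, h4, frameCoord_eq_complexCoord f hq.1]
  simp [complexCoord, Complex.ext_iff]

theorem velocityAt_prod {γ : ℝ → S₁ × S₂} {t : ℝ}
    (h : MDifferentiableAt 𝓘(ℝ, ℝ) ((𝓡 2).prod (𝓡 2)) γ t) :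
    velocityAt ((𝓡 2).prod (𝓡 2)) γ t = tangentProd (γ t)
      (velocityAt (𝓡 2) (fun s => (γ s).1) t, velocityAt (𝓡 2) (fun s => (γ s).2) t) := by
  have h1 : MDifferentiableAt 𝓘(ℝ, ℝ) (𝓡 2) (fun s => (γ s).1) t := h.fst
  have h2 : MDifferentiableAt 𝓘(ℝ, ℝ) (𝓡 2) (fun s => (γ s).2) t := h.snd
  have h3 := (h1.hasMFDerivAt.prodMk h2.hasMFDerivAt).mfderiv
  exact congrArg (fun T => T (1 : ℝ)) h3

/-- The chain rule. Only the germ of `γ` at `t` and the derivatives of `y` and `θ` at `t` matter. -/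
theorem velocity_rollingParam (f : SurfaceFrame g₁ o₁) (f' : SurfaceFrame g₂ o₂)
    {γ : ℝ → RollingSpace g₁ o₁ g₂ o₂} {y : ℝ → S₁ × S₂} {θ : ℝ → ℝ} {θ' t : ℝ}
    (hy : MDifferentiableAt 𝓘(ℝ, ℝ) ((𝓡 2).prod (𝓡 2)) y t) (hyD : y t ∈ f.dom ×ˢ f'.dom)
    (hθ : HasDerivAt θ θ' t) (hγ : γ =ᶠ[𝓝 t] fun s => rollingParam f f' (y s, θ s)) :
    velocity (((𝓡 2).prod (𝓡 2)).prod (𝓡 1)) γ t = ⟨rollingParam f f' (y t, θ t),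
      mfderiv (((𝓡 2).prod (𝓡 2)).prod 𝓘(ℝ, ℝ)) (((𝓡 2).prod (𝓡 2)).prod (𝓡 1))
        (rollingParam f f') (y t, θ t) (velocityAt ((𝓡 2).prod (𝓡 2)) y t, θ')⟩ := by
  have h1 : HasMFDerivAt 𝓘(ℝ, ℝ) 𝓘(ℝ, ℝ) θ t (ContinuousLinearMap.toSpanSingleton ℝ θ') :=
    hθ.hasFDerivAt.hasMFDerivAt
  have h2 := (mdifferentiableAt_rollingParam f f' (q := (y t, θ t)) hyD).hasMFDerivAt.comp t
    (hy.hasMFDerivAt.prodMk h1)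
  have h3 := (h2.congr_of_eventuallyEq hγ).mfderiv
  have h4 : γ t = rollingParam f f' (y t, θ t) := hγ.self_of_nhds
  have h5 : (velocityAt (((𝓡 2).prod (𝓡 2)).prod (𝓡 1)) γ t : (E2 × E2) × EuclideanSpace ℝ (Fin 1)) =
      mfderiv (((𝓡 2).prod (𝓡 2)).prod 𝓘(ℝ, ℝ)) (((𝓡 2).prod (𝓡 2)).prod (𝓡 1))
        (rollingParam f f') (y t, θ t) (velocityAt ((𝓡 2).prod (𝓡 2)) y t, θ') := by
    refine (congrArg (fun T => T (1 : ℝ)) h3).trans ?_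
    refine congrArg (mfderiv (((𝓡 2).prod (𝓡 2)).prod 𝓘(ℝ, ℝ)) (((𝓡 2).prod (𝓡 2)).prod (𝓡 1))
        (rollingParam f f') (y t, θ t)) ?_
    exact Prod.ext rfl (one_smul ℝ θ')
  exact Bundle.TotalSpace.ext h4 (heq_of_eq h5)

end RollingParam

/-! ### Regularity of the connection form -/

section ConnFormSmooth

variable {S : Type*} [TopologicalSpace S] [ChartedSpace (EuclideanSpace ℝ (Fin 2)) S]
  [IsManifold (𝓡 2) ∞ S] {g : SurfaceMetric S} {o : SurfaceOrientation S}

local notation "E2" => EuclideanSpace ℝ (Fin 2)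

theorem contMDiffOn_frameBracket (f : SurfaceFrame g o) :
    ContMDiffOn (𝓡 2) (𝓡 2).tangent ∞ (fun x => (⟨x, VectorField.mlieBracket (𝓡 2) (f.vec 0)
      (f.vec 1) x⟩ : TangentBundle (𝓡 2) S)) f.dom := by
  -- The bracket costs one derivative; as `∞ + 1 = ∞`, nothing is lost.
  have : IsManifold (𝓡 2) (((⊤ : ℕ∞) : WithTop ℕ∞) + 1) S := ‹IsManifold (𝓡 2) ∞ S›
  intro x hx
  have h := fun i => (f.isFrame.contMDiffOn i).contMDiffAt (f.isOpen_dom.mem_nhds hx)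
  have : IsManifold (𝓡 2) (minSmoothness ℝ 2) S := by
    rw [minSmoothness_of_isRCLikeNormedField]
    exact IsManifold.of_le (n := ∞) (WithTop.coe_le_coe.2 le_top)
  refine (ContMDiffAt.mlieBracket_vectorField (m := ⊤) (n := ⊤) (h 0) (h 1) ?_).contMDiffWithinAt
  rw [minSmoothness_of_isRCLikeNormedField]
  exact le_rfl

theorem contMDiffOn_connForm (f : SurfaceFrame g o) (i : Fin 2) :
    ContMDiffOn (𝓡 2) 𝓘(ℝ, ℝ) ∞ (fun x => connForm f x (f.vec i x)) f.dom :=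
  (contMDiffOn_metric g (contMDiffOn_frameBracket f) (f.isFrame.contMDiffOn i)).neg

theorem connForm_frameVec (f : SurfaceFrame g o) (x : S) (w : ℂ) : connForm f x (frameVec f x w) =
    w.re * connForm f x (f.vec 0 x) + w.im * connForm f x (f.vec 1 x) := by
  simp [frameVec_apply]

/-- Along a smooth curve, the connection form of a frame is continuous. -/
theorem continuousOn_connForm_velocityAt (f : SurfaceFrame g o) {γ : ℝ → S} {J : Set ℝ}
    (hJ : IsOpen J) (hγ : ContMDiffOn 𝓘(ℝ, ℝ) (𝓡 2) ∞ γ J) (hdom : ∀ t ∈ J, γ t ∈ f.dom) :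
    ContinuousOn (fun t => connForm f (γ t) (velocityAt (𝓡 2) γ t)) J := by
  intro t₀ ht₀
  refine ContinuousAt.continuousWithinAt ?_
  set x₀ := γ t₀
  have hmd : ∀ t ∈ J, MDifferentiableAt 𝓘(ℝ, ℝ) (𝓡 2) γ t := fun t ht =>
    (hγ.contMDiffAt (hJ.mem_nhds ht)).mdifferentiableAt (by simp)
  have hev : ∀ᶠ t in 𝓝 t₀, t ∈ J ∧ γ t ∈ (chartAt E2 x₀).source :=
    (hJ.eventually_mem ht₀).and
      ((hmd t₀ ht₀).continuousAt.preimage_mem_nhds ((chartAt E2 x₀).open_source.mem_nhds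
        (mem_chart_source E2 x₀)))
  -- In the fixed chart at `x₀` the velocity is `u'`, and near `t₀` the connection form on it is
  -- `-G(u)(b(u), u')`, where `G` is the metric and `b` the bracket of the frame.
  let u : ℝ → E2 := fun t => extChartAt (𝓡 2) x₀ (γ t)
  have hu : ContDiffAt ℝ ∞ u t₀ := by
    rw [← contMDiffAt_iff_contDiffAt]
    exact (contMDiffAt_extChartAt (I := 𝓡 2) (x := x₀)).comp t₀ (hγ.contMDiffAt (hJ.mem_nhds ht₀))
  have hdu : ContinuousAt (deriv u) t₀ := by
    have h := hu.continuousAt_fderiv (by simp) 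
    exact h.clm_apply continuousAt_const
  let b := chartField (IX := 𝓡 2) x₀ (VectorField.mlieBracket (𝓡 2) (f.vec 0) (f.vec 1))
  have hT : (extChartAt (𝓡 2) x₀).target ∩ (extChartAt (𝓡 2) x₀).symm ⁻¹' f.dom ∈ 𝓝 (u t₀) := by
    refine (isOpen_chart_preimage x₀ f.isOpen_dom).mem_nhds ⟨mem_extChartAt_target x₀, ?_⟩
    exact (congrArg (· ∈ f.dom) (extChartAt_to_inv (I := 𝓡 2) x₀)).mpr (hdom t₀ ht₀)
  have hb : ContinuousAt b (u t₀) :=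
    ((contDiffOn_chartField x₀ f.isOpen_dom (contMDiffOn_frameBracket f)).contDiffAt hT).continuousAt
  have hG : ContinuousAt (chartMetric g x₀) (u t₀) := ((contDiffOn_chartMetric g x₀).contDiffAt
    (Filter.mem_of_superset hT inter_subset_left)).continuousAt
  have hc : ContinuousAt (fun t => - chartMetric g x₀ (u t) (b (u t)) (deriv u t)) t₀ := by
    have h1 : ContinuousAt (fun t => chartMetric g x₀ (u t)) t₀ := hG.comp hu.continuousAt
    have h2 : ContinuousAt (fun t => b (u t)) t₀ := hb.comp hu.continuousAt
    exact ((h1.clm_apply h2).clm_apply hdu).neg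
  refine hc.congr ?_
  filter_upwards [hev] with t ht
  have hinv : (extChartAt (𝓡 2) x₀).symm (u t) = γ t :=
    (extChartAt (𝓡 2) x₀).left_inv (by rw [extChartAt_source]; exact ht.2)
  have hmem : u t ∈ (extChartAt (𝓡 2) x₀).target :=
    (extChartAt (𝓡 2) x₀).map_source (by rw [extChartAt_source]; exact ht.2)
  have h1 := chartMetric_chartCoord g x₀ hmem
  rw [(hasDerivAt_extChartAt_comp x₀ ht.2 (hmd t ht.1)).deriv]
  simp only [b, chartField]
  rw [hinv] at h1 ⊢
  rw [h1]
  rfl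

/-- A solution in a chart of the differential equation `x' = w` is a curve with velocity `w`. -/
theorem velocityAt_symm_comp (f : SurfaceFrame g o) (x₀ : S) {u : ℝ → E2} {w : ℂ} {t : ℝ}
    (ht : u t ∈ (extChartAt (𝓡 2) x₀).target)
    (hd : HasDerivAt u (w.re • chartField x₀ (f.vec 0) (u t) + w.im • chartField x₀ (f.vec 1) (u t)) t) :
    MDifferentiableAt 𝓘(ℝ, ℝ) (𝓡 2) (fun s => (extChartAt (𝓡 2) x₀).symm (u s)) t ∧
    velocityAt (𝓡 2) (fun s => (extChartAt (𝓡 2) x₀).symm (u s)) t =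
      frameVec f ((extChartAt (𝓡 2) x₀).symm (u t)) w := by
  have hx := symm_mem_chart_source x₀ ht
  have hm : MDifferentiableAt 𝓘(ℝ, ℝ) (𝓡 2) (fun s => (extChartAt (𝓡 2) x₀).symm (u s)) t := by
    have h1 : MDifferentiableAt 𝓘(ℝ, E2) (𝓡 2) (extChartAt (𝓡 2) x₀).symm (u t) :=
      ((contMDiffOn_extChartAt_symm (n := ∞) x₀).contMDiffAt
        ((isOpen_extChartAt_target x₀).mem_nhds ht)).mdifferentiableAt (by simp)
    exact h1.comp t hd.differentiableAt.mdifferentiableAt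
  refine ⟨hm, ?_⟩
  have h2 := hasDerivAt_extChartAt_comp x₀ hx hm
  have h3 : (fun s => extChartAt (𝓡 2) x₀ ((extChartAt (𝓡 2) x₀).symm (u s))) =ᶠ[𝓝 t] u := by
    filter_upwards [hd.continuousAt ((isOpen_extChartAt_target x₀).mem_nhds ht)] with s hs
    exact (extChartAt (𝓡 2) x₀).right_inv hs
  -- The derivative of `u` is the coordinate expression of the velocity; by the differential
  -- equation it is also that of the frame vector.
  have h4 := (h2.congr_of_eventuallyEq h3.symm).unique hd
  rw [← symm_chartCoord x₀ hx (velocityAt _ _ _), h4, ← symm_chartCoord x₀ hx (frameVec f _ w)]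
  congr 1
  simp only [chartCoord_eq_clm x₀ hx, frameVec_apply, map_add, map_smul, chartField]

end ConnFormSmooth

/-! ### Existence of rolling motions with prescribed velocity -/

section RollingCurve

variable {S₁ : Type*} [TopologicalSpace S₁] [ChartedSpace (EuclideanSpace ℝ (Fin 2)) S₁]
  [IsManifold (𝓡 2) ∞ S₁]
  {S₂ : Type*} [TopologicalSpace S₂] [ChartedSpace (EuclideanSpace ℝ (Fin 2)) S₂]
  [IsManifold (𝓡 2) ∞ S₂]
  {g₁ : SurfaceMetric S₁} {o₁ : SurfaceOrientation S₁}
  {g₂ : SurfaceMetric S₂} {o₂ : SurfaceOrientation S₂}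

local notation "E2" => EuclideanSpace ℝ (Fin 2)

theorem frameCoord_rollingParam_fiber (f : SurfaceFrame g₁ o₁) (f' : SurfaceFrame g₂ o₂)
    {q : (S₁ × S₂) × ℝ} (hq : q.1 ∈ f.dom ×ˢ f'.dom) (u : TangentSpace (𝓡 2) q.1.1) :
    frameCoord f' q.1.2 ((rollingParam f f' q).fiber.1 u) =
      Circle.exp q.2 * frameCoord f q.1.1 u := by
  have h := frameCoord_fiber f f' (p := rollingParam f f' q) hq u
  rw [rollingTriv_rollingParam f f' hq] at h
  exact h

theorem rollingParam_fiber_frameVec (f : SurfaceFrame g₁ o₁) (f' : SurfaceFrame g₂ o₂)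
    {q : (S₁ × S₂) × ℝ} (hq : q.1 ∈ f.dom ×ˢ f'.dom) (w : ℂ) :
    (rollingParam f f' q).fiber.1 (frameVec f q.1.1 w) = frameVec f' q.1.2 (Circle.exp q.2 * w) := by
  have h := frameCoord_rollingParam_fiber f f' hq (frameVec f q.1.1 w)
  rw [frameCoord_frameVec f hq.1] at h
  rw [← h]
  exact (frameVec_frameCoord f' hq.2 _).symm

theorem hasDerivAt_circleExp {θ : ℝ → ℝ} {θ' t : ℝ} (h : HasDerivAt θ θ' t) :
    HasDerivAt (fun s => (Circle.exp (θ s) : ℂ)) (Circle.exp (θ t) * (θ' * Complex.I)) t := by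
  simp only [Circle.coe_exp]
  exact (h.ofReal_comp.mul_const Complex.I).cexp

/-- From `z' = -i α₁ z` follows `(e^{iθ} z)' = i (θ' - α₁) e^{iθ} z`. For `θ' = α₁ - α₂` this is `-i
α₂ e^{iθ} z`, the parallel equation on the second surface. Here `α₁` and `α₂` stand for the
connection forms on the two contact velocities. -/
theorem noTwist_rollingParam (f : SurfaceFrame g₁ o₁) (f' : SurfaceFrame g₂ o₂)
    {y : ℝ → S₁ × S₂} {θ : ℝ → ℝ} {J : Set ℝ} (hJ : IsOpen J)
    (hD : ∀ t ∈ J, y t ∈ f.dom ×ˢ f'.dom)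
    (hy : ∀ t ∈ J, MDifferentiableAt 𝓘(ℝ, ℝ) ((𝓡 2).prod (𝓡 2)) y t)
    (hθ : ∀ t ∈ J, HasDerivAt θ (connForm f (y t).1 (velocityAt (𝓡 2) (fun s => (y s).1) t) -
      connForm f' (y t).2 (velocityAt (𝓡 2) (fun s => (y s).2) t)) t) :
    NoTwist (fun t => rollingParam f f' (y t, θ t)) J := by
  intro a b hab v hv t ht
  have htJ := hab ht
  have h := ((isParallelAt_iff f (hD t htJ).1).1 (hv t ht)).2
  refine (isParallelAt_iff f' (hD t htJ).2).2 ⟨(hy t htJ).snd, ?_⟩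
  have h1 := (hasDerivAt_circleExp (hθ t htJ)).mul h
  have h2 : (fun s => frameCoord f' (y s).2 ((rollingParam f f' (y s, θ s)).fiber.1 (v s))) =ᶠ[𝓝 t]
      fun s => (Circle.exp (θ s) : ℂ) * frameCoord f (y s).1 (v s) := by
    filter_upwards [hJ.mem_nhds htJ] with s hs
    exact frameCoord_rollingParam_fiber f f' (q := (y s, θ s)) (hD s hs) (v s)
  refine (h1.congr_of_eventuallyEq h2).congr_deriv ?_
  have halg : ∀ (E z : ℂ) (a b : ℝ), E * (((a - b : ℝ) : ℂ) * Complex.I) * z +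
      E * (-(a : ℂ) * Complex.I * z) = -(b : ℂ) * Complex.I * (E * z) := by
    intros
    push_cast
    ring
  exact (halg _ _ _ _).trans (congrArg (fun z : ℂ =>
    -((connForm f' (y t).2 (velocityAt (𝓡 2) (fun s => (y s).2) t) : ℝ) : ℂ) * Complex.I * z)
    h2.self_of_nhds.symm)

/-- In the coordinates given by frames, the velocities of rolling motions contain the vectors
`(w, e^{iθ} w, θ')`. -/
theorem rollingLift_mem_rollingDistribution (f : SurfaceFrame g₁ o₁) (f' : SurfaceFrame g₂ o₂)
    {q : (S₁ × S₂) × ℝ} (hq : q.1 ∈ f.dom ×ˢ f'.dom) (w : ℂ) :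
    (⟨rollingParam f f' q, rollingLift f f' q w⟩ :
      TangentBundle (((𝓡 2).prod (𝓡 2)).prod (𝓡 1)) (RollingSpace g₁ o₁ g₂ o₂)) ∈
      rollingDistribution g₁ o₁ g₂ o₂ := by
  obtain ⟨⟨x₁, x₂⟩, θ₀⟩ := q
  let s₁ : E2 → S₁ := (extChartAt (𝓡 2) x₁).symm
  let s₂ : E2 → S₂ := (extChartAt (𝓡 2) x₂).symm
  let U₁ := (extChartAt (𝓡 2) x₁).target ∩ s₁ ⁻¹' f.dom
  let U₂ := (extChartAt (𝓡 2) x₂).target ∩ s₂ ⁻¹' f'.dom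
  have hU₁ : IsOpen U₁ := isOpen_chart_preimage x₁ f.isOpen_dom
  have hU₂ : IsOpen U₂ := isOpen_chart_preimage x₂ f'.isOpen_dom
  let e : Fin 2 → E2 → E2 := fun i => chartField x₁ (f.vec i)
  let e' : Fin 2 → E2 → E2 := fun i => chartField x₂ (f'.vec i)
  let k : Fin 2 → E2 → ℝ := fun i u => connForm f (s₁ u) (f.vec i (s₁ u))
  let k' : Fin 2 → E2 → ℝ := fun i u => connForm f' (s₂ u) (f'.vec i (s₂ u))
  have he : ∀ i, ContDiffOn ℝ ∞ (e i) U₁ := fun i =>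
    contDiffOn_chartField x₁ f.isOpen_dom (f.isFrame.contMDiffOn i)
  have he' : ∀ i, ContDiffOn ℝ ∞ (e' i) U₂ := fun i =>
    contDiffOn_chartField x₂ f'.isOpen_dom (f'.isFrame.contMDiffOn i)
  have hk : ∀ i, ContDiffOn ℝ ∞ (k i) U₁ := fun i => contDiffOn_chartFun x₁ (contMDiffOn_connForm f i)
  have hk' : ∀ i, ContDiffOn ℝ ∞ (k' i) U₂ := fun i => contDiffOn_chartFun x₂ (contMDiffOn_connForm f' i)
  let W : ℝ → ℂ := fun θ => Circle.exp θ * w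
  have hW : ContDiff ℝ ∞ W := by
    simp only [W, Circle.coe_exp]
    exact ((Complex.ofRealCLM.contDiff.mul contDiff_const).cexp).mul contDiff_const
  have hre : ContDiff ℝ ∞ fun θ => (W θ).re := Complex.reCLM.contDiff.comp hW
  have him : ContDiff ℝ ∞ fun θ => (W θ).im := Complex.imCLM.contDiff.comp hW
  -- The rolling equations in charts: `x'` has the constant frame coordinate `w`, absence of
  -- slipping forces the coordinate `W θ = e^{iθ} w` for the second contact point, and absence of
  -- twisting forces `θ'`. The functions `k` and `k'` are the values of the connection forms on the
  -- frames.
  let F : (E2 × E2) × ℝ → (E2 × E2) × ℝ := fun p =>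
    ((w.re • e 0 p.1.1 + w.im • e 1 p.1.1, (W p.2).re • e' 0 p.1.2 + (W p.2).im • e' 1 p.1.2),
      (w.re * k 0 p.1.1 + w.im * k 1 p.1.1) - ((W p.2).re * k' 0 p.1.2 + (W p.2).im * k' 1 p.1.2))
  let U : Set ((E2 × E2) × ℝ) := (U₁ ×ˢ U₂) ×ˢ univ
  have hU : IsOpen U := (hU₁.prod hU₂).prod isOpen_univ
  have hF : ContDiffOn ℝ ∞ F U := by
    have p1 : ContDiffOn ℝ ∞ (fun p : (E2 × E2) × ℝ => p.1.1) U := (contDiff_fst.comp contDiff_fst).contDiffOn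
    have p2 : ContDiffOn ℝ ∞ (fun p : (E2 × E2) × ℝ => p.1.2) U := (contDiff_snd.comp contDiff_fst).contDiffOn
    have m1 : MapsTo (fun p : (E2 × E2) × ℝ => p.1.1) U U₁ := fun p hp => hp.1.1
    have m2 : MapsTo (fun p : (E2 × E2) × ℝ => p.1.2) U U₂ := fun p hp => hp.1.2
    have r1 : ContDiffOn ℝ ∞ (fun p : (E2 × E2) × ℝ => (W p.2).re) U := (hre.comp contDiff_snd).contDiffOn
    have r2 : ContDiffOn ℝ ∞ (fun p : (E2 × E2) × ℝ => (W p.2).im) U := (him.comp contDiff_snd).contDiffOn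
    have E := fun i => (he i).comp p1 m1
    have E' := fun i => (he' i).comp p2 m2
    have K := fun i => (hk i).comp p1 m1
    have K' := fun i => (hk' i).comp p2 m2
    exact ((((E 0).const_smul w.re).add ((E 1).const_smul w.im)).prodMk
      ((r1.smul (E' 0)).add (r2.smul (E' 1)))).prodMk
      (((contDiffOn_const.mul (K 0)).add (contDiffOn_const.mul (K 1))).sub
        ((r1.mul (K' 0)).add (r2.mul (K' 1))))
  have hx₁ : s₁ (extChartAt (𝓡 2) x₁ x₁) = x₁ := extChartAt_to_inv (I := 𝓡 2) x₁
  have hx₂ : s₂ (extChartAt (𝓡 2) x₂ x₂) = x₂ := extChartAt_to_inv (I := 𝓡 2) x₂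
  have h0 : ((extChartAt (𝓡 2) x₁ x₁, extChartAt (𝓡 2) x₂ x₂), θ₀) ∈ U :=
    ⟨⟨⟨mem_extChartAt_target x₁, (congrArg (· ∈ f.dom) hx₁).mpr hq.1⟩,
      ⟨mem_extChartAt_target x₂, (congrArg (· ∈ f'.dom) hx₂).mpr hq.2⟩⟩, mem_univ _⟩
  -- The solution stays in `U`, so on the whole interval both contact points remain in the charts
  -- and in the domains of the frames.
  obtain ⟨α, ε, hε, hα0, hαs, hα⟩ := exists_contDiffOn_integralCurve hU hF h0
  let y : ℝ → S₁ × S₂ := fun t => (s₁ (α t).1.1, s₂ (α t).1.2)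
  let θ : ℝ → ℝ := fun t => (α t).2
  have hD : ∀ t ∈ Ioo (-ε) ε, y t ∈ f.dom ×ˢ f'.dom := fun t ht =>
    ⟨(hα t ht).1.1.1.2, (hα t ht).1.1.2.2⟩
  have hv1 : ∀ t ∈ Ioo (-ε) ε, velocityAt (𝓡 2) (fun s => (y s).1) t = frameVec f (y t).1 w :=
    fun t ht => (velocityAt_symm_comp f x₁ (hα t ht).1.1.1.1
      (hα t ht).2.fst.fst).2
  have hv2 : ∀ t ∈ Ioo (-ε) ε, velocityAt (𝓡 2) (fun s => (y s).2) t = frameVec f' (y t).2 (W (θ t)) :=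
    fun t ht => (velocityAt_symm_comp f' x₂ (hα t ht).1.1.2.1
      (hα t ht).2.fst.snd).2
  have hys : ContMDiffOn 𝓘(ℝ, ℝ) ((𝓡 2).prod (𝓡 2)) ∞ y (Ioo (-ε) ε) := by
    have a1 : ContMDiffOn 𝓘(ℝ, ℝ) 𝓘(ℝ, E2) ∞ (fun t => (α t).1.1) (Ioo (-ε) ε) :=
      (contDiff_fst.comp_contDiffOn (contDiff_fst.comp_contDiffOn hαs)).contMDiffOn
    have a2 : ContMDiffOn 𝓘(ℝ, ℝ) 𝓘(ℝ, E2) ∞ (fun t => (α t).1.2) (Ioo (-ε) ε) :=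
      (contDiff_snd.comp_contDiffOn (contDiff_fst.comp_contDiffOn hαs)).contMDiffOn
    exact ((contMDiffOn_extChartAt_symm x₁).comp a1 fun t ht => (hα t ht).1.1.1.1).prodMk
      ((contMDiffOn_extChartAt_symm x₂).comp a2 fun t ht => (hα t ht).1.1.2.1)
  have hyd : ∀ t ∈ Ioo (-ε) ε, MDifferentiableAt 𝓘(ℝ, ℝ) ((𝓡 2).prod (𝓡 2)) y t := fun t ht =>
    (hys.contMDiffAt (isOpen_Ioo.mem_nhds ht)).mdifferentiableAt (by simp)
  have hθd : ∀ t ∈ Ioo (-ε) ε, HasDerivAt θ (connForm f (y t).1 (frameVec f (y t).1 w) -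
      connForm f' (y t).2 (frameVec f' (y t).2 (W (θ t)))) t := by
    intro t ht
    rw [connForm_frameVec, connForm_frameVec]
    exact (hα t ht).2.snd
  have h0ε : (0 : ℝ) ∈ Ioo (-ε) ε := ⟨by linarith, hε⟩
  have hy0 : (y 0, θ 0) = ((x₁, x₂), θ₀) := by
    simp only [y, θ, hα0, hx₁, hx₂]
  refine ⟨fun t => rollingParam f f' (y t, θ t), ε, hε, ?_, ?_, ?_, ?_⟩
  · exact (contMDiffOn_rollingParam f f').comp (hys.prodMk
      (contDiff_snd.comp_contDiffOn hαs).contMDiffOn) fun t ht => ⟨hD t ht, mem_univ _⟩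
  · intro t ht
    have h := rollingParam_fiber_frameVec f f' (q := (y t, θ t)) (hD t ht) w
    exact (congrArg (rollingParam f f' (y t, θ t)).fiber.1 (hv1 t ht)).trans (h.trans (hv2 t ht).symm)
  · refine noTwist_rollingParam f f' isOpen_Ioo hD hyd fun t ht => ?_
    rw [hv1 t ht, hv2 t ht]
    exact hθd t ht
  · rw [velocity_rollingParam f f' (hyd 0 h0ε) (hD 0 h0ε) (hθd 0 h0ε) (Filter.EventuallyEq.refl _ _),
      velocityAt_prod (hyd 0 h0ε), hv1 0 h0ε, hv2 0 h0ε]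
    change _ = (⟨rollingParam f f' (y 0, θ 0), rollingLift f f' (y 0, θ 0) w⟩ :
      TangentBundle (((𝓡 2).prod (𝓡 2)).prod (𝓡 1)) (RollingSpace g₁ o₁ g₂ o₂))
    rw [hy0]

end RollingCurve

/-! ### Untwisted motions and horizontal curves of planes -/

theorem exists_hasDerivAt_of_continuousOn {h : ℝ → ℝ} {δ : ℝ} (hδ : 0 < δ)
    (hh : ContinuousOn h (Ioo (-δ) δ)) : ∃ H : ℝ → ℝ, ∀ t ∈ Ioo (-δ) δ, HasDerivAt H (h t) t := by
  refine ⟨fun t => ∫ s in (0 : ℝ)..t, h s, fun t ht => ?_⟩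
  refine intervalIntegral.integral_hasDerivAt_right ?_
    (hh.stronglyMeasurableAtFilter isOpen_Ioo t ht) (hh.continuousAt (isOpen_Ioo.mem_nhds ht))
  refine (hh.mono ?_).intervalIntegrable
  exact (ordConnected_Ioo (a := -δ) (b := δ)).uIcc_subset ⟨by linarith, hδ⟩ ht

section Horizontal

variable {S₁ : Type*} [TopologicalSpace S₁] [ChartedSpace (EuclideanSpace ℝ (Fin 2)) S₁]
  [IsManifold (𝓡 2) ∞ S₁]
  {S₂ : Type*} [TopologicalSpace S₂] [ChartedSpace (EuclideanSpace ℝ (Fin 2)) S₂]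
  [IsManifold (𝓡 2) ∞ S₂]
  {g₁ : SurfaceMetric S₁} {o₁ : SurfaceOrientation S₁}
  {g₂ : SurfaceMetric S₂} {o₂ : SurfaceOrientation S₂}

/-- For `E ≠ 0` the numbers `E` and `E i` form a real basis of `ℂ`, and `u ↦ (u, A u)` carries a
basis to a basis of the graph. The factor `E` will be the phase of parallel transport. -/
theorem span_graphPlane (f : SurfaceFrame g₁ o₁) {y : S₁ × S₂} (hy : y.1 ∈ f.dom)
    (A : TangentSpace (𝓡 2) y.1 ≃ₗ[ℝ] TangentSpace (𝓡 2) y.2) {E : ℂ} (hE : E ≠ 0) :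
    graphPlane y A = Submodule.span ℝ (range fun i : Fin 2 =>
      tangentProd y (frameVec f y.1 (E * ![1, Complex.I] i),
        A (frameVec f y.1 (E * ![1, Complex.I] i)))) := by
  apply le_antisymm
  · intro w hw
    obtain ⟨⟨u, v⟩, rfl⟩ := (tangentProd y).surjective w
    obtain rfl := (tangentProd_mem_graphPlane y A u v).1 hw
    set ζ := frameCoord f y.1 u / E
    have hu : u = ζ.re • frameVec f y.1 (E * ![1, Complex.I] 0) +
        ζ.im • frameVec f y.1 (E * ![1, Complex.I] 1) := by
      have h1 : frameCoord f y.1 u = E * ζ := (mul_div_cancel₀ _ hE).symm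
      have h2 : frameCoord f y.1 u = ζ.re • (E * ![1, Complex.I] 0) + ζ.im • (E * ![1, Complex.I] 1) := by
        rw [h1]
        conv_lhs => rw [← Complex.re_add_im ζ]
        simp only [Matrix.cons_val_zero, Matrix.cons_val_one, Complex.real_smul]
        ring
      rw [← map_smul, ← map_smul, ← map_add, ← h2]
      exact (frameVec_frameCoord f hy u).symm
    have h2 : tangentProd y (u, A u) =
        ζ.re • tangentProd y (frameVec f y.1 (E * ![1, Complex.I] 0),
          A (frameVec f y.1 (E * ![1, Complex.I] 0))) +
        ζ.im • tangentProd y (frameVec f y.1 (E * ![1, Complex.I] 1),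
          A (frameVec f y.1 (E * ![1, Complex.I] 1))) := by
      rw [← map_smul, ← map_smul, ← map_add]
      congr 1
      refine Prod.ext hu ?_
      exact (congrArg A hu).trans (by rw [map_add, map_smul, map_smul]; rfl)
    rw [h2]
    exact add_mem (Submodule.smul_mem _ _ (Submodule.subset_span ⟨0, rfl⟩))
      (Submodule.smul_mem _ _ (Submodule.subset_span ⟨1, rfl⟩))
  · rw [Submodule.span_le]
    rintro _ ⟨i, rfl⟩
    exact (tangentProd_mem_graphPlane y A _ _).2 rfl

/-- The graphs of a motion without twisting form a horizontal curve of planes. -/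
theorem exists_isHorizontal_of_noTwist {γ : ℝ → RollingSpace g₁ o₁ g₂ o₂} {ε : ℝ} (hε : 0 < ε)
    (hγ : ContMDiffOn 𝓘(ℝ, ℝ) (((𝓡 2).prod (𝓡 2)).prod (𝓡 1)) ∞ γ (Ioo (-ε) ε))
    (hT : NoTwist γ (Ioo (-ε) ε)) :
    ∃ δ > 0, δ ≤ ε ∧
      IsHorizontal (splitProduct g₁ o₁ g₂ o₂) (graphDiffeo g₁ o₁ g₂ o₂ ∘ γ) (Ioo (-δ) δ) := by
  obtain ⟨f, hf⟩ := exists_surfaceFrame g₁ o₁ (γ 0).base.1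
  have hy : ContMDiffOn 𝓘(ℝ, ℝ) ((𝓡 2).prod (𝓡 2)) ∞ (fun t => (γ t).base) (Ioo (-ε) ε) :=
    contMDiff_rolling_base.comp_contMDiffOn hγ
  have hx : ContMDiffOn 𝓘(ℝ, ℝ) (𝓡 2) ∞ (fun t => (γ t).base.1) (Ioo (-ε) ε) :=
    contMDiff_fst.comp_contMDiffOn hy
  have h0 : (0 : ℝ) ∈ Ioo (-ε) ε := ⟨by linarith, hε⟩
  -- The interval is shortened to keep the first contact curve in the domain of one frame; no frame
  -- of the second surface is needed.
  have hn : (fun t => (γ t).base.1) ⁻¹' f.dom ∈ 𝓝 (0 : ℝ) :=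
    (hx.continuousOn.continuousAt (isOpen_Ioo.mem_nhds h0)).preimage_mem_nhds
      (f.isOpen_dom.mem_nhds hf)
  obtain ⟨r, hr, hrf⟩ := Metric.mem_nhds_iff.1 hn
  rw [Real.ball_eq_Ioo, zero_sub, zero_add] at hrf
  have hδ : 0 < min r ε := lt_min hr hε
  have hsub : Ioo (-(min r ε)) (min r ε) ⊆ Ioo (-ε) ε :=
    Ioo_subset_Ioo (neg_le_neg (min_le_right _ _)) (min_le_right _ _)
  have hdom : ∀ t ∈ Ioo (-(min r ε)) (min r ε), (γ t).base.1 ∈ f.dom := fun t ht =>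
    hrf (Ioo_subset_Ioo (neg_le_neg (min_le_left _ _)) (min_le_left _ _) ht)
  refine ⟨min r ε, hδ, min_le_right _ _, ?_⟩
  generalize min r ε = δ at *
  -- With a primitive `Θ` of the connection form on the velocity, `e^{-iΘ}` solves `z' = -i α(x')
  -- z`. So `e^{-iΘ}` and `i e^{-iΘ}` are the coordinates of two independent parallel fields.
  obtain ⟨Θ, hΘ⟩ := exists_hasDerivAt_of_continuousOn hδ
    (continuousOn_connForm_velocityAt f isOpen_Ioo (hx.mono hsub) hdom)
  let E : ℝ → ℂ := fun t => Complex.exp (-(Θ t : ℂ) * Complex.I)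
  let v : Fin 2 → ∀ t, TangentSpace (𝓡 2) (γ t).base.1 := fun i t =>
    frameVec f (γ t).base.1 (E t * ![1, Complex.I] i)
  have hv : ∀ i, IsParallelAlong (metricForm g₁) (fun t => (γ t).base.1) (v i) (Ioo (-δ) δ) := by
    intro i t ht
    refine (isParallelAt_iff f (hdom t ht)).2
      ⟨(hx.contMDiffAt (isOpen_Ioo.mem_nhds (hsub ht))).mdifferentiableAt (by simp), ?_⟩
    have h1 := ((((hΘ t ht).ofReal_comp).neg.mul_const Complex.I).cexp).mul_const
      ((![1, Complex.I] : Fin 2 → ℂ) i)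
    have h2 : (fun s => frameCoord f (γ s).base.1 (v i s)) =ᶠ[𝓝 t] fun s => E s * ![1, Complex.I] i := by
      filter_upwards [isOpen_Ioo.mem_nhds ht] with s hs
      exact frameCoord_frameVec f (hdom s hs) _
    refine (h1.congr_of_eventuallyEq h2).congr_deriv ?_
    refine Eq.trans ?_ (congrArg (fun z : ℂ => -((connForm f (γ t).base.1
      (velocityAt (𝓡 2) (fun t => (γ t).base.1) t) : ℝ) : ℂ) * Complex.I * z) h2.self_of_nhds.symm)
    simp only [E, Pi.neg_apply]
    ring
  -- Absence of twisting makes the images `A v` parallel too. Hence the pairs `(v, A v)` are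
  -- parallel for the product metric, and they span the graph.
  have hw := fun i => hT (-δ) δ hsub (v i) (hv i)
  refine ⟨fun i t => tangentProd (γ t).base (v i t, (γ t).fiber.1 (v i t)), fun i t ht => ?_,
    fun t ht => ?_⟩
  · exact (isParallelAt_split_iff g₁ g₂).2 ⟨hv i t ht, hw i t ht⟩
  · exact span_graphPlane f (hdom t ht) (γ t).fiber.1 (Complex.exp_ne_zero _)

/-- If the graphs of a curve in the configuration space form a horizontal curve of planes and the
velocity of the base curve lies in the graph, then the curve has the velocity of a rolling
motion. -/
theorem exists_velocity_eq_rollingLift (f : SurfaceFrame g₁ o₁) (f' : SurfaceFrame g₂ o₂)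
    {q : (S₁ × S₂) × ℝ} (hq : q.1 ∈ f.dom ×ˢ f'.dom)
    {γ : ℝ → RollingSpace g₁ o₁ g₂ o₂} {ε : ℝ} (hε : 0 < ε)
    (hγ : ContMDiffOn 𝓘(ℝ, ℝ) (((𝓡 2).prod (𝓡 2)).prod (𝓡 1)) ∞ γ (Ioo (-ε) ε))
    (hH : IsHorizontal (splitProduct g₁ o₁ g₂ o₂) (graphDiffeo g₁ o₁ g₂ o₂ ∘ γ) (Ioo (-ε) ε))
    (hb : velocityAt ((𝓡 2).prod (𝓡 2)) (fun t => (γ t).base) 0 ∈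
      graphPlane (γ 0).base (γ 0).fiber.1)
    (hγ0 : γ 0 = rollingParam f f' q) :
    ∃ w, velocity (((𝓡 2).prod (𝓡 2)).prod (𝓡 1)) γ 0 =
      ⟨rollingParam f f' q, rollingLift f f' q w⟩ := by
  have h0 : (0 : ℝ) ∈ Ioo (-ε) ε := ⟨by linarith, hε⟩
  have hy : MDifferentiableAt 𝓘(ℝ, ℝ) ((𝓡 2).prod (𝓡 2)) (fun t => (γ t).base) 0 :=
    ((contMDiff_rolling_base.comp_contMDiffOn hγ).contMDiffAt
      (isOpen_Ioo.mem_nhds h0)).mdifferentiableAt (by simp)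
  set y : ℝ → S₁ × S₂ := fun t => (γ t).base with hydef
  have hy0 : y 0 = q.1 := congrArg BundlePoint.base hγ0
  have hyD : y 0 ∈ f.dom ×ˢ f'.dom := by rw [hy0]; exact hq
  have hev : ∀ᶠ t in 𝓝 (0 : ℝ), t ∈ Ioo (-ε) ε ∧ y t ∈ f.dom ×ˢ f'.dom :=
    (isOpen_Ioo.eventually_mem h0).and (hy.continuousAt.preimage_mem_nhds
      ((f.isOpen_dom.prod f'.isOpen_dom).mem_nhds hyD))
  obtain ⟨n, hpar, hspan⟩ : ∃ n : Fin 2 → ∀ t, TangentSpace ((𝓡 2).prod (𝓡 2)) (y t),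
      (∀ i, IsParallelAlong (splitForm g₁ g₂) y (n i) (Ioo (-ε) ε)) ∧ ∀ t ∈ Ioo (-ε) ε,
        graphPlane (y t) (γ t).fiber.1 = Submodule.span ℝ (range fun i => n i t) := hH
  -- Each spanning field `nᵢ` is split into its components, which are parallel on the two surfaces;
  -- as `nᵢ` lies in the graph, the second component is the image of the first.
  have hab : ∀ i t, ∃ ab : TangentSpace (𝓡 2) (y t).1 × TangentSpace (𝓡 2) (y t).2,
      tangentProd (y t) ab = n i t := fun i t => (tangentProd (y t)).surjective _
  choose ab hab using hab
  have hn : n = fun i t => tangentProd (y t) ((ab i t).1, (ab i t).2) :=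
    funext fun i => funext fun t => (hab i t).symm
  have hp := fun i => hpar i 0 h0
  rw [hn] at hp
  have hp' := fun i => (isParallelAt_split_iff (γ := y) (a := fun t => (ab i t).1)
    (b := fun t => (ab i t).2) g₁ g₂).1 (hp i)
  have hz := fun i => ((isParallelAt_iff f hyD.1).1 (hp' i).1).2
  have hz' := fun i => ((isParallelAt_iff f' hyD.2).1 (hp' i).2).2
  have hgraph : ∀ i, ∀ t ∈ Ioo (-ε) ε, (γ t).fiber.1 (ab i t).1 = (ab i t).2 := by
    intro i t ht
    have h2 : n i t ∈ graphPlane (y t) (γ t).fiber.1 := by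
      rw [hspan t ht]; exact Submodule.subset_span ⟨i, rfl⟩
    rw [← hab i t] at h2
    exact (tangentProd_mem_graphPlane _ _ _ _).1 h2
  let c : ℝ → Circle := fun t => (rollingTriv f f' (γ t)).2
  have hc : ∀ i, ∀ t, t ∈ Ioo (-ε) ε ∧ y t ∈ f.dom ×ˢ f'.dom → frameCoord f' (y t).2 (ab i t).2 =
      c t * frameCoord f (y t).1 (ab i t).1 := by
    intro i t ht
    rw [← hgraph i t ht.1]
    exact frameCoord_fiber f f' (p := γ t) ht.2 _
  -- Otherwise both `nᵢ` would vanish at time zero and could not span a plane. The nonzero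
  -- coordinate serves as a denominator for the angle.
  have hne : ∃ i, frameCoord f (y 0).1 (ab i 0).1 ≠ 0 := by
    by_contra! hcon
    have h1 : ∀ i, n i 0 = 0 := by
      intro i
      have e1 : (ab i 0).1 = 0 := by
        rw [← frameVec_frameCoord f hyD.1 (ab i 0).1, hcon i, map_zero]
      have e2 : (ab i 0).2 = 0 := by
        rw [← hgraph i 0 h0, e1]
        exact map_zero (γ 0).fiber.1
      rw [← hab i 0, show ab i 0 = 0 from Prod.ext e1 e2, map_zero]
    have h2 : graphPlane (y 0) (γ 0).fiber.1 = ⊥ := by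
      refine (hspan 0 h0).trans ?_
      rw [Submodule.span_eq_bot]
      rintro _ ⟨i, rfl⟩
      exact h1 i
    have h3 := (isSelfdualNullPlane_graphPlane (y 0) (γ 0).fiber).finrank_eq
    rw [h2, finrank_bot] at h3
    exact absurd h3 (by norm_num)
  obtain ⟨i, hi⟩ := hne
  set k := connForm f (y 0).1 (velocityAt (𝓡 2) (fun t => (y t).1) 0)
  set k' := connForm f' (y 0).2 (velocityAt (𝓡 2) (fun t => (y t).2) 0)
  have hc0 : Circle.exp q.2 = c 0 := by
    simp only [c]
    rw [hγ0, rollingTriv_rollingParam f f' hq]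
  -- The angle is the quotient `c = z₂ / z₁`, with `z₁' = -i k z₁` and `z₂' = -i k' z₂` at time
  -- zero. The quotient rule gives `c' / c = i (k - k')` there; the parallel equations at other
  -- times play no role.
  have hcd : HasDerivAt (fun t => ((c t / c 0 : Circle) : ℂ)) (((k - k' : ℝ) : ℂ) * Complex.I) 0 := by
    have h1 := ((hz' i).div (hz i) hi).div_const (c 0 : ℂ)
    have h2 : (fun t => ((c t / c 0 : Circle) : ℂ)) =ᶠ[𝓝 0] fun t =>
        (frameCoord f' (y t).2 (ab i t).2 / frameCoord f (y t).1 (ab i t).1) / (c 0 : ℂ) := by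
      filter_upwards [hev, (hz i).continuousAt.eventually_ne hi] with t ht hnt
      rw [hc i t ht, mul_div_cancel_right₀ _ hnt, Circle.coe_div]
    refine (h1.congr_of_eventuallyEq h2).congr_deriv ?_
    rw [hc i 0 hev.self_of_nhds]
    have h3 : (c 0 : ℂ) ≠ 0 := Circle.coe_ne_zero _
    have halg : ∀ (z C : ℂ) (a b : ℝ), z ≠ 0 → C ≠ 0 → ((-(b : ℂ) * Complex.I * (C * z)) * z -
        C * z * (-(a : ℂ) * Complex.I * z)) / z ^ 2 / C = ((a - b : ℝ) : ℂ) * Complex.I := by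
      intro z C a b hz hC
      push_cast
      field_simp
      ring
    exact halg _ _ k k' hi h3
  -- A real angle with the value `q.2` at time zero. Division by `c 0` moves the argument to `1`,
  -- away from the cut of `arg`, which makes `θ` differentiable there.
  let θ : ℝ → ℝ := fun t => q.2 + Complex.arg (c t / c 0 : Circle)
  have hθ0 : θ 0 = q.2 := by simp [θ]
  have hθ : HasDerivAt θ (k - k') 0 := by
    have h1 : ((c 0 / c 0 : Circle) : ℂ) = 1 := by simp
    have h2 := hcd.clog_real (by rw [h1]; exact Complex.one_mem_slitPlane)
    have h3 := (Complex.imCLM.hasFDerivAt.comp_hasDerivAt (0 : ℝ) h2).const_add q.2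
    have h4 : θ = fun t => q.2 + (Complex.imCLM ∘ fun t => Complex.log (c t / c 0 : Circle)) t :=
      funext fun t => by simp [θ, Complex.log_im]
    rw [h4]
    refine h3.congr_deriv ?_
    rw [h1, div_one]
    simp
  have hγθ : γ =ᶠ[𝓝 0] fun s => rollingParam f f' (y s, θ s) := by
    filter_upwards [hev] with t ht
    refine (rollingParam_eq f f' (p := γ t) ht.2 ?_).symm
    simp only [θ, Circle.exp_add, Circle.exp_arg, hc0]
    exact mul_div_cancel _ _
  have hvel := velocityAt_prod hy
  -- The hypothesis on the velocity is the no-slip condition at the single time zero, and this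
  -- suffices to determine the velocity.
  have hslip : (γ 0).fiber.1 (velocityAt (𝓡 2) (fun t => (y t).1) 0) =
      velocityAt (𝓡 2) (fun t => (y t).2) 0 := by
    rw [hvel] at hb
    exact (tangentProd_mem_graphPlane _ _ _ _).1 hb
  have hv2 : frameVec f' (y 0).2 (c 0 * frameCoord f (y 0).1 (velocityAt (𝓡 2) (fun t => (y t).1) 0)) =
      velocityAt (𝓡 2) (fun t => (y t).2) 0 := by
    rw [← hslip, ← frameVec_frameCoord f' hyD.2 ((γ 0).fiber.1 _)]
    exact congrArg _ (frameCoord_fiber f f' (p := γ 0) hyD _).symm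
  refine ⟨frameCoord f (y 0).1 (velocityAt (𝓡 2) (fun t => (y t).1) 0), ?_⟩
  have hq' : (y 0, θ 0) = q := Prod.ext hy0 hθ0
  have hvec : rollingVector f f' (y 0, θ 0)
      (frameCoord f (y 0).1 (velocityAt (𝓡 2) (fun t => (y t).1) 0)) =
        (velocityAt ((𝓡 2).prod (𝓡 2)) y 0, k - k') := by
    rw [rollingVector_apply]
    simp only [hθ0, hc0]
    rw [hv2, frameVec_frameCoord f hyD.1, hvel]
  refine (velocity_rollingParam f f' hy hyD hθ hγθ).trans ((congrArg (fun v =>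
    (⟨rollingParam f f' (y 0, θ 0), mfderiv (((𝓡 2).prod (𝓡 2)).prod 𝓘(ℝ, ℝ))
      (((𝓡 2).prod (𝓡 2)).prod (𝓡 1)) (rollingParam f f') (y 0, θ 0) v⟩ :
      TangentBundle (((𝓡 2).prod (𝓡 2)).prod (𝓡 1)) (RollingSpace g₁ o₁ g₂ o₂))) hvec.symm).trans ?_)
  change (⟨rollingParam f f' (y 0, θ 0), rollingLift f f' (y 0, θ 0) _⟩ :
      TangentBundle (((𝓡 2).prod (𝓡 2)).prod (𝓡 1)) (RollingSpace g₁ o₁ g₂ o₂)) = _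
  rw [hq']

end Horizontal

/-! ### Comparison of the two distributions -/

section Distributions

variable {S₁ : Type*} [TopologicalSpace S₁] [ChartedSpace (EuclideanSpace ℝ (Fin 2)) S₁]
  [IsManifold (𝓡 2) ∞ S₁]
  {S₂ : Type*} [TopologicalSpace S₂] [ChartedSpace (EuclideanSpace ℝ (Fin 2)) S₂]
  [IsManifold (𝓡 2) ∞ S₂]
  {g₁ : SurfaceMetric S₁} {o₁ : SurfaceOrientation S₁}
  {g₂ : SurfaceMetric S₂} {o₂ : SurfaceOrientation S₂}

theorem exists_rollingParam (p : RollingSpace g₁ o₁ g₂ o₂) :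
    ∃ (f : SurfaceFrame g₁ o₁) (f' : SurfaceFrame g₂ o₂) (q : (S₁ × S₂) × ℝ),
      q.1 ∈ f.dom ×ˢ f'.dom ∧ rollingParam f f' q = p := by
  obtain ⟨f, f', h⟩ := exists_splitFrame_pair g₁ o₁ g₂ o₂ p.base
  obtain ⟨θ, hθ⟩ := Circle.exp_surjective (rollingTriv f f' p).2
  exact ⟨f, f', (p.base, θ), h, rollingParam_eq f f' h hθ⟩

theorem mdifferentiableAt_rolling_base {γ : ℝ → RollingSpace g₁ o₁ g₂ o₂} {ε : ℝ} (hε : 0 < ε)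
    (hγ : ContMDiffOn 𝓘(ℝ, ℝ) (((𝓡 2).prod (𝓡 2)).prod (𝓡 1)) ∞ γ (Ioo (-ε) ε)) :
    MDifferentiableAt 𝓘(ℝ, ℝ) ((𝓡 2).prod (𝓡 2)) (fun t => (γ t).base) 0 :=
  ((contMDiff_rolling_base.comp_contMDiffOn hγ).contMDiffAt
    (Ioo_mem_nhds (by linarith) hε)).mdifferentiableAt (by simp)

theorem NoSlip.velocityAt_mem_graphPlane {γ : ℝ → RollingSpace g₁ o₁ g₂ o₂} {ε : ℝ} (hε : 0 < ε)
    (hγ : ContMDiffOn 𝓘(ℝ, ℝ) (((𝓡 2).prod (𝓡 2)).prod (𝓡 1)) ∞ γ (Ioo (-ε) ε))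
    (hS : NoSlip γ (Ioo (-ε) ε)) : velocityAt ((𝓡 2).prod (𝓡 2)) (fun t => (γ t).base) 0 ∈
      graphPlane (γ 0).base (γ 0).fiber.1 := by
  rw [velocityAt_prod (mdifferentiableAt_rolling_base hε hγ)]
  exact (tangentProd_mem_graphPlane _ _ _ _).2 (hS 0 ⟨by linarith, hε⟩)

/-- The graphs of a rolling motion form a horizontal curve near time zero, with base velocity in the
plane, which forces the velocity into the range of the lift. The differential equation realizes
every vector of that range. This makes the set of velocities visibly a linear subspace. -/
theorem mem_rollingDistribution_iff (f : SurfaceFrame g₁ o₁) (f' : SurfaceFrame g₂ o₂)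
    {q : (S₁ × S₂) × ℝ} (hq : q.1 ∈ f.dom ×ˢ f'.dom)
    (v : TangentSpace (((𝓡 2).prod (𝓡 2)).prod (𝓡 1)) (rollingParam f f' q)) :
    (⟨rollingParam f f' q, v⟩ :
      TangentBundle (((𝓡 2).prod (𝓡 2)).prod (𝓡 1)) (RollingSpace g₁ o₁ g₂ o₂)) ∈
      rollingDistribution g₁ o₁ g₂ o₂ ↔ v ∈ LinearMap.range (rollingLift f f' q) := by
  constructor
  · rintro ⟨γ, ε, hε, hγ, hS, hT, hv⟩
    obtain ⟨δ, hδ, hδε, hH⟩ := exists_isHorizontal_of_noTwist hε hγ hT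
    obtain ⟨w, hw⟩ := exists_velocity_eq_rollingLift f f' hq hδ
      (hγ.mono (Ioo_subset_Ioo (by linarith) hδε)) hH (hS.velocityAt_mem_graphPlane hε hγ)
      (congrArg TotalSpace.proj hv).symm
    exact ⟨w, (TotalSpace.mk_injective _ (hv.trans hw)).symm⟩
  · rintro ⟨w, rfl⟩
    exact rollingLift_mem_rollingDistribution f f' hq w

theorem tangentMap_velocity_graphDiffeo {γ : ℝ → RollingSpace g₁ o₁ g₂ o₂} {ε : ℝ} (hε : 0 < ε)
    (hγ : ContMDiffOn 𝓘(ℝ, ℝ) (((𝓡 2).prod (𝓡 2)).prod (𝓡 1)) ∞ γ (Ioo (-ε) ε)) :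
    tangentMap (((𝓡 2).prod (𝓡 2)).prod (𝓡 1)) (((𝓡 2).prod (𝓡 2)).prod (𝓡 1))
        (graphDiffeo g₁ o₁ g₂ o₂) (velocity (((𝓡 2).prod (𝓡 2)).prod (𝓡 1)) γ 0) =
      velocity (((𝓡 2).prod (𝓡 2)).prod (𝓡 1)) (graphDiffeo g₁ o₁ g₂ o₂ ∘ γ) 0 := by
  have h1 : MDifferentiableAt 𝓘(ℝ, ℝ) (((𝓡 2).prod (𝓡 2)).prod (𝓡 1)) γ 0 :=
    (hγ.contMDiffAt (Ioo_mem_nhds (by linarith) hε)).mdifferentiableAt (by simp)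
  have h2 := ((graphDiffeo g₁ o₁ g₂ o₂).mdifferentiable (by simp)).mdifferentiableAt (x := γ 0)
  have h3 := mfderiv_comp (0 : ℝ) h2 h1
  exact congrArg (fun T : ℝ →L[ℝ] ((EuclideanSpace ℝ (Fin 2) × EuclideanSpace ℝ (Fin 2)) ×
    EuclideanSpace ℝ (Fin 1)) => (⟨graphDiffeo g₁ o₁ g₂ o₂ (γ 0), T 1⟩ :
    TangentBundle (((𝓡 2).prod (𝓡 2)).prod (𝓡 1)) (TwistorBundle (splitProduct g₁ o₁ g₂ o₂)))) h3.symm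

/-- The graphs of a rolling motion near time zero form a curve admitted in the twistor distribution.
A curve of the latter kind, pulled back, may slip for `t ≠ 0`; it is exchanged for a rolling motion
with the same velocity at time zero. -/
theorem tangentMap_image_rollingDistribution :
    tangentMap (((𝓡 2).prod (𝓡 2)).prod (𝓡 1)) (((𝓡 2).prod (𝓡 2)).prod (𝓡 1))
        (graphDiffeo g₁ o₁ g₂ o₂) '' rollingDistribution g₁ o₁ g₂ o₂ =
      twistorDistribution (splitProduct g₁ o₁ g₂ o₂) := by
  apply Subset.antisymm
  · rintro _ ⟨_, ⟨γ, ε, hε, hγ, hS, hT, rfl⟩, rfl⟩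
    obtain ⟨δ, hδ, hδε, hH⟩ := exists_isHorizontal_of_noTwist hε hγ hT
    have hγ' := hγ.mono (Ioo_subset_Ioo (neg_le_neg hδε) hδε)
    exact ⟨graphDiffeo g₁ o₁ g₂ o₂ ∘ γ, δ, hδ,
      (graphDiffeo g₁ o₁ g₂ o₂).contMDiff.comp_contMDiffOn hγ', hH,
      hS.velocityAt_mem_graphPlane hε hγ, tangentMap_velocity_graphDiffeo hδ hγ'⟩
  · rintro _ ⟨η, ε, hε, hη, hH, hb, rfl⟩
    obtain ⟨γ, rfl⟩ : ∃ γ : ℝ → RollingSpace g₁ o₁ g₂ o₂, graphDiffeo g₁ o₁ g₂ o₂ ∘ γ = η :=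
      ⟨(graphDiffeo g₁ o₁ g₂ o₂).symm ∘ η,
        funext fun t => (graphDiffeo g₁ o₁ g₂ o₂).apply_symm_apply (η t)⟩
    have hγ : ContMDiffOn 𝓘(ℝ, ℝ) (((𝓡 2).prod (𝓡 2)).prod (𝓡 1)) ∞ γ (Ioo (-ε) ε) :=
      ((graphDiffeo g₁ o₁ g₂ o₂).symm.contMDiff.comp_contMDiffOn hη).congr fun t _ =>
        ((graphDiffeo g₁ o₁ g₂ o₂).symm_apply_apply (γ t)).symm
    refine ⟨velocity (((𝓡 2).prod (𝓡 2)).prod (𝓡 1)) γ 0, ?_,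
      tangentMap_velocity_graphDiffeo hε hγ⟩
    obtain ⟨f, f', q, hq, hp⟩ := exists_rollingParam (γ 0)
    obtain ⟨w, hw⟩ := exists_velocity_eq_rollingLift f f' hq hε hγ hH hb hp.symm
    rw [hw]
    exact rollingLift_mem_rollingDistribution f f' hq w

theorem isPlaneField_rollingDistribution : IsPlaneField 2 (rollingDistribution g₁ o₁ g₂ o₂) := by
  intro p
  obtain ⟨f, f', q, hq, rfl⟩ := exists_rollingParam p
  refine ⟨LinearMap.range (rollingLift f f' q), ?_, mem_rollingDistribution_iff f f' hq⟩
  rw [LinearMap.finrank_range_of_inj (rollingLift_injective f f' hq), Complex.finrank_real_complex]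

/-- The derivative of the diffeomorphism is a linear isomorphism of tangent spaces, so the plane of
rolling velocities is carried to a plane. -/
theorem isPlaneField_twistorDistribution :
    IsPlaneField 2 (twistorDistribution (splitProduct g₁ o₁ g₂ o₂)) := by
  intro P
  obtain ⟨p, rfl⟩ := (graphDiffeo g₁ o₁ g₂ o₂).surjective P
  obtain ⟨W, hW, hmem⟩ := isPlaneField_rollingDistribution p
  let L := (graphDiffeo g₁ o₁ g₂ o₂).mfderivToContinuousLinearEquiv (by simp) p
  refine ⟨W.map L.toLinearEquiv.toLinearMap, ?_, fun w => ?_⟩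
  · exact (LinearEquiv.finrank_map_eq L.toLinearEquiv W).trans hW
  rw [← tangentMap_image_rollingDistribution]
  constructor
  · rintro ⟨⟨p', v⟩, hv, hvw⟩
    -- Injectivity of the diffeomorphism ensures that only vectors based at `p` contribute over its
    -- image.
    obtain rfl : p' = p := (graphDiffeo g₁ o₁ g₂ o₂).injective (congrArg TotalSpace.proj hvw)
    exact ⟨v, (hmem v).1 hv, TotalSpace.mk_injective _ hvw⟩
  · rintro ⟨v, hv, rfl⟩
    exact ⟨⟨p, v⟩, (hmem v).2 hv, rfl⟩

end Distributions

end

theorem theorem2p1 {S₁ : Type*} [TopologicalSpace S₁] [ChartedSpace (EuclideanSpace ℝ (Fin 2)) S₁]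
    [IsManifold (𝓡 2) ∞ S₁]
    {S₂ : Type*} [TopologicalSpace S₂] [ChartedSpace (EuclideanSpace ℝ (Fin 2)) S₂]
    [IsManifold (𝓡 2) ∞ S₂]
    (g₁ : SurfaceMetric S₁) (o₁ : SurfaceOrientation S₁)
    (g₂ : SurfaceMetric S₂) (o₂ : SurfaceOrientation S₂) :
    ∃ Φ : Diffeomorph (((𝓡 2).prod (𝓡 2)).prod (𝓡 1)) (((𝓡 2).prod (𝓡 2)).prod (𝓡 1))
        (RollingSpace g₁ o₁ g₂ o₂) (TwistorBundle (splitProduct g₁ o₁ g₂ o₂)) ∞,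
      (∀ p : RollingSpace g₁ o₁ g₂ o₂, ∃ N : TwistorFiber (splitProduct g₁ o₁ g₂ o₂) p.base,
        Φ p = ⟨p.base, N⟩ ∧
        ∀ w : TangentSpace ((𝓡 2).prod (𝓡 2)) p.base, w ∈ N.1 ↔
          p.fiber.1 (mfderiv ((𝓡 2).prod (𝓡 2)) (𝓡 2) (Prod.fst : S₁ × S₂ → S₁) p.base w) =
            mfderiv ((𝓡 2).prod (𝓡 2)) (𝓡 2) (Prod.snd : S₁ × S₂ → S₂) p.base w) ∧
      tangentMap (((𝓡 2).prod (𝓡 2)).prod (𝓡 1)) (((𝓡 2).prod (𝓡 2)).prod (𝓡 1)) Φ ''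
          rollingDistribution g₁ o₁ g₂ o₂ = twistorDistribution (splitProduct g₁ o₁ g₂ o₂) ∧
      IsPlaneField 2 (rollingDistribution g₁ o₁ g₂ o₂) ∧
      IsPlaneField 2 (twistorDistribution (splitProduct g₁ o₁ g₂ o₂)) :=
  -- The graph is defined as the equalizer of `A` after the derivative of the first projection with
  -- the derivative of the second, so the description of the plane holds by definition.
  ⟨graphDiffeo g₁ o₁ g₂ o₂, fun p => ⟨graphFiber p.base p.fiber, rfl, fun _ => Iff.rfl⟩,
    tangentMap_image_rollingDistribution, isPlaneField_rollingDistribution,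
    isPlaneField_twistorDistribution⟩
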